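/- Let $B$ be a (unital, associative) $*$-algebra over $\mathbb C$ and put $A=B^{op}$. Let $\mathcal H=(\mathcal L,\mathcal R,S)$ be a full $*$-Hopf algebroid, that is: - $\mathcal L$ is a left $B$-bialgebroid with source $s_L$, target $t_L$, counit $\varepsilon_L$ (with $\varepsilon_L(1)=1$) and coproduct $\Delta_L(X)=X_{(1)}\otimes_B X_{(2)}$, and $S:\mathcal L\to\mathcal L$ is an invertible anti-algebra map with $S\circ t_L=s_L$, $(S^{-1}X_{(2)})_{(1)}\otimes_B(S^{-1}X_{(2)})_{(2)}X_{(1)}=S^{-1}(X)\otimes_B1$ and $S(X_{(1)})_{(1)}X_{(2)}\otimes_BS(X_{(1)})_{(2)}=1\otimes_BS(X)$; - $\mathcal R$ is the right $A$-bialgebroid with the same algebra as $\mathcal L$ and $s_R=t_L$, $t_R=S^{-1}\circ t_L$, $\varepsilon_R=\varepsilon_L\circ S$, $\Delta_R(X)=X_{[1]}\otimes_A X_{[2]}=S^{-1}(S(X)_{(2)})\otimes_AS^{-1}(S(X)_{(1)})$; - the algebra $\mathcal L$ is a $*$-algebra with $s_L(b)^*=t_R(b^*)$, $t_L(b)^*=s_R(b^*)$,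 $\varepsilon_L(X^*)=\varepsilon_R(X)^*$ and $\Delta_R(X^*)=X_{(1)}{}^*\otimes_A X_{(2)}{}^*$. Let $\mathcal{YD}^{\mathcal H}_{\mathcal R}$ be the category of full right-right Yetter–Drinfeld modules. An object is an $A$-bimodule $\Gamma$ with a right action $\triangleleft$ of the algebra $\mathcal R$ such that $a\rho a'=\rho\triangleleft t_R(a)s_R(a')$, a right $\mathcal R$-comodule structure $\delta_R(\rho)=\rho_{[0]}\otimes_A\rho_{[1]}$ and a right $\mathcal L$-comodule structure $\delta_L(\rho)=\rho_{(0)}\otimes_B\rho_{(1)}$ on the same bimodule (both coassociative and counital, with $\delta_R(a\rho a')=\rho_{[0]}\otimes s_R(a)\rho_{[1]}s_R(a')$, $\delta_L(a\rho a')=\rho_{(0)}\otimes t_L(a)\rho_{(1)}t_L(a')$, and with values in the Takeuchi products: $a\rho_{[0]}\otimes_A\rho_{[1]}=\rho_{[0]}\otimes_At_R(a)\rho_{[1]}$, $\rho_{(0)}b\otimes_B\rho_{(1)}=\rho_{(0)}\otimes_B\rho_{(1)}s_L(b)$; here $\rho a\otimes_AX=\rho\otimes_AXt_R(a)$ and $b\rho\otimes_BX=\rho\otimes_Bs_L(b)X$),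 such that $({\rm id}\otimes_B\Delta_R)\delta_L=(\delta_L\otimes_A{\rm id})\delta_R$, $({\rm id}\otimes_A\Delta_L)\delta_R=(\delta_R\otimes_B{\rm id})\delta_L$ and $$(\rho\triangleleft X_{[2]})_{[0]}\otimes_AX_{[1]}(\rho\triangleleft X_{[2]})_{[1]}=\rho_{[0]}\triangleleft X_{[1]}\otimes_A\rho_{[1]}X_{[2]}.$$ Morphisms are the linear maps that respect the bimodule structures, the actions and both coactions. Then: 1. $\mathcal{YD}^{\mathcal H}_{\mathcal R}$ is a monoidal category with tensor product $\otimes_A$, unit object $A$ and the usual constraints. On $\Gamma\otimes_A\Lambda$ one has $(\rho\otimes\eta)\triangleleft X=\rho\triangleleft X_{[1]}\otimes\eta\triangleleft X_{[2]}$, $\delta_R(\rho\otimes\eta)=\rho_{[0]}\otimes\eta_{[0]}\otimes\rho_{[1]}\eta_{[1]}$ and $\delta_L(\rho\otimes\eta)=\rho_{(0)}\otimes\eta_{(0)}\otimes\rho_{(1)}\eta_{(1)}$; on $A$ one has $a\triangleleft X=\varepsilon_R(s_R(a)X)$, $\delta_R(a)=1\otimes s_R(a)$ and $\delta_L(a)=1\otimes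 t_L(a)$. It is braided by $\sigma(\rho\otimes\eta)=\eta_{[0]}\otimes\rho\triangleleft\eta_{[1]}$, with inverse $\sigma^{-1}(\eta\otimes\rho)=\rho\triangleleft S^{-1}(\eta_{(1)})\otimes\eta_{(0)}$. 2. $\mathcal{YD}^{\mathcal H}_{\mathcal R}$ is a bar category: there are a functor $V\mapsto\overline V$ from it to itself, natural isomorphisms $\Upsilon_{V,W}:\overline{V\otimes W}\to\overline W\otimes\overline V$ and $bb_V:V\to\overline{\overline V}$, and an isomorphism $\star:1\to\overline1$, such that (up to the associativity constraints) $({\rm id}\otimes\Upsilon_{U,V})\Upsilon_{U\otimes V,W}=(\Upsilon_{V,W}\otimes{\rm id})\Upsilon_{U,V\otimes W}$, $\Upsilon$ and $\star$ are compatible with the unit constraints, $\overline\star\circ\star=bb_1$ and $\overline{bb_V}=bb_{\overline V}$. Here $\overline\Gamma=\{\overline\rho:\rho\in\Gamma\}$ is the complex conjugate of the vector space $\Gamma$, with $$a\overline\rho a'=\overline{a'^*\rho a^*},\quad\overline\rho\triangleleft X=\overline{\rho\triangleleft S^{-1}(X^*)},\quad\delta_R(\overline\rho)=\overline{\rho_{(0)}}\otimes_A\rho_{(1)}{}^*,\quad\delta_L(\overline\rho)=\overline{\rho_{[0]}}\otimes_B\rho_{[1]}{}^*,$$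 and $\overline T(\overline\rho)=\overline{T(\rho)}$, $\Upsilon(\overline{\rho\otimes\eta})=\overline\eta\otimes\overline\rho$, $bb(\rho)=\overline{\overline\rho}$, $\star(a)=\overline{a^*}$. 3. The braiding is antireal: $\Upsilon_{X,Y}^{-1}\circ\sigma_{\overline X,\overline Y}=\overline{\sigma_{X,Y}^{-1}}\circ\Upsilon_{Y,X}^{-1}:\overline X\otimes\overline Y\to\overline{X\otimes Y}$ for all objects $X,Y$. -/

import Mathlib

open CategoryTheory MonoidalCategory MulOpposite
open scoped TensorProduct ComplexConjugate

universe u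

noncomputable section

/-! ### Balanced tensor products of complex vector spaces

All the tensor products `⊗_A`, `⊗_B` are quotients of the tensor product over `ℂ`. The two families
`f`, `g` of operators give the action of the base on the left and on the right factor that is
being balanced. -/

section Balanced

variable {I J M N P : Type*} [AddCommGroup M] [Module ℂ M] [AddCommGroup N] [Module ℂ N]
  [AddCommGroup P] [Module ℂ P]

/-- The relations `f a m ⊗ n = m ⊗ g a n`. -/
def balRel (f : I → Module.End ℂ M) (g : I → Module.End ℂ N) : Submodule ℂ (M ⊗[ℂ] N) :=
  Submodule.span ℂ {z | ∃ a m n, z = (f a m) ⊗ₜ[ℂ] n - m ⊗ₜ[ℂ] (g a n)}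

/-- The balanced tensor product: `M ⊗ N` modulo `f a m ⊗ n = m ⊗ g a n`. -/
def Bal (f : I → Module.End ℂ M) (g : I → Module.End ℂ N) : Type _ :=
  (M ⊗[ℂ] N) ⧸ balRel f g

instance (f : I → Module.End ℂ M) (g : I → Module.End ℂ N) : AddCommGroup (Bal f g) :=
  inferInstanceAs (AddCommGroup ((M ⊗[ℂ] N) ⧸ balRel f g))

instance (f : I → Module.End ℂ M) (g : I → Module.End ℂ N) : Module ℂ (Bal f g) :=
  inferInstanceAs (Module ℂ ((M ⊗[ℂ] N) ⧸ balRel f g))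

/-- The projection of `M ⊗ N` onto the balanced tensor product. -/
def Bal.mk (f : I → Module.End ℂ M) (g : I → Module.End ℂ N) : M ⊗[ℂ] N →ₗ[ℂ] Bal f g :=
  (balRel f g).mkQ

/-- The class of `m ⊗ n`, as a bilinear map. -/
def Bal.tmul (f : I → Module.End ℂ M) (g : I → Module.End ℂ N) : M →ₗ[ℂ] N →ₗ[ℂ] Bal f g :=
  (TensorProduct.mk ℂ M N).compr₂ (Bal.mk f g)

theorem Bal.tmul_balanced (f : I → Module.End ℂ M) (g : I → Module.End ℂ N) (a : I) (m : M)
    (n : N) : Bal.tmul f g (f a m) n = Bal.tmul f g m (g a n) := by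
  refine (Submodule.Quotient.eq _).2 (Submodule.subset_span ⟨a, m, n, rfl⟩)

/-- A balanced bilinear map descends to the balanced tensor product. -/
def Bal.lift (f : I → Module.End ℂ M) (g : I → Module.End ℂ N) (φ : M →ₗ[ℂ] N →ₗ[ℂ] P)
    (h : ∀ a m n, φ (f a m) n = φ m (g a n)) : Bal f g →ₗ[ℂ] P :=
  (balRel f g).liftQ (TensorProduct.lift φ) (by
    refine Submodule.span_le.2 ?_
    rintro _ ⟨a, m, n, rfl⟩
    simp [h])

@[simp] theorem Bal.lift_tmul (f : I → Module.End ℂ M) (g : I → Module.End ℂ N)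
    (φ : M →ₗ[ℂ] N →ₗ[ℂ] P) (h : ∀ a m n, φ (f a m) n = φ m (g a n)) (m : M) (n : N) :
    Bal.lift f g φ h (Bal.tmul f g m n) = φ m n := by
  exact ((balRel f g).liftQ_apply _ _).trans (TensorProduct.lift.tmul m n)

/-- `z = ∑ᵢ pᵢ ⊗ qᵢ`: the families `p`, `q` are Sweedler components of `z`. -/
def Bal.IsSum {f : I → Module.End ℂ M} {g : I → Module.End ℂ N} (z : Bal f g) {n : ℕ}
    (p : Fin n → M) (q : Fin n → N) : Prop :=
  z = ∑ i, Bal.tmul f g (p i) (q i)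

/-- The relations of the threefold balanced tensor product. -/
def balRel₃ (f₁ : I → Module.End ℂ M) (g₁ : I → Module.End ℂ N) (f₂ : J → Module.End ℂ N)
    (g₂ : J → Module.End ℂ P) : Submodule ℂ (M ⊗[ℂ] (N ⊗[ℂ] P)) :=
  Submodule.span ℂ
    ({z | ∃ a m n p, z = (f₁ a m) ⊗ₜ[ℂ] (n ⊗ₜ[ℂ] p) - m ⊗ₜ[ℂ] ((g₁ a n) ⊗ₜ[ℂ] p)} ∪
     {z | ∃ b m n p, z = m ⊗ₜ[ℂ] ((f₂ b n) ⊗ₜ[ℂ] p) - m ⊗ₜ[ℂ] (n ⊗ₜ[ℂ] (g₂ b p))})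

/-- The threefold balanced tensor product: `M ⊗ N ⊗ P` modulo `f₁ a m ⊗ n ⊗ p = m ⊗ g₁ a n ⊗ p`
and `m ⊗ f₂ b n ⊗ p = m ⊗ n ⊗ g₂ b p`. -/
def Bal₃ (f₁ : I → Module.End ℂ M) (g₁ : I → Module.End ℂ N) (f₂ : J → Module.End ℂ N)
    (g₂ : J → Module.End ℂ P) : Type _ :=
  (M ⊗[ℂ] (N ⊗[ℂ] P)) ⧸ balRel₃ f₁ g₁ f₂ g₂

instance (f₁ : I → Module.End ℂ M) (g₁ : I → Module.End ℂ N) (f₂ : J → Module.End ℂ N)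
    (g₂ : J → Module.End ℂ P) : AddCommGroup (Bal₃ f₁ g₁ f₂ g₂) :=
  inferInstanceAs (AddCommGroup ((M ⊗[ℂ] (N ⊗[ℂ] P)) ⧸ balRel₃ f₁ g₁ f₂ g₂))

instance (f₁ : I → Module.End ℂ M) (g₁ : I → Module.End ℂ N) (f₂ : J → Module.End ℂ N)
    (g₂ : J → Module.End ℂ P) : Module ℂ (Bal₃ f₁ g₁ f₂ g₂) :=
  inferInstanceAs (Module ℂ ((M ⊗[ℂ] (N ⊗[ℂ] P)) ⧸ balRel₃ f₁ g₁ f₂ g₂))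

/-- The projection of `M ⊗ N ⊗ P` onto the threefold balanced tensor product. -/
def Bal₃.mk (f₁ : I → Module.End ℂ M) (g₁ : I → Module.End ℂ N) (f₂ : J → Module.End ℂ N)
    (g₂ : J → Module.End ℂ P) : M ⊗[ℂ] (N ⊗[ℂ] P) →ₗ[ℂ] Bal₃ f₁ g₁ f₂ g₂ :=
  (balRel₃ f₁ g₁ f₂ g₂).mkQ

/-- The class of `m ⊗ z` for `z` in the balanced tensor product of the last two factors:
`m ⊗ (n ⊗ p) ↦ m ⊗ n ⊗ p`. -/
def Bal₃.inr (f₁ : I → Module.End ℂ M) (g₁ : I → Module.End ℂ N) (f₂ : J → Module.End ℂ N)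
    (g₂ : J → Module.End ℂ P) (m : M) : Bal f₂ g₂ →ₗ[ℂ] Bal₃ f₁ g₁ f₂ g₂ :=
  (balRel f₂ g₂).liftQ (Bal₃.mk f₁ g₁ f₂ g₂ ∘ₗ TensorProduct.mk ℂ M (N ⊗[ℂ] P) m) (by
    refine Submodule.span_le.2 ?_
    rintro _ ⟨b, n, p, rfl⟩
    simp only [SetLike.mem_coe, LinearMap.mem_ker, LinearMap.comp_apply, map_sub,
      TensorProduct.mk_apply, sub_eq_zero]
    exact (Submodule.Quotient.eq _).2 (Submodule.subset_span (Or.inr ⟨b, m, n, p, rfl⟩)))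

/-- The class of `z ⊗ p` for `z` in the balanced tensor product of the first two factors:
`(m ⊗ n) ⊗ p ↦ m ⊗ n ⊗ p`. -/
def Bal₃.inl (f₁ : I → Module.End ℂ M) (g₁ : I → Module.End ℂ N) (f₂ : J → Module.End ℂ N)
    (g₂ : J → Module.End ℂ P) (z : Bal f₁ g₁) (p : P) : Bal₃ f₁ g₁ f₂ g₂ :=
  Bal.lift f₁ g₁
    (LinearMap.mk₂ ℂ (fun m n => Bal₃.mk f₁ g₁ f₂ g₂ (m ⊗ₜ[ℂ] (n ⊗ₜ[ℂ] p)))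
      (fun _ _ _ => by simp only [TensorProduct.add_tmul, map_add])
      (fun _ _ _ => by rw [← TensorProduct.smul_tmul', map_smul])
      (fun _ _ _ => by simp only [TensorProduct.add_tmul, TensorProduct.tmul_add, map_add])
      (fun _ _ _ => by
        rw [← TensorProduct.smul_tmul', TensorProduct.tmul_smul, map_smul]))
    (fun a m n =>
      (Submodule.Quotient.eq _).2 (Submodule.subset_span (Or.inl ⟨a, m, n, p, rfl⟩))) z

/-- The map `φ ⊗ id` on a balanced tensor product, for `φ` commuting with the balanced action. -/
def Bal.mapLeft (f : I → Module.End ℂ M) (g : I → Module.End ℂ N) (φ : Module.End ℂ M)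
    (hφ : ∀ a m, φ (f a m) = f a (φ m)) : Bal f g →ₗ[ℂ] Bal f g :=
  Bal.lift f g ((Bal.tmul f g).comp φ) (fun a m n => by
    simp [hφ, Bal.tmul_balanced])

/-- The map `id ⊗ ψ` on a balanced tensor product, for `ψ` commuting with the balanced action. -/
def Bal.mapRight (f : I → Module.End ℂ M) (g : I → Module.End ℂ N) (ψ : Module.End ℂ N)
    (hψ : ∀ a n, ψ (g a n) = g a (ψ n)) : Bal f g →ₗ[ℂ] Bal f g :=
  Bal.lift f g ((Bal.tmul f g).compl₂ ψ) (fun a m n => by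
    simp [hψ, Bal.tmul_balanced])

end Balanced

/-! ### Left bialgebroids and full Hopf algebroids -/

section Algebroids

variable (B H : Type u) [Ring B] [Algebra ℂ B] [Ring H] [Algebra ℂ H]

/-- The `B`-balanced tensor product `H ⊗_B H` of a left `B`-bialgebroid with source `s` and
target `t`, with respect to the bimodule structure `a.X.b = s a * t b * X`. -/
abbrev LTensor {B H : Type u} [Ring B] [Algebra ℂ B] [Ring H] [Algebra ℂ H]
    (s : B →ₐ[ℂ] H) (t : Bᵐᵒᵖ →ₐ[ℂ] H) : Type u :=
  Bal (fun b : B => LinearMap.mulLeft ℂ (t (op b))) (fun b : B => LinearMap.mulLeft ℂ (s b))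

/-- A left `B`-bialgebroid structure on the algebra `H`. The antialgebra map `t_L : B → H` is
written as an algebra map on `Bᵐᵒᵖ`. -/
structure LeftBialgebroid where
  /-- The source map. -/
  s : B →ₐ[ℂ] H
  /-- The target map. -/
  t : Bᵐᵒᵖ →ₐ[ℂ] H
  s_t_comm : ∀ a b, s a * t (op b) = t (op b) * s a
  /-- The coproduct. -/
  Δ : H →ₗ[ℂ] LTensor s t
  /-- The counit. -/
  ε : H →ₗ[ℂ] B
  /-- `Δ` is a `B`-bimodule map. -/
  Δ_bimod : ∀ (a b : B) (X : H) (n : ℕ) (p q : Fin n → H), (Δ X).IsSum p q →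
    (Δ (s a * t (op b) * X)).IsSum (fun i => s a * p i) (fun i => t (op b) * q i)
  /-- `ε` is a `B`-bimodule map. -/
  ε_bimod : ∀ (a b : B) (X : H), ε (s a * t (op b) * X) = a * ε X * b
  coassoc : ∀ (X : H) (n : ℕ) (p q : Fin n → H), (Δ X).IsSum p q →
    ∑ i, Bal₃.inl _ _ (fun b : B => LinearMap.mulLeft ℂ (t (op b)))
        (fun b : B => LinearMap.mulLeft ℂ (s b)) (Δ (p i)) (q i) =
      ∑ i, Bal₃.inr (fun b : B => LinearMap.mulLeft ℂ (t (op b)))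
        (fun b : B => LinearMap.mulLeft ℂ (s b)) _ _ (p i) (Δ (q i))
  counit_left : ∀ (X : H) (n : ℕ) (p q : Fin n → H), (Δ X).IsSum p q →
    ∑ i, s (ε (p i)) * q i = X
  counit_right : ∀ (X : H) (n : ℕ) (p q : Fin n → H), (Δ X).IsSum p q →
    ∑ i, t (op (ε (q i))) * p i = X
  /-- `Δ` has its image in the Takeuchi product. -/
  takeuchi : ∀ (X : H) (n : ℕ) (p q : Fin n → H), (Δ X).IsSum p q → ∀ a : B,
    ∑ i, Bal.tmul (fun b : B => LinearMap.mulLeft ℂ (t (op b)))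
        (fun b : B => LinearMap.mulLeft ℂ (s b)) (p i * t (op a)) (q i) =
      ∑ i, Bal.tmul (fun b : B => LinearMap.mulLeft ℂ (t (op b)))
        (fun b : B => LinearMap.mulLeft ℂ (s b)) (p i) (q i * s a)
  Δ_one : Δ 1 = Bal.tmul _ _ 1 1
  Δ_mul : ∀ (X Y : H) (n m : ℕ) (p q : Fin n → H) (p' q' : Fin m → H),
    (Δ X).IsSum p q → (Δ Y).IsSum p' q' →
    Δ (X * Y) = ∑ i, ∑ j, Bal.tmul _ _ (p i * p' j) (q i * q' j)
  ε_one : ε 1 = 1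
  ε_mul_s : ∀ X Y : H, ε (X * Y) = ε (X * s (ε Y))
  ε_mul_t : ∀ X Y : H, ε (X * Y) = ε (X * t (op (ε Y)))

/-- A full Hopf algebroid: a left `B`-bialgebroid with an invertible anti-algebra map `S`. -/
structure FullHopfAlgebroid extends LeftBialgebroid B H where
  /-- The antipode. -/
  S : H ≃ₗ[ℂ] H
  S_one : S 1 = 1
  S_mul : ∀ X Y, S (X * Y) = S Y * S X
  S_t : ∀ b : B, S (t (op b)) = s b
  /-- `(S⁻¹ X₂)₁ ⊗ (S⁻¹ X₂)₂ X₁ = S⁻¹ X ⊗ 1`. -/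
  S_symm_cond : ∀ (X : H) (n : ℕ) (p q : Fin n → H), (Δ X).IsSum p q →
    ∑ i, Bal.mapRight (fun b : B => LinearMap.mulLeft ℂ (t (op b)))
        (fun b : B => LinearMap.mulLeft ℂ (s b)) (LinearMap.mulRight ℂ (p i))
        (fun _ _ => mul_assoc _ _ _) (Δ (S.symm (q i))) =
      Bal.tmul _ _ (S.symm X) 1
  /-- `S(X₁)₁ X₂ ⊗ S(X₁)₂ = 1 ⊗ S X`. -/
  S_cond : ∀ (X : H) (n : ℕ) (p q : Fin n → H), (Δ X).IsSum p q →
    ∑ i, Bal.mapLeft (fun b : B => LinearMap.mulLeft ℂ (t (op b)))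
        (fun b : B => LinearMap.mulLeft ℂ (s b)) (LinearMap.mulRight ℂ (q i))
        (fun _ _ => mul_assoc _ _ _) (Δ (S (p i))) =
      Bal.tmul _ _ 1 (S X)

end Algebroids

namespace FullHopfAlgebroid

variable {B H : Type u} [Ring B] [Algebra ℂ B] [Ring H] [Algebra ℂ H]
variable (K : FullHopfAlgebroid B H)

theorem S_symm_mul (X Y : H) : K.S.symm (X * Y) = K.S.symm Y * K.S.symm X := by
  apply K.S.injective
  simp [K.S_mul]

theorem S_symm_s (b : B) : K.S.symm (K.s b) = K.t (op b) := by
  rw [← K.S_t, LinearEquiv.symm_apply_apply]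

/-! The right bialgebroid on the same algebra, over `A = Bᵐᵒᵖ`. -/

/-- The source map `s_R = t_L` of the right bialgebroid. -/
def sR (a : Bᵐᵒᵖ) : H := K.t a

/-- The target map `t_R = S⁻¹ ∘ t_L` of the right bialgebroid. -/
def tR (a : Bᵐᵒᵖ) : H := K.S.symm (K.t a)

/-- The counit `ε_R = ε_L ∘ S` of the right bialgebroid. -/
def εR (X : H) : Bᵐᵒᵖ := op (K.ε (K.S X))

/-- The actions of `B` balanced in `H ⊗_B H` (coproduct of the left bialgebroid):
`t_L(b) X ⊗ Y = X ⊗ s_L(b) Y`. -/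
abbrev lt (b : B) : Module.End ℂ H := LinearMap.mulLeft ℂ (K.t (op b))
/-- See `lt`. -/
abbrev ls (b : B) : Module.End ℂ H := LinearMap.mulLeft ℂ (K.s b)
/-- The actions of `A` balanced in `H ⊗_A H` (coproduct of the right bialgebroid):
`X s_R(a) ⊗ Y = X ⊗ Y t_R(a)`. -/
abbrev rs (a : Bᵐᵒᵖ) : Module.End ℂ H := LinearMap.mulRight ℂ (K.sR a)
/-- See `rs`. -/
abbrev rt (a : Bᵐᵒᵖ) : Module.End ℂ H := LinearMap.mulRight ℂ (K.tR a)

/-- The map `H ⊗_B H → H ⊗_A H`, `X ⊗ Y ↦ S⁻¹ Y ⊗ S⁻¹ X`. -/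
def flipS : Bal K.lt K.ls →ₗ[ℂ] Bal K.rs K.rt :=
  Bal.lift _ _ ((Bal.tmul K.rs K.rt).compl₁₂ K.S.symm.toLinearMap K.S.symm.toLinearMap).flip
    (fun b X Y => by
      have h := Bal.tmul_balanced K.rs K.rt (op b) (K.S.symm Y) (K.S.symm X)
      simpa [S_symm_mul, S_symm_s, sR, tR] using h.symm)

/-- The coproduct `Δ_R(X) = S⁻¹(S(X)₂) ⊗_A S⁻¹(S(X)₁)` of the right bialgebroid. -/
def ΔR : H →ₗ[ℂ] Bal K.rs K.rt := K.flipS ∘ₗ K.Δ ∘ₗ K.S.toLinearMap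

/-- The full Hopf algebroid is a full `*`-Hopf algebroid for the given `*`-algebra structures. -/
structure IsStar [StarRing B] [StarRing H] : Prop where
  star_s : ∀ b : B, star (K.s b) = K.tR (op (star b))
  star_t : ∀ b : B, star (K.t (op b)) = K.sR (op (star b))
  ε_star : ∀ X : H, op (K.ε (star X)) = star (K.εR X)
  Δ_star : ∀ (X : H) (n : ℕ) (p q : Fin n → H), (K.Δ X).IsSum p q →
    (K.ΔR (star X)).IsSum (fun i => star (p i)) (fun i => star (q i))

end FullHopfAlgebroid

/-! ### Full right-right Yetter–Drinfeld modules -/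

/-- An `A`-bimodule structure on a complex vector space `V`: `lact a v = a v`, `ract a v = v a`. -/
structure BimoduleStr (A V : Type u) [Ring A] [Algebra ℂ A] [AddCommGroup V] [Module ℂ V] where
  lact : A →ₗ[ℂ] Module.End ℂ V
  ract : A →ₗ[ℂ] Module.End ℂ V
  lact_one : ∀ v, lact 1 v = v
  lact_mul : ∀ a b v, lact (a * b) v = lact a (lact b v)
  ract_one : ∀ v, ract 1 v = v
  ract_mul : ∀ a b v, ract (a * b) v = ract b (ract a v)
  lact_ract : ∀ a b v, lact a (ract b v) = ract b (lact a v)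

section YD

variable {B H : Type u} [Ring B] [Algebra ℂ B] [Ring H] [Algebra ℂ H]

/-- A right module of the algebra `H` on the vector space `V`: `act X v = v ◁ X`. -/
structure RightModuleStr (H V : Type u) [Ring H] [Algebra ℂ H] [AddCommGroup V] [Module ℂ V] where
  act : H →ₗ[ℂ] Module.End ℂ V
  act_one : ∀ v, act 1 v = v
  act_mul : ∀ X Y v, act (X * Y) v = act Y (act X v)

/-- `V ⊗_A H`, with `v a ⊗ X = v ⊗ X t_R(a)`. -/
abbrev RTens (K : FullHopfAlgebroid B H) {V : Type u} [AddCommGroup V] [Module ℂ V]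
    (bim : BimoduleStr Bᵐᵒᵖ V) : Type u :=
  Bal (fun a => bim.ract a) K.rt

/-- `V ⊗_B H`, with `b v ⊗ X = v ⊗ s_L(b) X` (`b` in `B`, seen in `A = Bᵐᵒᵖ` on the left). -/
abbrev LTens (K : FullHopfAlgebroid B H) {V : Type u} [AddCommGroup V] [Module ℂ V]
    (bim : BimoduleStr Bᵐᵒᵖ V) : Type u :=
  Bal (fun b : B => bim.lact (op b)) K.ls

/-- A right comodule of the right `A`-bialgebroid of `K`. -/
structure RightRComodule (K : FullHopfAlgebroid B H) {V : Type u} [AddCommGroup V] [Module ℂ V]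
    (bim : BimoduleStr Bᵐᵒᵖ V) where
  /-- The coaction `v ↦ v_[0] ⊗_A v_[1]`. -/
  δ : V →ₗ[ℂ] RTens K bim
  δ_bimod : ∀ (a a' : Bᵐᵒᵖ) (v : V) (n : ℕ) (p : Fin n → V) (q : Fin n → H), (δ v).IsSum p q →
    (δ (bim.lact a (bim.ract a' v))).IsSum p (fun i => K.sR a * q i * K.sR a')
  takeuchi : ∀ (v : V) (n : ℕ) (p : Fin n → V) (q : Fin n → H), (δ v).IsSum p q → ∀ a : Bᵐᵒᵖ,
    ∑ i, Bal.tmul (fun a => bim.ract a) K.rt (bim.lact a (p i)) (q i) =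
      ∑ i, Bal.tmul (fun a => bim.ract a) K.rt (p i) (K.tR a * q i)
  coassoc : ∀ (v : V) (n : ℕ) (p : Fin n → V) (q : Fin n → H), (δ v).IsSum p q →
    ∑ i, Bal₃.inl (fun a => bim.ract a) K.rt K.rs K.rt (δ (p i)) (q i) =
      ∑ i, Bal₃.inr (fun a => bim.ract a) K.rt K.rs K.rt (p i) (K.ΔR (q i))
  counit : ∀ (v : V) (n : ℕ) (p : Fin n → V) (q : Fin n → H), (δ v).IsSum p q →
    ∑ i, bim.ract (K.εR (q i)) (p i) = v

/-- A right comodule of the left `B`-bialgebroid of `K`. -/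
structure RightLComodule (K : FullHopfAlgebroid B H) {V : Type u} [AddCommGroup V] [Module ℂ V]
    (bim : BimoduleStr Bᵐᵒᵖ V) where
  /-- The coaction `v ↦ v_(0) ⊗_B v_(1)`. -/
  δ : V →ₗ[ℂ] LTens K bim
  δ_bimod : ∀ (b b' : B) (v : V) (n : ℕ) (p : Fin n → V) (q : Fin n → H), (δ v).IsSum p q →
    (δ (bim.lact (op b) (bim.ract (op b') v))).IsSum p (fun i => K.t (op b) * q i * K.t (op b'))
  takeuchi : ∀ (v : V) (n : ℕ) (p : Fin n → V) (q : Fin n → H), (δ v).IsSum p q → ∀ b : B,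
    ∑ i, Bal.tmul (fun b : B => bim.lact (op b)) K.ls (bim.ract (op b) (p i)) (q i) =
      ∑ i, Bal.tmul (fun b : B => bim.lact (op b)) K.ls (p i) (q i * K.s b)
  coassoc : ∀ (v : V) (n : ℕ) (p : Fin n → V) (q : Fin n → H), (δ v).IsSum p q →
    ∑ i, Bal₃.inl (fun b : B => bim.lact (op b)) K.ls K.lt K.ls (δ (p i)) (q i) =
      ∑ i, Bal₃.inr (fun b : B => bim.lact (op b)) K.ls K.lt K.ls (p i) (K.Δ (q i))
  counit : ∀ (v : V) (n : ℕ) (p : Fin n → V) (q : Fin n → H), (δ v).IsSum p q →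
    ∑ i, bim.lact (op (K.ε (q i))) (p i) = v

/-- A full right-right Yetter–Drinfeld module of the full Hopf algebroid `K`: an `A`-bimodule
(`A = Bᵐᵒᵖ`) that is a right comodule of `K` and a right-right Yetter–Drinfeld module of the right
bialgebroid of `K`, all over the same bimodule structure. -/
structure FullYD (K : FullHopfAlgebroid B H) where
  carrier : Type u
  [addCommGroup : AddCommGroup carrier]
  [module : Module ℂ carrier]
  bim : BimoduleStr Bᵐᵒᵖ carrier
  mod : RightModuleStr H carrier
  /-- The bimodule structure is the one of the right module: `a v b = v ◁ t_R(a) s_R(b)`. -/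
  act_tR : ∀ (a : Bᵐᵒᵖ) (v : carrier), mod.act (K.tR a) v = bim.lact a v
  act_sR : ∀ (a : Bᵐᵒᵖ) (v : carrier), mod.act (K.sR a) v = bim.ract a v
  comodR : RightRComodule K bim
  comodL : RightLComodule K bim
  /-- `(id ⊗ Δ_R) ∘ δ_L = (δ_L ⊗ id) ∘ δ_R`. -/
  mixed_LR : ∀ (v : carrier) (n m : ℕ) (p : Fin n → carrier) (q : Fin n → H)
    (p' : Fin m → carrier) (q' : Fin m → H), (comodL.δ v).IsSum p q → (comodR.δ v).IsSum p' q' →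
    ∑ i, Bal₃.inr (fun b : B => bim.lact (op b)) K.ls K.rs K.rt (p i) (K.ΔR (q i)) =
      ∑ j, Bal₃.inl (fun b : B => bim.lact (op b)) K.ls K.rs K.rt (comodL.δ (p' j)) (q' j)
  /-- `(id ⊗ Δ_L) ∘ δ_R = (δ_R ⊗ id) ∘ δ_L`. -/
  mixed_RL : ∀ (v : carrier) (n m : ℕ) (p : Fin n → carrier) (q : Fin n → H)
    (p' : Fin m → carrier) (q' : Fin m → H), (comodR.δ v).IsSum p q → (comodL.δ v).IsSum p' q' →
    ∑ i, Bal₃.inr (fun a => bim.ract a) K.rt K.lt K.ls (p i) (K.Δ (q i)) =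
      ∑ j, Bal₃.inl (fun a => bim.ract a) K.rt K.lt K.ls (comodR.δ (p' j)) (q' j)
  /-- `(v ◁ X₂)₀ ⊗ X₁ (v ◁ X₂)₁ = v₀ ◁ X₁ ⊗ v₁ X₂`. -/
  yd : ∀ (v : carrier) (X : H) (n m : ℕ) (p q : Fin n → H) (w : Fin m → carrier) (y : Fin m → H),
    (K.ΔR X).IsSum p q → (comodR.δ v).IsSum w y →
    ∑ i, Bal.mapRight (fun a => bim.ract a) K.rt (LinearMap.mulLeft ℂ (p i))
        (fun _ _ => (mul_assoc _ _ _).symm) (comodR.δ (mod.act (q i) v)) =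
      ∑ i, ∑ j, Bal.tmul _ _ (mod.act (p i) (w j)) (y j * q i)

attribute [instance] FullYD.addCommGroup FullYD.module

namespace FullYD

variable {K : FullHopfAlgebroid B H}

/-- `a v`. -/
abbrev lact (V : FullYD K) (a : Bᵐᵒᵖ) : Module.End ℂ V.carrier := V.bim.lact a
/-- `v a`. -/
abbrev ract (V : FullYD K) (a : Bᵐᵒᵖ) : Module.End ℂ V.carrier := V.bim.ract a
/-- `v ◁ X`. -/
abbrev act (V : FullYD K) (X : H) : Module.End ℂ V.carrier := V.mod.act X
/-- The coaction of the right bialgebroid. -/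
abbrev δR (V : FullYD K) : V.carrier →ₗ[ℂ] RTens K V.bim := V.comodR.δ
/-- The coaction of the left bialgebroid. -/
abbrev δL (V : FullYD K) : V.carrier →ₗ[ℂ] LTens K V.bim := V.comodL.δ

/-- Morphisms: maps of bimodules, of right modules and of both comodules. -/
@[ext] structure Hom (V W : FullYD K) where
  map : V.carrier →ₗ[ℂ] W.carrier
  map_lact : ∀ a v, map (V.lact a v) = W.lact a (map v)
  map_ract : ∀ a v, map (V.ract a v) = W.ract a (map v)
  map_act : ∀ X v, map (V.act X v) = W.act X (map v)
  map_δR : ∀ (v : V.carrier) (n : ℕ) (p : Fin n → V.carrier) (q : Fin n → H),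
    (V.δR v).IsSum p q → (W.δR (map v)).IsSum (fun i => map (p i)) q
  map_δL : ∀ (v : V.carrier) (n : ℕ) (p : Fin n → V.carrier) (q : Fin n → H),
    (V.δL v).IsSum p q → (W.δL (map v)).IsSum (fun i => map (p i)) q

/-- The category of full right-right Yetter–Drinfeld modules. -/
instance : Category (FullYD K) where
  Hom := Hom
  id V :=
    { map := LinearMap.id
      map_lact := fun _ _ => rfl
      map_ract := fun _ _ => rfl
      map_act := fun _ _ => rfl
      map_δR := fun _ _ _ _ h => h
      map_δL := fun _ _ _ _ h => h }
  comp f g :=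
    { map := g.map ∘ₗ f.map
      map_lact := fun a v => by simp [f.map_lact, g.map_lact]
      map_ract := fun a v => by simp [f.map_ract, g.map_ract]
      map_act := fun X v => by simp [f.map_act, g.map_act]
      map_δR := fun v n p q h => g.map_δR _ n _ q (f.map_δR v n p q h)
      map_δL := fun v n p q h => g.map_δL _ n _ q (f.map_δL v n p q h) }

/-- The underlying linear map of a morphism. -/
abbrev lin {V W : FullYD K} (f : V ⟶ W) : V.carrier →ₗ[ℂ] W.carrier := Hom.map f

/-- `V ⊗_A W`, with `v a ⊗ w = v ⊗ a w`. -/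
abbrev Tens (V W : FullYD K) : Type u := Bal V.ract W.lact

/-- The class of `v ⊗ w` in `V ⊗_A W`. -/
abbrev tm {V W : FullYD K} (v : V.carrier) (w : W.carrier) : Tens V W :=
  Bal.tmul V.ract W.lact v w

end FullYD

/-- A monoidal structure on the category of full Yetter–Drinfeld modules is *the* one given by
`⊗_A` if the underlying space of `V ⊗ W` is identified with `V ⊗_A W`, with the actions
and coactions below, the unit object is identified with `A` and the constraints are the
evident ones. -/
structure TensorOverBase (K : FullHopfAlgebroid B H) [MonoidalCategory (FullYD K)] where
  /-- The underlying space of `V ⊗ W` is `V ⊗_A W`. -/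
  e : ∀ V W : FullYD K, FullYD.Tens V W ≃ₗ[ℂ] (V ⊗ W).carrier
  lact_e : ∀ (V W : FullYD K) (a : Bᵐᵒᵖ) (v : V.carrier) (w : W.carrier),
    (V ⊗ W).lact a (e V W (FullYD.tm v w)) = e V W (FullYD.tm (V.lact a v) w)
  ract_e : ∀ (V W : FullYD K) (a : Bᵐᵒᵖ) (v : V.carrier) (w : W.carrier),
    (V ⊗ W).ract a (e V W (FullYD.tm v w)) = e V W (FullYD.tm v (W.ract a w))
  /-- `(v ⊗ w) ◁ X = v ◁ X₁ ⊗ w ◁ X₂`. -/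
  act_e : ∀ (V W : FullYD K) (v : V.carrier) (w : W.carrier) (X : H) (n : ℕ) (p q : Fin n → H),
    (K.ΔR X).IsSum p q →
    (V ⊗ W).act X (e V W (FullYD.tm v w)) =
      ∑ i, e V W (FullYD.tm (V.act (p i) v) (W.act (q i) w))
  /-- `δ_R (v ⊗ w) = (v₀ ⊗ w₀) ⊗ v₁ w₁`. -/
  δR_e : ∀ (V W : FullYD K) (v : V.carrier) (w : W.carrier) (n m : ℕ)
    (p : Fin n → V.carrier) (x : Fin n → H) (q : Fin m → W.carrier) (y : Fin m → H),
    (V.δR v).IsSum p x → (W.δR w).IsSum q y →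
    (V ⊗ W).δR (e V W (FullYD.tm v w)) =
      ∑ i, ∑ j, Bal.tmul _ _ (e V W (FullYD.tm (p i) (q j))) (x i * y j)
  /-- `δ_L (v ⊗ w) = (v₀ ⊗ w₀) ⊗ v₁ w₁`. -/
  δL_e : ∀ (V W : FullYD K) (v : V.carrier) (w : W.carrier) (n m : ℕ)
    (p : Fin n → V.carrier) (x : Fin n → H) (q : Fin m → W.carrier) (y : Fin m → H),
    (V.δL v).IsSum p x → (W.δL w).IsSum q y →
    (V ⊗ W).δL (e V W (FullYD.tm v w)) =
      ∑ i, ∑ j, Bal.tmul _ _ (e V W (FullYD.tm (p i) (q j))) (x i * y j)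
  map_e : ∀ {V V' W W' : FullYD K} (f : V ⟶ V') (g : W ⟶ W') (v : V.carrier) (w : W.carrier),
    FullYD.lin (f ⊗ₘ g) (e V W (FullYD.tm v w)) =
      e V' W' (FullYD.tm (FullYD.lin f v) (FullYD.lin g w))
  assoc_e : ∀ (U V W : FullYD K) (u : U.carrier) (v : V.carrier) (w : W.carrier),
    FullYD.lin (α_ U V W).hom (e (U ⊗ V) W (FullYD.tm (e U V (FullYD.tm u v)) w)) =
      e U (V ⊗ W) (FullYD.tm u (e V W (FullYD.tm v w)))
  /-- The underlying space of the unit object is `A`. -/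
  ι : Bᵐᵒᵖ ≃ₗ[ℂ] (𝟙_ (FullYD K)).carrier
  lact_ι : ∀ a b : Bᵐᵒᵖ, (𝟙_ (FullYD K)).lact a (ι b) = ι (a * b)
  ract_ι : ∀ a b : Bᵐᵒᵖ, (𝟙_ (FullYD K)).ract a (ι b) = ι (b * a)
  act_ι : ∀ (X : H) (a : Bᵐᵒᵖ), (𝟙_ (FullYD K)).act X (ι a) = ι (K.εR (K.sR a * X))
  δR_ι : ∀ a : Bᵐᵒᵖ, (𝟙_ (FullYD K)).δR (ι a) = Bal.tmul _ _ (ι 1) (K.sR a)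
  δL_ι : ∀ a : Bᵐᵒᵖ, (𝟙_ (FullYD K)).δL (ι a) = Bal.tmul _ _ (ι 1) (K.t a)
  leftUnitor_e : ∀ (V : FullYD K) (a : Bᵐᵒᵖ) (v : V.carrier),
    FullYD.lin (λ_ V).hom (e _ V (FullYD.tm (ι a) v)) = V.lact a v
  rightUnitor_e : ∀ (V : FullYD K) (a : Bᵐᵒᵖ) (v : V.carrier),
    FullYD.lin (ρ_ V).hom (e V _ (FullYD.tm v (ι a))) = V.ract a v

/-- The braiding of the category is `σ(v ⊗ w) = w_[0] ⊗ v ◁ w_[1]`, with inverse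
`σ⁻¹(w ⊗ v) = v ◁ S⁻¹(w_(1)) ⊗ w_(0)`. -/
structure IsYDBraiding {K : FullHopfAlgebroid B H} [MonoidalCategory (FullYD K)]
    [BraidedCategory (FullYD K)] (T : TensorOverBase K) : Prop where
  hom_e : ∀ (V W : FullYD K) (v : V.carrier) (w : W.carrier) (n : ℕ)
    (q : Fin n → W.carrier) (y : Fin n → H), (W.δR w).IsSum q y →
    FullYD.lin (β_ V W).hom (T.e V W (FullYD.tm v w)) =
      ∑ i, T.e W V (FullYD.tm (q i) (V.act (y i) v))
  inv_e : ∀ (V W : FullYD K) (v : V.carrier) (w : W.carrier) (n : ℕ)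
    (q : Fin n → W.carrier) (y : Fin n → H), (W.δL w).IsSum q y →
    FullYD.lin (β_ V W).inv (T.e W V (FullYD.tm w v)) =
      ∑ i, T.e V W (FullYD.tm (V.act (K.S.symm (y i)) v) (q i))

end YD

/-! ### Bar categories -/

/-- A bar category structure on a monoidal category: a functor `bar` that is (strong) monoidal for
the reversed tensor product on the target, with the associativity and unit constraints written
out, and a natural isomorphism `bb` from the identity to `bar ∘ bar`. -/
structure BarCategory (C : Type*) [Category C] [MonoidalCategory C] where
  bar : C ⥤ C
  /-- `Υ : bar (X ⊗ Y) ≅ bar Y ⊗ bar X`. -/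
  Υ : ∀ X Y : C, bar.obj (X ⊗ Y) ≅ bar.obj Y ⊗ bar.obj X
  Υ_natural : ∀ {X X' Y Y' : C} (f : X ⟶ X') (g : Y ⟶ Y'),
    bar.map (f ⊗ₘ g) ≫ (Υ X' Y').hom = (Υ X Y).hom ≫ (bar.map g ⊗ₘ bar.map f)
  /-- `⋆ : 1 ≅ bar 1`. -/
  starIso : 𝟙_ C ≅ bar.obj (𝟙_ C)
  Υ_assoc : ∀ X Y Z : C,
    (Υ (X ⊗ Y) Z).hom ≫ (bar.obj Z ◁ (Υ X Y).hom) =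
      bar.map (α_ X Y Z).hom ≫ (Υ X (Y ⊗ Z)).hom ≫ ((Υ Y Z).hom ▷ bar.obj X) ≫
        (α_ (bar.obj Z) (bar.obj Y) (bar.obj X)).hom
  Υ_unit_left : ∀ X : C,
    (Υ (𝟙_ C) X).hom ≫ (bar.obj X ◁ starIso.inv) ≫ (ρ_ (bar.obj X)).hom = bar.map (λ_ X).hom
  Υ_unit_right : ∀ X : C,
    (Υ X (𝟙_ C)).hom ≫ (starIso.inv ▷ bar.obj X) ≫ (λ_ (bar.obj X)).hom = bar.map (ρ_ X).hom
  /-- `bb : id ≅ bar ∘ bar`. -/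
  bb : 𝟭 C ≅ bar ⋙ bar
  star_star : starIso.hom ≫ bar.map starIso.hom = bb.hom.app (𝟙_ C)
  bar_bb : ∀ X : C, bar.map (bb.hom.app X) = bb.hom.app (bar.obj X)

/-- The braiding is antireal: `Υ⁻¹ ∘ σ = bar(σ⁻¹) ∘ Υ⁻¹` from `bar X ⊗ bar Y` to `bar (X ⊗ Y)`. -/
def BarCategory.IsAntireal {C : Type*} [Category C] [MonoidalCategory C] [BraidedCategory C]
    (b : BarCategory C) : Prop :=
  ∀ X Y : C, (β_ (b.bar.obj X) (b.bar.obj Y)).hom ≫ (b.Υ X Y).inv =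
    (b.Υ Y X).inv ≫ b.bar.map (β_ X Y).inv

/-- The bar structure on full Yetter–Drinfeld modules is the one of conjugates: the underlying
space of `bar V` is the complex conjugate `{v̄}` of that of `V`, with the actions and coactions
below, and `bar`, `Υ`, `⋆`, `bb` are those of the underlying `A`-bimodules. -/
structure BarOfConjugates {B H : Type u} [Ring B] [Algebra ℂ B] [Ring H] [Algebra ℂ H]
    [StarRing B] [StarRing H] {K : FullHopfAlgebroid B H}
    [MonoidalCategory (FullYD K)] (T : TensorOverBase K) (b : BarCategory (FullYD K)) where
  /-- The antilinear bijection `v ↦ v̄`. -/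
  c : ∀ V : FullYD K, V.carrier ≃ₛₗ[starRingEnd ℂ] (b.bar.obj V).carrier
  /-- `a v̄ = (v a*)‾`. -/
  lact_c : ∀ (V : FullYD K) (a : Bᵐᵒᵖ) (v : V.carrier),
    (b.bar.obj V).lact a (c V v) = c V (V.ract (star a) v)
  /-- `v̄ a = (a* v)‾`. -/
  ract_c : ∀ (V : FullYD K) (a : Bᵐᵒᵖ) (v : V.carrier),
    (b.bar.obj V).ract a (c V v) = c V (V.lact (star a) v)
  /-- `v̄ ◁ X = (v ◁ S⁻¹(X*))‾`. -/
  act_c : ∀ (V : FullYD K) (X : H) (v : V.carrier),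
    (b.bar.obj V).act X (c V v) = c V (V.act (K.S.symm (star X)) v)
  /-- `δ_R(v̄) = (v_(0))‾ ⊗_A v_(1)*`. -/
  δR_c : ∀ (V : FullYD K) (v : V.carrier) (n : ℕ) (p : Fin n → V.carrier) (q : Fin n → H),
    (V.δL v).IsSum p q →
    ((b.bar.obj V).δR (c V v)).IsSum (fun i => c V (p i)) (fun i => star (q i))
  /-- `δ_L(v̄) = (v_[0])‾ ⊗_B v_[1]*`. -/
  δL_c : ∀ (V : FullYD K) (v : V.carrier) (n : ℕ) (p : Fin n → V.carrier) (q : Fin n → H),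
    (V.δR v).IsSum p q →
    ((b.bar.obj V).δL (c V v)).IsSum (fun i => c V (p i)) (fun i => star (q i))
  map_c : ∀ {V W : FullYD K} (f : V ⟶ W) (v : V.carrier),
    FullYD.lin (b.bar.map f) (c V v) = c W (FullYD.lin f v)
  Υ_c : ∀ (V W : FullYD K) (v : V.carrier) (w : W.carrier),
    FullYD.lin (b.Υ V W).hom (c (V ⊗ W) (T.e V W (FullYD.tm v w))) =
      T.e (b.bar.obj W) (b.bar.obj V) (FullYD.tm (c W w) (c V v))
  star_c : ∀ a : Bᵐᵒᵖ, FullYD.lin b.starIso.hom (T.ι a) = c (𝟙_ (FullYD K)) (T.ι (star a))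
  bb_c : ∀ (V : FullYD K) (v : V.carrier),
    FullYD.lin (b.bb.hom.app V) v = c (b.bar.obj V) (c V v)

end

/-! Every formula involves representatives of classes in quotients of tensor products over `ℂ`, so
the recurring question is well-definedness. `Bal.sw` separates it from the calculations. A linear
section of the projection onto the balanced tensor product and bases of the factors are fixed once,
which makes a Sweedler sum linear in the element for an arbitrary summand. Sums can then be nested
and exchanged freely (`Bal.sw_sw`, `Bal.sw_comm`). Balancedness of the summand (`IsBal`) is needed
only when one representative is replaced by another (`Bal.sw_tmul`, `Bal.IsSum.sw_eq`). In this
language each axiom is a rewriting rule for sums.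

The Hopf algebroid part rests on the antipode. Contracting its two axioms with the counit gives
`S(X₁) X₂ = t_L ε_L S(X)` and `S⁻¹(X₂) X₁ = s_L ε_L S⁻¹(X)`. Comparing the two shows that `s_L` and
`t_R` have the same image (`s_ε_S_symm`), so each coproduct is linear over the base of the other one
on the side where the mixed axioms need it. On a Yetter–Drinfeld module, the mixed axioms and these
identities make `v ⊗_B X ↦ v_[0] ⊗_A S⁻¹(X) v_[1]` bijective, with inverse `v ⊗_A X ↦ v_(0) ⊗_B
v_(1) S(X)`. The inverse sends `v ⊗ 1` to `δ_L(v)`, so `δ_L` is determined by `δ_R`. Two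
consequences carry the rest: a linear map compatible with the action and with `δ_R` is a morphism
(`Hom.ofR`), and the Yetter–Drinfeld condition has a version for `δ_L` (`sw_ydL`).

The tensor product carries the diagonal action and the product coactions; Takeuchi conditions make
them well defined, and the Yetter–Drinfeld condition follows from those of the two factors joined by
coassociativity of `Δ_R`. For the braiding, the condition on the second factor says that `σ` is a
module map, while the condition on the first factor and coassociativity say that it is a comodule
map. The mixed axioms and the antipode identities give its inverse. The hexagons express that `δ_R`
is multiplicative on tensor products and coassociative.

The involution carries `Δ_L` to `Δ_R`, so conjugation exchanges the two coactions; the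
Yetter–Drinfeld condition of the conjugate is therefore `sw_ydL` for the original module. The map
`bb` is a module map because `(S⁻¹(X*))* = S(X)`. This identity is derived as in the uniqueness of
an antipode: both sides convolve with the identity to the same element. Antireality is then a
comparison of two formulas on `v̄ ⊗ w̄`. -/

noncomputable section

/-! ### Sweedler sums -/

section SweedlerSums

variable {I J M N P Q M' N' : Type*} [AddCommGroup M] [Module ℂ M] [AddCommGroup N] [Module ℂ N]
  [AddCommGroup P] [Module ℂ P] [AddCommGroup Q] [Module ℂ Q]
  [AddCommGroup M'] [Module ℂ M'] [AddCommGroup N'] [Module ℂ N']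

/-- A bilinear map (as a plain function) that is balanced with respect to `f` and `g`. -/
structure IsBal (f : I → Module.End ℂ M) (g : I → Module.End ℂ N) (φ : M → N → P) : Prop where
  bal : ∀ a m n, φ (f a m) n = φ m (g a n)
  add_left : ∀ m m' n, φ (m + m') n = φ m n + φ m' n := by intros; simp [add_mul, mul_add]
  smul_left : ∀ (c : ℂ) m n, φ (c • m) n = c • φ m n := by intros; simp
  add_right : ∀ m n n', φ m (n + n') = φ m n + φ m n' := by intros; simp [add_mul, mul_add]
  smul_right : ∀ (c : ℂ) m n, φ m (c • n) = c • φ m n := by intros; simp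

/-- Summands are kept as plain functions so that rewriting can match lambda terms. A proof that
needs additivity or homogeneity first replaces the function by this bilinear map. -/
theorem IsBal.exists_bilin {f : I → Module.End ℂ M} {g : I → Module.End ℂ N} {φ : M → N → P}
    (h : IsBal f g φ) : ∃ ψ : M →ₗ[ℂ] N →ₗ[ℂ] P, φ = fun m n => ψ m n :=
  ⟨LinearMap.mk₂ ℂ φ h.add_left h.smul_left h.add_right h.smul_right, rfl⟩

/-- A trilinear map (as a plain function) that is balanced between the first and the second and
between the second and the third variables. -/
structure IsBal₃ (f₁ : I → Module.End ℂ M) (g₁ : I → Module.End ℂ N) (f₂ : J → Module.End ℂ N)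
    (g₂ : J → Module.End ℂ P) (τ : M → N → P → Q) : Prop where
  bal₁ : ∀ a m n p, τ (f₁ a m) n p = τ m (g₁ a n) p
  bal₂ : ∀ a m n p, τ m (f₂ a n) p = τ m n (g₂ a p)
  add₁ : ∀ m m' n p, τ (m + m') n p = τ m n p + τ m' n p := by intros; simp [add_mul, mul_add]
  smul₁ : ∀ (c : ℂ) m n p, τ (c • m) n p = c • τ m n p := by intros; simp
  add₂ : ∀ m n n' p, τ m (n + n') p = τ m n p + τ m n' p := by intros; simp [add_mul, mul_add]
  smul₂ : ∀ (c : ℂ) m n p, τ m (c • n) p = c • τ m n p := by intros; simp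
  add₃ : ∀ m n p p', τ m n (p + p') = τ m n p + τ m n p' := by intros; simp [add_mul, mul_add]
  smul₃ : ∀ (c : ℂ) m n p, τ m n (c • p) = c • τ m n p := by intros; simp

theorem IsBal₃.exists_trilin {f₁ : I → Module.End ℂ M} {g₁ : I → Module.End ℂ N}
    {f₂ : J → Module.End ℂ N} {g₂ : J → Module.End ℂ P} {τ : M → N → P → Q}
    (h : IsBal₃ f₁ g₁ f₂ g₂ τ) :
    ∃ ψ : M →ₗ[ℂ] N →ₗ[ℂ] P →ₗ[ℂ] Q, τ = fun m n p => ψ m n p :=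
  ⟨LinearMap.mk₂ ℂ (fun m n => (⟨⟨τ m n, h.add₃ m n⟩, fun c => h.smul₃ c m n⟩ : P →ₗ[ℂ] Q))
    (fun _ _ _ => LinearMap.ext (h.add₁ _ _ _)) (fun _ _ _ => LinearMap.ext (h.smul₁ _ _ _))
    (fun _ _ _ => LinearMap.ext (h.add₂ _ _ _)) (fun _ _ _ => LinearMap.ext (h.smul₂ _ _ _)), rfl⟩

namespace Bal

variable (f : I → Module.End ℂ M) (g : I → Module.End ℂ N)

theorem mk_surjective : Function.Surjective (Bal.mk f g) := Submodule.mkQ_surjective _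

/-- A linear section of the projection onto the balanced tensor product. -/
def sec : Bal f g →ₗ[ℂ] M ⊗[ℂ] N :=
  Classical.choose ((Bal.mk f g).exists_rightInverse_of_surjective
    (LinearMap.range_eq_top.2 (mk_surjective f g)))

theorem mk_sec (z : Bal f g) : Bal.mk f g (sec f g z) = z :=
  LinearMap.congr_fun (Classical.choose_spec ((Bal.mk f g).exists_rightInverse_of_surjective
    (LinearMap.range_eq_top.2 (mk_surjective f g)))) z

variable {f g}

/-- The Sweedler sum `∑ φ m n` over a representation `z = ∑ m ⊗ n` that depends linearly on `z`. -/
def sw (z : Bal f g) (φ : M → N → P) : P :=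
  Finsupp.linearCombination ℂ
    (fun i => φ (Module.Basis.ofVectorSpace ℂ M i.1) (Module.Basis.ofVectorSpace ℂ N i.2))
    (((Module.Basis.ofVectorSpace ℂ M).tensorProduct (Module.Basis.ofVectorSpace ℂ N)).repr
      (sec f g z))

@[simp] theorem sw_add (z z' : Bal f g) (φ : M → N → P) : sw (z + z') φ = sw z φ + sw z' φ := by
  simp [sw]

@[simp] theorem sw_smul (c : ℂ) (z : Bal f g) (φ : M → N → P) : sw (c • z) φ = c • sw z φ := by
  simp [sw]

theorem sw_def (z : Bal f g) (φ : M → N → P) : sw z φ =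
    (((Module.Basis.ofVectorSpace ℂ M).tensorProduct (Module.Basis.ofVectorSpace ℂ N)).repr
      (sec f g z)).sum (fun i c => c •
        φ (Module.Basis.ofVectorSpace ℂ M i.1) (Module.Basis.ofVectorSpace ℂ N i.2)) := rfl

@[simp] theorem sw_fun_add (z : Bal f g) (φ ψ : M → N → P) :
    sw z (fun m n => φ m n + ψ m n) = sw z φ + sw z ψ := by
  simp [sw_def]

theorem map_sw (L : P →ₗ[ℂ] Q) (z : Bal f g) (φ : M → N → P) :
    L (sw z φ) = sw z (fun m n => L (φ m n)) := by
  simp [sw_def, map_finsuppSum]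

@[simp] theorem sw_fun_smul (c : ℂ) (z : Bal f g) (φ : M → N → P) :
    sw z (fun m n => c • φ m n) = c • sw z φ := by
  have h := map_sw (LinearMap.lsmul ℂ P c) z φ
  simp only [LinearMap.lsmul_apply] at h
  exact h.symm

variable (f g) in
/-- The Sweedler sum as a linear map. -/
def swLin (φ : M → N → P) : Bal f g →ₗ[ℂ] P where
  toFun z := sw z φ
  map_add' _ _ := sw_add _ _ _
  map_smul' _ _ := sw_smul _ _ _

@[simp] theorem swLin_apply (φ : M → N → P) (z : Bal f g) : swLin f g φ z = sw z φ := rfl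

/-- No balancedness is involved: `sw · φ` is linear in the element for any function `φ`, and a
linear map passes through the outer sum. -/
theorem sw_sw {f' : J → Module.End ℂ M'} {g' : J → Module.End ℂ N'} (z : Bal f g)
    (ψ : M → N → Bal f' g') (φ : M' → N' → P) :
    sw (sw z ψ) φ = sw z (fun m n => sw (ψ m n) φ) :=
  map_sw (swLin f' g' φ) z ψ

/-- Both sides are finite double sums over the supports of two chosen expansions, so the exchange
needs no hypothesis on `φ`. Independent coproducts and coactions can thus be expanded in any order.
-/
theorem sw_comm {f' : J → Module.End ℂ M'} {g' : J → Module.End ℂ N'} (z : Bal f g)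
    (z' : Bal f' g') (φ : M → N → M' → N' → P) :
    sw z (fun m n => sw z' (fun m' n' => φ m n m' n')) =
      sw z' (fun m' n' => sw z (fun m n => φ m n m' n')) := by
  simp only [sw_def, Finsupp.sum, Finset.smul_sum]
  rw [Finset.sum_comm]
  exact Finset.sum_congr rfl fun _ _ => Finset.sum_congr rfl fun _ _ => smul_comm _ _ _

theorem sw_congr (z : Bal f g) {φ ψ : M → N → P} (h : ∀ m n, φ m n = ψ m n) : sw z φ = sw z ψ := by
  have : φ = ψ := funext fun m => funext fun n => h m n
  rw [this]

theorem sw_bilin (z : Bal f g) (φ : M →ₗ[ℂ] N →ₗ[ℂ] P) :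
    sw z (fun m n => φ m n) = TensorProduct.lift φ (sec f g z) := by
  set b := (Module.Basis.ofVectorSpace ℂ M).tensorProduct (Module.Basis.ofVectorSpace ℂ N)
  conv_rhs => rw [← b.linearCombination_repr (sec f g z), Finsupp.apply_linearCombination]
  rw [sw]
  congr 2
  ext i
  simp [b, Module.Basis.tensorProduct_apply']

theorem sw_eq_lift (z : Bal f g) (φ : M →ₗ[ℂ] N →ₗ[ℂ] P)
    (h : ∀ a m n, φ (f a m) n = φ m (g a n)) : sw z (fun m n => φ m n) = Bal.lift f g φ h z := by
  rw [sw_bilin]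
  conv_rhs => rw [← mk_sec f g z]
  rfl

/-- Here balancedness enters. The section picks some representative of the class of `m ⊗ n`, and a
balanced bilinear summand takes the same value on it as on `m ⊗ n`. -/
theorem sw_tmul {φ : M → N → P} (h : IsBal f g φ) (m : M) (n : N) :
    sw (Bal.tmul f g m n) φ = φ m n := by
  obtain ⟨ψ, rfl⟩ := h.exists_bilin
  rw [sw_eq_lift _ _ h.bal, lift_tmul]

theorem isBal_tmul : IsBal f g (fun m n => Bal.tmul f g m n) :=
  .mk (fun a m n => Bal.tmul_balanced f g a m n)

theorem sw_self (z : Bal f g) : sw z (fun m n => Bal.tmul f g m n) = z := by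
  rw [sw_bilin]
  conv_rhs => rw [← mk_sec f g z]
  refine LinearMap.congr_fun (?_ : TensorProduct.lift (Bal.tmul f g) = Bal.mk f g) _
  ext; rfl

@[elab_as_elim] theorem induction {motive : Bal f g → Prop} (z : Bal f g)
    (tmul : ∀ m n, motive (Bal.tmul f g m n)) (add : ∀ x y, motive x → motive y → motive (x + y)) :
    motive z := by
  obtain ⟨t, rfl⟩ := mk_surjective f g z
  induction t using TensorProduct.induction_on with
  | zero => simpa using tmul 0 0
  | tmul m n => exact tmul m n
  | add x y hx hy => rw [map_add]; exact add _ _ hx hy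

theorem hom_ext {L L' : Bal f g →ₗ[ℂ] P} (h : ∀ m n, L (Bal.tmul f g m n) = L' (Bal.tmul f g m n)) :
    L = L' := by
  ext z
  induction z using Bal.induction with
  | tmul m n => exact h m n
  | add x y hx hy => rw [map_add, map_add, hx, hy]

theorem IsSum.sw_eq {z : Bal f g} {n : ℕ} {p : Fin n → M} {q : Fin n → N} (hz : z.IsSum p q)
    {φ : M → N → P} (h : IsBal f g φ) : sw z φ = ∑ i, φ (p i) (q i) := by
  have hz' : z = ∑ i, Bal.tmul f g (p i) (q i) := hz
  rw [hz', ← swLin_apply, map_sum]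
  exact Finset.sum_congr rfl fun i _ => sw_tmul h _ _

/-- The coefficients of the basis expansion are absorbed into the first factors, so only homogeneity
in the first variable is used. The axioms speak of finite families, and their summands may be nested
sums not known to be balanced; on this family `sw` is an honest finite sum for all of them. -/
theorem exists_isSum_sw (z : Bal f g) : ∃ (n : ℕ) (p : Fin n → M) (q : Fin n → N), z.IsSum p q ∧
    ∀ φ : M → N → P, (∀ (c : ℂ) m n, φ (c • m) n = c • φ m n) →
      sw z φ = ∑ i, φ (p i) (q i) := by
  set r := ((Module.Basis.ofVectorSpace ℂ M).tensorProduct (Module.Basis.ofVectorSpace ℂ N)).repr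
    (sec f g z) with hr
  let e := r.support.equivFin.symm
  refine ⟨_, fun i => r (e i).1 • Module.Basis.ofVectorSpace ℂ M (e i).1.1,
    fun i => Module.Basis.ofVectorSpace ℂ N (e i).1.2, ?_, fun φ hφ => ?_⟩
  · show z = _
    conv_lhs => rw [← sw_self z]
    rw [e.sum_comp (fun i => Bal.tmul f g (r i.1 • Module.Basis.ofVectorSpace ℂ M i.1.1)
      (Module.Basis.ofVectorSpace ℂ N i.1.2)), Finset.sum_coe_sort r.support
        (fun i => Bal.tmul f g (r i • Module.Basis.ofVectorSpace ℂ M i.1)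
      (Module.Basis.ofVectorSpace ℂ N i.2))]
    simp only [map_smul, LinearMap.smul_apply]
    rfl
  · rw [e.sum_comp (fun i => φ (r i.1 • Module.Basis.ofVectorSpace ℂ M i.1.1)
      (Module.Basis.ofVectorSpace ℂ N i.1.2)), Finset.sum_coe_sort r.support
        (fun i => φ (r i • Module.Basis.ofVectorSpace ℂ M i.1)
      (Module.Basis.ofVectorSpace ℂ N i.2))]
    simp only [hφ]
    rfl

theorem exists_isSum (z : Bal f g) : ∃ (n : ℕ) (p : Fin n → M) (q : Fin n → N), z.IsSum p q := by
  obtain ⟨n, p, q, h, -⟩ := exists_isSum_sw (P := ℂ) z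
  exact ⟨n, p, q, h⟩

@[simp] theorem mapLeft_tmul (φ : Module.End ℂ M) (hφ : ∀ a m, φ (f a m) = f a (φ m)) (m : M)
    (n : N) : Bal.mapLeft f g φ hφ (Bal.tmul f g m n) = Bal.tmul f g (φ m) n := by
  simp [mapLeft]

@[simp] theorem mapRight_tmul (φ : Module.End ℂ N) (hφ : ∀ a m, φ (g a m) = g a (φ m)) (m : M)
    (n : N) : Bal.mapRight f g φ hφ (Bal.tmul f g m n) = Bal.tmul f g m (φ n) := by
  simp [mapRight]

theorem mapLeft_eq_sw (φ : Module.End ℂ M) (hφ : ∀ a m, φ (f a m) = f a (φ m)) (z : Bal f g) :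
    Bal.mapLeft f g φ hφ z = sw z (fun m n => Bal.tmul f g (φ m) n) := by
  conv_lhs => rw [← sw_self z, map_sw]
  simp only [mapLeft_tmul]

theorem mapRight_eq_sw (φ : Module.End ℂ N) (hφ : ∀ a m, φ (g a m) = g a (φ m)) (z : Bal f g) :
    Bal.mapRight f g φ hφ z = sw z (fun m n => Bal.tmul f g m (φ n)) := by
  conv_lhs => rw [← sw_self z, map_sw]
  simp only [mapRight_tmul]

end Bal

namespace Bal₃

variable (f₁ : I → Module.End ℂ M) (g₁ : I → Module.End ℂ N) (f₂ : J → Module.End ℂ N)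
    (g₂ : J → Module.End ℂ P)

/-- The class of `m ⊗ n ⊗ p`, as a trilinear map. -/
def tmul : M →ₗ[ℂ] N →ₗ[ℂ] P →ₗ[ℂ] Bal₃ f₁ g₁ f₂ g₂ :=
  LinearMap.mk₂ ℂ (fun m n => Bal₃.mk f₁ g₁ f₂ g₂ ∘ₗ
      TensorProduct.mk ℂ M (N ⊗[ℂ] P) m ∘ₗ TensorProduct.mk ℂ N P n)
    (fun _ _ _ => by ext; simp)
    (fun _ _ _ => by ext; simp)
    (fun _ _ _ => by ext; simp [TensorProduct.tmul_add])
    (fun _ _ _ => by ext; simp)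

theorem tmul_balanced₁ (a : I) (m : M) (n : N) (p : P) :
    tmul f₁ g₁ f₂ g₂ (f₁ a m) n p = tmul f₁ g₁ f₂ g₂ m (g₁ a n) p :=
  (Submodule.Quotient.eq _).2 (Submodule.subset_span (Or.inl ⟨a, m, n, p, rfl⟩))

theorem tmul_balanced₂ (b : J) (m : M) (n : N) (p : P) :
    tmul f₁ g₁ f₂ g₂ m (f₂ b n) p = tmul f₁ g₁ f₂ g₂ m n (g₂ b p) :=
  (Submodule.Quotient.eq _).2 (Submodule.subset_span (Or.inr ⟨b, m, n, p, rfl⟩))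

@[simp] theorem inr_tmul (m : M) (n : N) (p : P) :
    inr f₁ g₁ f₂ g₂ m (Bal.tmul f₂ g₂ n p) = tmul f₁ g₁ f₂ g₂ m n p := rfl

@[simp] theorem inl_tmul (m : M) (n : N) (p : P) :
    inl f₁ g₁ f₂ g₂ (Bal.tmul f₁ g₁ m n) p = tmul f₁ g₁ f₂ g₂ m n p := by
  simp [inl]; rfl

theorem inr_eq_sw (m : M) (z : Bal f₂ g₂) :
    inr f₁ g₁ f₂ g₂ m z = z.sw (fun n p => tmul f₁ g₁ f₂ g₂ m n p) := by
  conv_lhs => rw [← Bal.sw_self z, Bal.map_sw]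
  simp

theorem inl_eq_sw (z : Bal f₁ g₁) (p : P) :
    inl f₁ g₁ f₂ g₂ z p = z.sw (fun m n => tmul f₁ g₁ f₂ g₂ m n p) := by
  conv_lhs => rw [← Bal.sw_self z]
  rw [inl, Bal.map_sw]
  refine Bal.sw_congr _ fun m n => inl_tmul f₁ g₁ f₂ g₂ m n p

variable {f₁ g₁ f₂ g₂}

/-- A balanced trilinear map descends to the threefold balanced tensor product. -/
theorem exists_lift {τ : M → N → P → Q} (h : IsBal₃ f₁ g₁ f₂ g₂ τ) :
    ∃ L : Bal₃ f₁ g₁ f₂ g₂ →ₗ[ℂ] Q, ∀ m n p, L (tmul f₁ g₁ f₂ g₂ m n p) = τ m n p := by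
  obtain ⟨ψ, rfl⟩ := h.exists_trilin
  refine ⟨(balRel₃ f₁ g₁ f₂ g₂).liftQ
    (TensorProduct.lift ((TensorProduct.uncurry (.id ℂ) N P Q) ∘ₗ ψ)) ?_, ?_⟩
  · refine Submodule.span_le.2 ?_
    rintro _ (⟨a, m, n, p, rfl⟩ | ⟨a, m, n, p, rfl⟩)
    · simpa [sub_eq_zero] using h.bal₁ a m n p
    · simpa [sub_eq_zero] using h.bal₂ a m n p
  · intro m n p
    exact ((balRel₃ f₁ g₁ f₂ g₂).liftQ_apply _ _).trans (by simp)

end Bal₃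

attribute [irreducible] Bal.sw

end SweedlerSums

/-! ### Sweedler calculus in a full Hopf algebroid -/

namespace FullHopfAlgebroid

variable {B H : Type u} [Ring B] [Algebra ℂ B] [Ring H] [Algebra ℂ H] (K : FullHopfAlgebroid B H)
variable {P : Type*} [AddCommGroup P] [Module ℂ P]

open Bal

/-- Pattern of the transfer lemmas: the axiom is applied to the family of `exists_isSum_sw`. A side
with a balanced summand is evaluated by `IsSum.sw_eq`, any other side by the special property of
that family. -/
theorem sw_Δ_s_t_mul {φ : H → H → P} (hφ : IsBal K.lt K.ls φ) (a b : B) (X : H) :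
    sw (K.Δ (K.s a * K.t (op b) * X)) φ =
      sw (K.Δ X) fun x y => φ (K.s a * x) (K.t (op b) * y) := by
  obtain ⟨n, p, q, h, hsw⟩ := exists_isSum_sw (P := P) (K.Δ X)
  rw [(K.Δ_bimod a b X n p q h).sw_eq hφ, hsw]
  obtain ⟨φ, rfl⟩ := hφ.exists_bilin
  simp

theorem sw_Δ_s_mul {φ : H → H → P} (hφ : IsBal K.lt K.ls φ) (a : B) (X : H) :
    sw (K.Δ (K.s a * X)) φ = sw (K.Δ X) fun x y => φ (K.s a * x) y := by
  simpa using K.sw_Δ_s_t_mul hφ a 1 X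

theorem sw_Δ_t_mul {φ : H → H → P} (hφ : IsBal K.lt K.ls φ) (b : B) (X : H) :
    sw (K.Δ (K.t (op b) * X)) φ = sw (K.Δ X) fun x y => φ x (K.t (op b) * y) := by
  simpa using K.sw_Δ_s_t_mul hφ 1 b X

theorem sw_Δ_takeuchi {φ : H → H → P} (hφ : IsBal K.lt K.ls φ) (b : B) (X : H) :
    sw (K.Δ X) (fun x y => φ (x * K.t (op b)) y) = sw (K.Δ X) fun x y => φ x (y * K.s b) := by
  obtain ⟨n, p, q, h, hsw⟩ := exists_isSum_sw (P := P) (K.Δ X)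
  have := congrArg (swLin _ _ φ) (K.takeuchi X n p q h b)
  simp only [map_sum, swLin_apply, sw_tmul hφ] at this
  obtain ⟨φ, rfl⟩ := hφ.exists_bilin
  rw [hsw _ (by intros; simp), hsw _ (by intros; simp), this]

theorem sw_Δ_coassoc {τ : H → H → H → P} (hτ : IsBal₃ K.lt K.ls K.lt K.ls τ) (X : H) :
    sw (K.Δ X) (fun x y => sw (K.Δ x) fun x' y' => τ x' y' y) =
      sw (K.Δ X) fun x y => sw (K.Δ y) fun x' y' => τ x x' y' := by
  obtain ⟨L, hL⟩ := Bal₃.exists_lift hτ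
  obtain ⟨n, p, q, h, hsw⟩ := exists_isSum_sw (P := P) (K.Δ X)
  have := congrArg L (K.coassoc X n p q h)
  simp only [map_sum, Bal₃.inl_eq_sw, Bal₃.inr_eq_sw, map_sw, hL] at this
  obtain ⟨τ, rfl⟩ := hτ.exists_trilin
  rw [hsw _ (by intros; simp), hsw _ (by intros; simp), this]

theorem sw_Δ_counit_left (X : H) : sw (K.Δ X) (fun x y => K.s (K.ε x) * y) = X := by
  obtain ⟨n, p, q, h, hsw⟩ := exists_isSum_sw (P := H) (K.Δ X)
  rw [hsw _ (by intros; simp), K.counit_left X n p q h]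

theorem sw_Δ_counit_right (X : H) : sw (K.Δ X) (fun x y => K.t (op (K.ε y)) * x) = X := by
  obtain ⟨n, p, q, h, hsw⟩ := exists_isSum_sw (P := H) (K.Δ X)
  rw [hsw _ (by intros; simp), K.counit_right X n p q h]

theorem sw_Δ_one {φ : H → H → P} (hφ : IsBal K.lt K.ls φ) : sw (K.Δ 1) φ = φ 1 1 := by
  rw [K.Δ_one, sw_tmul hφ]

/-- The sum over `Y` is the outer one because the inner sum is then balanced in the components of
`Y`, and `Δ Y` may be replaced by any representative. -/
theorem sw_Δ_mul {φ : H → H → P} (hφ : IsBal K.lt K.ls φ) (X Y : H) :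
    sw (K.Δ (X * Y)) φ =
      sw (K.Δ Y) fun x' y' => sw (K.Δ X) fun x y => φ (x * x') (y * y') := by
  obtain ⟨n, p, q, h, hsw⟩ := exists_isSum_sw (P := P) (K.Δ X)
  obtain ⟨m, p', q', h', hsw'⟩ := exists_isSum_sw (P := P) (K.Δ Y)
  have := congrArg (swLin _ _ φ) (K.Δ_mul X Y n m p q p' q' h h')
  simp only [map_sum, swLin_apply, sw_tmul hφ] at this
  obtain ⟨φ, rfl⟩ := hφ.exists_bilin
  rw [this, hsw' _ (by intros; simp only [mul_smul_comm, map_smul, LinearMap.smul_apply, sw_fun_smul]), Finset.sum_comm]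
  refine Finset.sum_congr rfl fun i _ => ?_
  rw [hsw]
  intros
  simp

theorem isBal_mul_right {φ : H → H → P} (hφ : IsBal K.lt K.ls φ) (X Y : H) :
    IsBal K.lt K.ls fun x y => φ (x * X) (y * Y) := by
  have hb := hφ.bal
  obtain ⟨φ, rfl⟩ := hφ.exists_bilin
  refine .mk fun b x y => ?_
  simpa [mul_assoc] using hb b (x * X) (y * Y)

/-- Componentwise multiplication does not respect the relations of `H ⊗_B H` on its own; the
Takeuchi condition on `Δ X` moves `t_L(b)` in the first factor to `s_L(b)` in the second. -/
theorem isBal_sw_Δ_mul {φ : H → H → P} (hφ : IsBal K.lt K.ls φ) (X : H) :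
    IsBal K.lt K.ls fun x' y' => sw (K.Δ X) fun x y => φ (x * x') (y * y') := by
  have ht := fun x y a => K.sw_Δ_takeuchi (K.isBal_mul_right hφ x y) a X
  obtain ⟨φ, rfl⟩ := hφ.exists_bilin
  refine .mk fun b x y => ?_
  simpa [mul_assoc] using ht x y b

theorem isBal_mul_t {φ : H → H → P} (hφ : IsBal K.lt K.ls φ) (b : B) :
    IsBal K.lt K.ls fun x y => φ x (K.t (op b) * y) := by
  have hb := hφ.bal
  obtain ⟨φ, rfl⟩ := hφ.exists_bilin
  refine .mk fun a x y => ?_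
  simpa [← mul_assoc, K.s_t_comm] using hb a x (K.t (op b) * y)

theorem isBal_s_mul {φ : H → H → P} (hφ : IsBal K.lt K.ls φ) (b : B) :
    IsBal K.lt K.ls fun x y => φ (K.s b * x) y := by
  have hb := hφ.bal
  obtain ⟨φ, rfl⟩ := hφ.exists_bilin
  refine .mk fun a x y => ?_
  simpa [← mul_assoc, K.s_t_comm] using hb a (K.s b * x) y

theorem sw_Δ_t {φ : H → H → P} (hφ : IsBal K.lt K.ls φ) (b : B) :
    sw (K.Δ (K.t (op b))) φ = φ 1 (K.t (op b)) := by
  rw [← mul_one (K.t (op b)), K.sw_Δ_t_mul hφ, K.sw_Δ_one (K.isBal_mul_t hφ b), mul_one]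

theorem sw_Δ_s {φ : H → H → P} (hφ : IsBal K.lt K.ls φ) (b : B) :
    sw (K.Δ (K.s b)) φ = φ (K.s b) 1 := by
  rw [← mul_one (K.s b), K.sw_Δ_s_mul hφ, K.sw_Δ_one (K.isBal_s_mul hφ b), mul_one]

theorem sw_Δ_mul_t {φ : H → H → P} (hφ : IsBal K.lt K.ls φ) (b : B) (X : H) :
    sw (K.Δ (X * K.t (op b))) φ = sw (K.Δ X) fun x y => φ x (y * K.t (op b)) := by
  rw [K.sw_Δ_mul hφ, K.sw_Δ_t (K.isBal_sw_Δ_mul hφ X)]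
  simp

theorem sw_Δ_mul_s {φ : H → H → P} (hφ : IsBal K.lt K.ls φ) (b : B) (X : H) :
    sw (K.Δ (X * K.s b)) φ = sw (K.Δ X) fun x y => φ (x * K.s b) y := by
  rw [K.sw_Δ_mul hφ, K.sw_Δ_s (K.isBal_sw_Δ_mul hφ X)]
  simp

theorem ε_s_mul (a : B) (X : H) : K.ε (K.s a * X) = a * K.ε X := by
  simpa using K.ε_bimod a 1 X

theorem ε_t_mul (b : B) (X : H) : K.ε (K.t (op b) * X) = K.ε X * b := by
  simpa using K.ε_bimod 1 b X

theorem ε_s (b : B) : K.ε (K.s b) = b := by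
  simpa [K.ε_one] using K.ε_s_mul b 1

theorem ε_t (b : B) : K.ε (K.t (op b)) = b := by
  simpa [K.ε_one] using K.ε_t_mul b 1

theorem S_tR (a : Bᵐᵒᵖ) : K.S (K.tR a) = K.sR a := by
  simp [tR, sR]

theorem S_sR (a : Bᵐᵒᵖ) : K.S (K.sR a) = K.s (unop a) := K.S_t (unop a)

theorem S_symm_sR (a : Bᵐᵒᵖ) : K.S.symm (K.sR a) = K.tR a := rfl

theorem S_symm_one : K.S.symm 1 = 1 := by
  rw [LinearEquiv.symm_apply_eq, K.S_one]

theorem sR_mul (a b : Bᵐᵒᵖ) : K.sR (a * b) = K.sR a * K.sR b := map_mul _ _ _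

theorem sR_one : K.sR 1 = 1 := map_one _

theorem tR_mul (a b : Bᵐᵒᵖ) : K.tR (a * b) = K.tR b * K.tR a := by
  simp [tR, S_symm_mul]

@[simp] theorem sR_add (a b : Bᵐᵒᵖ) : K.sR (a + b) = K.sR a + K.sR b := map_add _ _ _
@[simp] theorem sR_smul (c : ℂ) (a : Bᵐᵒᵖ) : K.sR (c • a) = c • K.sR a := map_smul _ _ _
@[simp] theorem tR_add (a b : Bᵐᵒᵖ) : K.tR (a + b) = K.tR a + K.tR b := by simp [tR]
@[simp] theorem tR_smul (c : ℂ) (a : Bᵐᵒᵖ) : K.tR (c • a) = c • K.tR a := by simp [tR]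
@[simp] theorem εR_add (X Y : H) : K.εR (X + Y) = K.εR X + K.εR Y := by simp [εR]
@[simp] theorem εR_smul (c : ℂ) (X : H) : K.εR (c • X) = c • K.εR X := by simp [εR]

/-! The right bialgebroid. -/

/-- Source of the facts about `Δ_R`: a statement becomes one about `Δ (S X)` with the components
exchanged and `S⁻¹` applied to both. Since `S` reverses products, left and right multiplications by
the base trade places. -/
theorem sw_ΔR {φ : H → H → P} (hφ : IsBal K.rs K.rt φ) (X : H) :
    sw (K.ΔR X) φ = sw (K.Δ (K.S X)) fun x y => φ (K.S.symm y) (K.S.symm x) := by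
  have : K.ΔR X = K.flipS (K.Δ (K.S X)) := rfl
  rw [this, ← sw_self (K.Δ (K.S X)), map_sw, sw_sw]
  simp only [flipS, lift_tmul, sw_self]
  exact sw_congr _ fun x y => sw_tmul hφ _ _

theorem isBal_flip {φ : H → H → P} (hφ : IsBal K.rs K.rt φ) :
    IsBal K.lt K.ls fun x y => φ (K.S.symm y) (K.S.symm x) := by
  have hb := hφ.bal
  obtain ⟨φ, rfl⟩ := hφ.exists_bilin
  refine .mk fun b x y => ?_
  simpa [S_symm_mul, S_symm_s, sR, tR] using (hb (op b) (K.S.symm y) (K.S.symm x)).symm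

/-- `S` carries the two factors into the images of `t_L` and `s_L`, which commute. -/
theorem tR_sR_comm (a b : Bᵐᵒᵖ) : K.tR a * K.sR b = K.sR b * K.tR a := by
  apply K.S.injective
  rw [K.S_mul, K.S_mul, S_tR, S_sR]
  exact K.s_t_comm _ _

theorem sw_ΔR_mul_tR {φ : H → H → P} (hφ : IsBal K.rs K.rt φ) (a : Bᵐᵒᵖ) (X : H) :
    sw (K.ΔR (X * K.tR a)) φ = sw (K.ΔR X) fun x y => φ (x * K.tR a) y := by
  rw [K.sw_ΔR hφ, K.sw_ΔR, K.S_mul, S_tR]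
  · exact (K.sw_Δ_t_mul (K.isBal_flip hφ) (unop a) (K.S X)).trans (by simp [S_symm_mul, tR])
  · have hb := hφ.bal
    obtain ⟨φ, rfl⟩ := hφ.exists_bilin
    refine .mk fun b x y => ?_
    simpa [mul_assoc, tR_sR_comm] using hb b (x * K.tR a) y

theorem sw_ΔR_mul_sR {φ : H → H → P} (hφ : IsBal K.rs K.rt φ) (a : Bᵐᵒᵖ) (X : H) :
    sw (K.ΔR (X * K.sR a)) φ = sw (K.ΔR X) fun x y => φ x (y * K.sR a) := by
  rw [K.sw_ΔR hφ, K.sw_ΔR, K.S_mul, S_sR]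
  · exact (K.sw_Δ_s_mul (K.isBal_flip hφ) (unop a) (K.S X)).trans
      (by simp [S_symm_mul, S_symm_s, sR])
  · have hb := hφ.bal
    obtain ⟨φ, rfl⟩ := hφ.exists_bilin
    refine .mk fun b x y => ?_
    simpa [mul_assoc, tR_sR_comm] using hb b x (y * K.sR a)

theorem sw_ΔR_takeuchi {φ : H → H → P} (hφ : IsBal K.rs K.rt φ) (a : Bᵐᵒᵖ) (X : H) :
    sw (K.ΔR X) (fun x y => φ (K.sR a * x) y) = sw (K.ΔR X) fun x y => φ x (K.tR a * y) := by
  rw [K.sw_ΔR, K.sw_ΔR]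
  · simpa [S_symm_mul, S_symm_s, sR, tR] using
      (K.sw_Δ_takeuchi (K.isBal_flip hφ) (unop a) (K.S X)).symm
  all_goals
    have hb := hφ.bal
    obtain ⟨φ, rfl⟩ := hφ.exists_bilin
    refine .mk fun b x y => ?_
  · simpa [mul_assoc] using hb b x (K.tR a * y)
  · simpa [mul_assoc] using hb b (K.sR a * x) y

theorem sw_ΔR_one {φ : H → H → P} (hφ : IsBal K.rs K.rt φ) : sw (K.ΔR 1) φ = φ 1 1 := by
  rw [K.sw_ΔR hφ, K.S_one, K.sw_Δ_one (K.isBal_flip hφ), S_symm_one]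

/-- As `S` reverses products, the outer sum now runs over `X`, opposite to the rule for `Δ`. In this
order the inner sum is balanced by the Takeuchi condition on `Δ_R(Y)`. -/
theorem sw_ΔR_mul {φ : H → H → P} (hφ : IsBal K.rs K.rt φ) (X Y : H) :
    sw (K.ΔR (X * Y)) φ =
      sw (K.ΔR X) fun x y => sw (K.ΔR Y) fun x' y' => φ (x * x') (y * y') := by
  have hφ' := K.isBal_flip hφ
  have h1 : ∀ x y, IsBal K.rs K.rt fun x' y' => φ (x * x') (y * y') := fun x y => by
    have hb := hφ.bal
    obtain ⟨φ, rfl⟩ := hφ.exists_bilin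
    refine .mk fun b x' y' => ?_
    simpa [mul_assoc] using hb b (x * x') (y * y')
  rw [K.sw_ΔR hφ, K.S_mul, K.sw_Δ_mul hφ', K.sw_ΔR]
  · refine sw_congr _ fun x y => ?_
    rw [K.sw_ΔR (h1 _ _)]
    simp [S_symm_mul]
  · have ht := fun x y a => K.sw_ΔR_takeuchi (h1 x y) a Y
    obtain ⟨φ, rfl⟩ := hφ.exists_bilin
    refine .mk fun b x y => ?_
    simpa [mul_assoc] using ht x y b

theorem sw_ΔR_sR {φ : H → H → P} (hφ : IsBal K.rs K.rt φ) (a : Bᵐᵒᵖ) :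
    sw (K.ΔR (K.sR a)) φ = φ 1 (K.sR a) := by
  rw [← one_mul (K.sR a), K.sw_ΔR_mul_sR hφ, K.sw_ΔR_one, one_mul]
  have hb := hφ.bal
  obtain ⟨φ, rfl⟩ := hφ.exists_bilin
  refine .mk fun b x y => ?_
  simpa [mul_assoc, tR_sR_comm] using hb b x (y * K.sR a)

theorem sw_ΔR_tR {φ : H → H → P} (hφ : IsBal K.rs K.rt φ) (a : Bᵐᵒᵖ) :
    sw (K.ΔR (K.tR a)) φ = φ (K.tR a) 1 := by
  rw [← one_mul (K.tR a), K.sw_ΔR_mul_tR hφ, K.sw_ΔR_one, one_mul]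
  have hb := hφ.bal
  obtain ⟨φ, rfl⟩ := hφ.exists_bilin
  refine .mk fun b x y => ?_
  simpa [mul_assoc, tR_sR_comm] using hb b (x * K.tR a) y

theorem isBal_mul_left {φ : H → H → P} (hφ : IsBal K.rs K.rt φ) (X Y : H) :
    IsBal K.rs K.rt fun x y => φ (X * x) (Y * y) := by
  have hb := hφ.bal
  obtain ⟨φ, rfl⟩ := hφ.exists_bilin
  refine .mk fun b x y => ?_
  simpa [mul_assoc] using hb b (X * x) (Y * y)

theorem isBal_sw_ΔR_mul {φ : H → H → P} (hφ : IsBal K.rs K.rt φ) (Y : H) :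
    IsBal K.rs K.rt fun x y => sw (K.ΔR Y) fun x' y' => φ (x * x') (y * y') := by
  have ht := fun x y a => K.sw_ΔR_takeuchi (K.isBal_mul_left hφ x y) a Y
  obtain ⟨φ, rfl⟩ := hφ.exists_bilin
  refine .mk fun b x y => ?_
  simpa [mul_assoc] using ht x y b

theorem sw_ΔR_sR_mul {φ : H → H → P} (hφ : IsBal K.rs K.rt φ) (a : Bᵐᵒᵖ) (X : H) :
    sw (K.ΔR (K.sR a * X)) φ = sw (K.ΔR X) fun x y => φ x (K.sR a * y) := by
  rw [K.sw_ΔR_mul hφ, K.sw_ΔR_sR (K.isBal_sw_ΔR_mul hφ X)]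
  simp

theorem sw_ΔR_tR_mul {φ : H → H → P} (hφ : IsBal K.rs K.rt φ) (a : Bᵐᵒᵖ) (X : H) :
    sw (K.ΔR (K.tR a * X)) φ = sw (K.ΔR X) fun x y => φ (K.tR a * x) y := by
  rw [K.sw_ΔR_mul hφ, K.sw_ΔR_tR (K.isBal_sw_ΔR_mul hφ X)]
  simp

theorem sw_ΔR_coassoc {τ : H → H → H → P} (hτ : IsBal₃ K.rs K.rt K.rs K.rt τ) (X : H) :
    sw (K.ΔR X) (fun x y => sw (K.ΔR x) fun x' y' => τ x' y' y) =
      sw (K.ΔR X) fun x y => sw (K.ΔR y) fun x' y' => τ x x' y' := by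
  have hb₁ := hτ.bal₁
  have hb₂ := hτ.bal₂
  obtain ⟨τ, rfl⟩ := hτ.exists_trilin
  have h1 : ∀ y, IsBal K.rs K.rt fun x' y' => τ x' y' y := fun y => .mk fun a m n => hb₁ _ _ _ _
  have h2 : ∀ x, IsBal K.rs K.rt fun x' y' => τ x x' y' := fun y => .mk fun a m n => hb₂ _ _ _ _
  rw [K.sw_ΔR, K.sw_ΔR]
  -- In the inner coproducts `S` cancels the `S⁻¹` left by the outer one. What remains is
  -- coassociativity of `Δ` at `S X` with the three factors reversed.
  · simp_rw [fun X y => K.sw_ΔR (h1 y) X, fun X y => K.sw_ΔR (h2 y) X, LinearEquiv.apply_symm_apply]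
    refine (K.sw_Δ_coassoc (τ := fun x y z => τ (K.S.symm z) (K.S.symm y) (K.S.symm x))
      (.mk (fun b x y z => ?_) (fun b x y z => ?_)) (K.S X)).symm
    · simpa [S_symm_mul, S_symm_s, sR, tR] using
        (hb₂ (op b) (K.S.symm z) (K.S.symm y) (K.S.symm x)).symm
    · simpa [S_symm_mul, S_symm_s, sR, tR] using
        (hb₁ (op b) (K.S.symm z) (K.S.symm y) (K.S.symm x)).symm
  · refine .mk fun a x y => ?_
    exact (sw_congr _ fun _ _ => hb₁ _ _ _ _).trans (K.sw_ΔR_mul_tR (h2 x) a y).symm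
  · refine .mk fun a x y => ?_
    exact (K.sw_ΔR_mul_sR (h1 y) a x).trans (sw_congr _ fun _ _ => hb₂ _ _ _ _)

theorem εR_mul_tR (X : H) (a : Bᵐᵒᵖ) : K.εR (X * K.tR a) = a * K.εR X := by
  rw [εR, K.S_mul, S_tR]
  exact congrArg op (K.ε_t_mul (unop a) _)

theorem εR_mul_sR (X : H) (a : Bᵐᵒᵖ) : K.εR (X * K.sR a) = K.εR X * a := by
  rw [εR, K.S_mul, S_sR]
  exact congrArg op (K.ε_s_mul (unop a) _)

theorem εR_one : K.εR 1 = 1 := by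
  simp [εR, K.S_one, K.ε_one]

theorem εR_sR (a : Bᵐᵒᵖ) : K.εR (K.sR a) = a := by
  simpa [εR_one] using K.εR_mul_sR 1 a

theorem εR_tR (a : Bᵐᵒᵖ) : K.εR (K.tR a) = a := by
  simpa [εR_one] using K.εR_mul_tR 1 a

theorem εR_sR_mul (X Y : H) : K.εR (K.sR (K.εR X) * Y) = K.εR (X * Y) := by
  rw [εR, εR, εR, K.S_mul, S_sR, K.S_mul]
  exact congrArg op (K.ε_mul_s _ _).symm

theorem εR_tR_mul (X Y : H) : K.εR (K.tR (K.εR X) * Y) = K.εR (X * Y) := by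
  rw [εR, εR, εR, K.S_mul, S_tR, K.S_mul]
  exact congrArg op (K.ε_mul_t _ _).symm

theorem sw_ΔR_counit_left (X : H) : sw (K.ΔR X) (fun x y => y * K.tR (K.εR x)) = X := by
  rw [K.sw_ΔR]
  · apply K.S.injective
    rw [← LinearEquiv.coe_coe, map_sw]
    simpa [K.S_mul, S_tR, εR, sR] using K.sw_Δ_counit_right (K.S X)
  · exact .mk fun a x y => by simp [εR_mul_sR, tR_mul, mul_assoc]

theorem sw_ΔR_counit_right (X : H) : sw (K.ΔR X) (fun x y => x * K.sR (K.εR y)) = X := by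
  rw [K.sw_ΔR]
  · apply K.S.injective
    rw [← LinearEquiv.coe_coe, map_sw]
    simpa [K.S_mul, S_sR, εR] using K.sw_Δ_counit_left (K.S X)
  · exact .mk fun a x y => by simp [εR_mul_tR, sR_mul, mul_assoc]

/-! Antipode identities. -/

/-- Apply `x ⊗ y ↦ t_L(ε_L(y)) x` to the axiom `S(X₁)₁ X₂ ⊗ S(X₁)₂ = 1 ⊗ S(X)`: the right counit law
collapses the left side. -/
theorem sw_Δ_S_mul (X : H) : sw (K.Δ X) (fun x y => K.S x * y) = K.t (op (K.ε (K.S X))) := by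
  obtain ⟨n, p, q, h, hsw⟩ := exists_isSum_sw (P := H) (K.Δ X)
  have hb : IsBal K.lt K.ls fun x y => K.t (op (K.ε y)) * x :=
    .mk (fun b x y => by simp [ε_s_mul, mul_assoc])
  have h0 : ∑ i, sw (K.Δ (K.S (p i))) (fun x y => Bal.tmul K.lt K.ls (x * q i) y) =
      Bal.tmul K.lt K.ls 1 (K.S X) := by
    refine Eq.trans (Finset.sum_congr rfl fun i _ => ?_) (K.S_cond X n p q h)
    exact (mapLeft_eq_sw (f := K.lt) (g := K.ls) (LinearMap.mulRight ℂ (q i))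
      (fun _ _ => mul_assoc _ _ _) (K.Δ (K.S (p i)))).symm
  have := congrArg (swLin _ _ fun x y => K.t (op (K.ε y)) * x) h0
  simp only [map_sum, swLin_apply, sw_sw, sw_tmul hb, mul_one] at this
  rw [hsw _ (by intros; simp), ← this]
  refine Finset.sum_congr rfl fun i _ => ?_
  conv_lhs => rw [← K.sw_Δ_counit_right (K.S (p i)), ← LinearMap.mulRight_apply ℂ, map_sw]
  simp [mul_assoc]

theorem sum_sw_Δ_S_symm {X : H} {n : ℕ} {p q : Fin n → H} (h : (K.Δ X).IsSum p q) :
    ∑ i, sw (K.Δ (K.S.symm (q i))) (fun x y => Bal.tmul K.lt K.ls x (y * p i)) =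
      Bal.tmul K.lt K.ls (K.S.symm X) 1 := by
  refine Eq.trans (Finset.sum_congr rfl fun i _ => ?_) (K.S_symm_cond X n p q h)
  exact (mapRight_eq_sw (f := K.lt) (g := K.ls) (LinearMap.mulRight ℂ (p i))
    (fun _ _ => mul_assoc _ _ _) (K.Δ (K.S.symm (q i)))).symm

/-- Apply `x ⊗ y ↦ s_L(ε_L(x)) y` to the axiom on `S⁻¹`: the left counit law collapses the left
side. -/
theorem sw_Δ_S_symm_mul (X : H) :
    sw (K.Δ X) (fun x y => K.S.symm y * x) = K.s (K.ε (K.S.symm X)) := by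
  obtain ⟨n, p, q, h, hsw⟩ := exists_isSum_sw (P := H) (K.Δ X)
  have hb : IsBal K.lt K.ls fun x y => K.s (K.ε x) * y :=
    .mk (fun b x y => by simp [ε_t_mul, mul_assoc])
  have := congrArg (swLin _ _ fun x y => K.s (K.ε x) * y) (K.sum_sw_Δ_S_symm h)
  simp only [map_sum, swLin_apply, sw_sw, sw_tmul hb, mul_one] at this
  rw [hsw _ (by intros; simp), ← this]
  refine Finset.sum_congr rfl fun i _ => ?_
  conv_lhs => rw [← K.sw_Δ_counit_left (K.S.symm (q i)), ← LinearMap.mulRight_apply ℂ, map_sw]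
  simp [mul_assoc]

/-- By the definition of `Δ_R` the summand is `S⁻¹(S(X)₂) S(X)₁`, so this is the previous identity
at `S X`. It is the cancellation rule for one composite of the Galois maps. -/
theorem sw_ΔR_mul_S (X : H) : sw (K.ΔR X) (fun x y => x * K.S y) = K.s (K.ε X) := by
  rw [K.sw_ΔR]
  · simpa using K.sw_Δ_S_symm_mul (K.S X)
  · exact .mk fun a x y => by simp [K.S_mul, S_tR, mul_assoc]

/-- After applying `S` the same identity at `S X` appears. The result is used for the inverse of the
braiding and for the compatibility of `S` with the involution. -/
theorem sw_ΔR_mul_S_symm (X : H) :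
    sw (K.ΔR X) (fun x y => y * K.S.symm x) = K.t (op (K.ε X)) := by
  rw [K.sw_ΔR]
  · apply K.S.injective
    rw [← LinearEquiv.coe_coe, map_sw]
    simpa [K.S_mul, K.S_t] using K.sw_Δ_S_symm_mul (K.S X)
  · exact .mk fun a x y => by simp [S_symm_mul, S_symm_sR, mul_assoc]

/-- Applying `S` to `S⁻¹(X₂) X₁` gives `S(X₁) X₂`, so the two contracted antipode axioms can be
compared. It follows that `s_L` and `t_R` have the same image, although only `t_L` and `s_R` are
related by definition. -/
theorem s_ε_S_symm (X : H) : K.s (K.ε (K.S.symm X)) = K.tR (K.εR X) := by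
  apply K.S.injective
  rw [← K.sw_Δ_S_symm_mul, ← LinearEquiv.coe_coe, map_sw]
  simpa [K.S_mul, S_tR, εR, sR] using K.sw_Δ_S_mul X

theorem s_eq_tR (b : B) : K.s b = K.tR (K.εR (K.S (K.s b))) := by
  rw [← s_ε_S_symm, LinearEquiv.symm_apply_apply, ε_s]

theorem tR_eq_s (a : Bᵐᵒᵖ) : K.tR a = K.s (K.ε (K.S.symm (K.tR a))) := by
  rw [s_ε_S_symm, εR_tR]

/-- This linearity is what lets `id ⊗ Δ_R` descend to a tensor product over `B`. Its companion for
`Δ` and `t_R` plays the same role for `id ⊗ Δ_L` over `A`. -/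
theorem sw_ΔR_s_mul {φ : H → H → P} (hφ : IsBal K.rs K.rt φ) (b : B) (X : H) :
    sw (K.ΔR (K.s b * X)) φ = sw (K.ΔR X) fun x y => φ (K.s b * x) y := by
  rw [s_eq_tR, K.sw_ΔR_tR_mul hφ]

theorem sw_Δ_mul_tR {φ : H → H → P} (hφ : IsBal K.lt K.ls φ) (a : Bᵐᵒᵖ) (X : H) :
    sw (K.Δ (X * K.tR a)) φ = sw (K.Δ X) fun x y => φ (x * K.tR a) y := by
  rw [tR_eq_s, K.sw_Δ_mul_s hφ]

/-- `Z_[1](1) ⊗ Z_[1](2) S(Z_[2]) = Z ⊗ 1`. -/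
theorem sw_ΔR_sw_Δ_mul_S {φ : H → H → P} (hφ : IsBal K.lt K.ls φ) (Z : H) :
    sw (K.ΔR Z) (fun x y => sw (K.Δ x) fun x' y' => φ x' (y' * K.S y)) = φ Z 1 := by
  have h1 : ∀ W, IsBal K.lt K.ls fun x y => φ x (y * W) := fun W => by
    simpa using K.isBal_mul_right hφ 1 W
  have hφ' := hφ
  obtain ⟨φ, rfl⟩ := hφ.exists_bilin
  rw [K.sw_ΔR]
  -- Writing `Δ_R(Z)` through `S Z` turns `S(Z_[2])` into the first component of `Δ (S Z)`, and the
  -- claim becomes the axiom on `S⁻¹` at `S Z`.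
  · obtain ⟨n, p, q, h, hsw⟩ := exists_isSum_sw (P := P) (K.Δ (K.S Z))
    have := congrArg (swLin _ _ fun x y => φ x y) (K.sum_sw_Δ_S_symm h)
    simp only [map_sum, swLin_apply, sw_sw, sw_tmul hφ', LinearEquiv.symm_apply_apply] at this
    rw [hsw _ (by intros; simp)]
    simpa using this
  · refine .mk fun a x y => (K.sw_Δ_mul_t (h1 (K.S y)) (unop a) x).trans ?_
    simp [K.S_mul, S_tR, sR, mul_assoc]

end FullHopfAlgebroid

/-! ### Sweedler calculus in Yetter–Drinfeld modules -/

section YDSweedler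

variable {B H : Type u} [Ring B] [Algebra ℂ B] [Ring H] [Algebra ℂ H] {K : FullHopfAlgebroid B H}

open Bal

namespace RightRComodule

variable {V : Type u} [AddCommGroup V] [Module ℂ V] {bim : BimoduleStr Bᵐᵒᵖ V}
  (C : RightRComodule K bim) {P : Type*} [AddCommGroup P] [Module ℂ P]

theorem sw_δ_bimod {φ : V → H → P} (hφ : IsBal (fun a => bim.ract a) K.rt φ) (a a' : Bᵐᵒᵖ) (v : V) :
    sw (C.δ (bim.lact a (bim.ract a' v))) φ =
      sw (C.δ v) fun p q => φ p (K.sR a * q * K.sR a') := by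
  obtain ⟨n, p, q, h, hsw⟩ := exists_isSum_sw (P := P) (C.δ v)
  rw [(C.δ_bimod a a' v n p q h).sw_eq hφ, hsw]
  obtain ⟨φ, rfl⟩ := hφ.exists_bilin
  simp

theorem sw_δ_lact {φ : V → H → P} (hφ : IsBal (fun a => bim.ract a) K.rt φ) (a : Bᵐᵒᵖ) (v : V) :
    sw (C.δ (bim.lact a v)) φ = sw (C.δ v) fun p q => φ p (K.sR a * q) := by
  simpa [bim.ract_one, K.sR_one] using C.sw_δ_bimod hφ a 1 v

theorem sw_δ_ract {φ : V → H → P} (hφ : IsBal (fun a => bim.ract a) K.rt φ) (a : Bᵐᵒᵖ) (v : V) :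
    sw (C.δ (bim.ract a v)) φ = sw (C.δ v) fun p q => φ p (q * K.sR a) := by
  simpa [bim.lact_one, K.sR_one] using C.sw_δ_bimod hφ 1 a v

theorem sw_takeuchi {φ : V → H → P} (hφ : IsBal (fun a => bim.ract a) K.rt φ) (a : Bᵐᵒᵖ) (v : V) :
    sw (C.δ v) (fun p q => φ (bim.lact a p) q) = sw (C.δ v) fun p q => φ p (K.tR a * q) := by
  obtain ⟨n, p, q, h, hsw⟩ := exists_isSum_sw (P := P) (C.δ v)
  have := congrArg (swLin _ _ φ) (C.takeuchi v n p q h a)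
  simp only [map_sum, swLin_apply, sw_tmul hφ] at this
  obtain ⟨φ, rfl⟩ := hφ.exists_bilin
  rw [hsw _ (by intros; simp), hsw _ (by intros; simp), this]

theorem sw_coassoc {τ : V → H → H → P} (hτ : IsBal₃ (fun a => bim.ract a) K.rt K.rs K.rt τ)
    (v : V) :
    sw (C.δ v) (fun p q => sw (C.δ p) fun p' q' => τ p' q' q) =
      sw (C.δ v) fun p q => sw (K.ΔR q) fun x y => τ p x y := by
  obtain ⟨L, hL⟩ := Bal₃.exists_lift hτ
  obtain ⟨n, p, q, h, hsw⟩ := exists_isSum_sw (P := P) (C.δ v)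
  have := congrArg L (C.coassoc v n p q h)
  simp only [map_sum, Bal₃.inl_eq_sw, Bal₃.inr_eq_sw, map_sw, hL] at this
  obtain ⟨τ, rfl⟩ := hτ.exists_trilin
  rw [hsw _ (by intros; simp), hsw _ (by intros; simp), this]

theorem sw_counit (v : V) : sw (C.δ v) (fun p q => bim.ract (K.εR q) p) = v := by
  obtain ⟨n, p, q, h, hsw⟩ := exists_isSum_sw (P := V) (C.δ v)
  rw [hsw _ (by intros; simp), C.counit v n p q h]

theorem isBal_sR_mul {φ : V → H → P} (hφ : IsBal (fun a => bim.ract a) K.rt φ) (X : H)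
    (a : Bᵐᵒᵖ) : IsBal (fun a => bim.ract a) K.rt fun p q => φ p (X * q * K.sR a) := by
  have hb := hφ.bal
  obtain ⟨φ, rfl⟩ := hφ.exists_bilin
  refine .mk fun b x y => ?_
  simpa [mul_assoc, K.tR_sR_comm] using hb b x (X * y * K.sR a)

/-- A comodule structure from the axioms in terms of Sweedler sums. -/
def ofSw (δ : V →ₗ[ℂ] RTens K bim)
    (δ_bimod : ∀ a a' v, δ (bim.lact a (bim.ract a' v)) =
      sw (δ v) fun p q => Bal.tmul _ _ p (K.sR a * q * K.sR a'))
    (takeuchi : ∀ a v, sw (δ v) (fun p q => Bal.tmul (fun a => bim.ract a) K.rt (bim.lact a p) q) =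
      sw (δ v) fun p q => Bal.tmul _ _ p (K.tR a * q))
    (coassoc : ∀ v, sw (δ v) (fun p q => sw (δ p) fun p' q' =>
        Bal₃.tmul (fun a => bim.ract a) K.rt K.rs K.rt p' q' q) =
      sw (δ v) fun p q => sw (K.ΔR q) fun x y => Bal₃.tmul _ _ _ _ p x y)
    (counit : ∀ v, sw (δ v) (fun p q => bim.ract (K.εR q) p) = v) : RightRComodule K bim where
  δ := δ
  δ_bimod a a' v n p q h := by
    rw [δ_bimod, h.sw_eq (isBal_sR_mul isBal_tmul _ _)]
    rfl
  takeuchi v n p q h a := by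
    have := takeuchi a v
    rwa [h.sw_eq, h.sw_eq] at this
    · exact .mk fun b m n => by
        rw [LinearMap.mulRight_apply, ← mul_assoc]
        exact Bal.tmul_balanced (fun a => bim.ract a) K.rt b m (K.tR a * n)
    · exact .mk fun b m n => by
        rw [bim.lact_ract]
        exact Bal.tmul_balanced (fun a => bim.ract a) K.rt b (bim.lact a m) n
  coassoc v n p q h := by
    have := coassoc v
    rw [h.sw_eq, h.sw_eq] at this
    · simpa only [Bal₃.inl_eq_sw, Bal₃.inr_eq_sw] using this
    · exact .mk fun b m n => by
        rw [LinearMap.mulRight_apply,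
          K.sw_ΔR_mul_tR (.mk fun a m n => Bal₃.tmul_balanced₂ _ _ _ _ _ _ _ _)]
        exact sw_congr _ fun x y => Bal₃.tmul_balanced₁ (fun a => bim.ract a) K.rt K.rs K.rt _ _ _ _
    · exact .mk fun b m n => by
        have := δ_bimod 1 b m
        rw [bim.lact_one] at this
        rw [this, sw_sw]
        refine sw_congr _ fun x y => ?_
        rw [sw_tmul (.mk fun a m n => Bal₃.tmul_balanced₁ _ _ _ _ _ _ _ _), K.sR_one, one_mul]
        exact Bal₃.tmul_balanced₂ (fun a => bim.ract a) K.rt K.rs K.rt _ _ _ _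
  counit v n p q h := by
    have := counit v
    rwa [h.sw_eq (.mk fun b m n => by
      rw [← bim.ract_mul, LinearMap.mulRight_apply, K.εR_mul_tR])] at this

end RightRComodule

namespace RightLComodule

variable {V : Type u} [AddCommGroup V] [Module ℂ V] {bim : BimoduleStr Bᵐᵒᵖ V}
  (C : RightLComodule K bim) {P : Type*} [AddCommGroup P] [Module ℂ P]

theorem sw_δ_bimod {φ : V → H → P} (hφ : IsBal (fun b : B => bim.lact (op b)) K.ls φ) (b b' : B)
    (v : V) : sw (C.δ (bim.lact (op b) (bim.ract (op b') v))) φ =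
      sw (C.δ v) fun p q => φ p (K.t (op b) * q * K.t (op b')) := by
  obtain ⟨n, p, q, h, hsw⟩ := exists_isSum_sw (P := P) (C.δ v)
  rw [(C.δ_bimod b b' v n p q h).sw_eq hφ, hsw]
  obtain ⟨φ, rfl⟩ := hφ.exists_bilin
  simp

theorem sw_δ_lact {φ : V → H → P} (hφ : IsBal (fun b : B => bim.lact (op b)) K.ls φ) (b : B)
    (v : V) : sw (C.δ (bim.lact (op b) v)) φ = sw (C.δ v) fun p q => φ p (K.t (op b) * q) := by
  simpa [bim.ract_one] using C.sw_δ_bimod hφ b 1 v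

theorem sw_δ_ract {φ : V → H → P} (hφ : IsBal (fun b : B => bim.lact (op b)) K.ls φ) (b : B)
    (v : V) : sw (C.δ (bim.ract (op b) v)) φ = sw (C.δ v) fun p q => φ p (q * K.t (op b)) := by
  simpa [bim.lact_one] using C.sw_δ_bimod hφ 1 b v

theorem sw_takeuchi {φ : V → H → P} (hφ : IsBal (fun b : B => bim.lact (op b)) K.ls φ) (b : B)
    (v : V) : sw (C.δ v) (fun p q => φ (bim.ract (op b) p) q) =
      sw (C.δ v) fun p q => φ p (q * K.s b) := by
  obtain ⟨n, p, q, h, hsw⟩ := exists_isSum_sw (P := P) (C.δ v)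
  have := congrArg (swLin _ _ φ) (C.takeuchi v n p q h b)
  simp only [map_sum, swLin_apply, sw_tmul hφ] at this
  obtain ⟨φ, rfl⟩ := hφ.exists_bilin
  rw [hsw _ (by intros; simp), hsw _ (by intros; simp), this]

theorem sw_coassoc {τ : V → H → H → P}
    (hτ : IsBal₃ (fun b : B => bim.lact (op b)) K.ls K.lt K.ls τ) (v : V) :
    sw (C.δ v) (fun p q => sw (C.δ p) fun p' q' => τ p' q' q) =
      sw (C.δ v) fun p q => sw (K.Δ q) fun x y => τ p x y := by
  obtain ⟨L, hL⟩ := Bal₃.exists_lift hτ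
  obtain ⟨n, p, q, h, hsw⟩ := exists_isSum_sw (P := P) (C.δ v)
  have := congrArg L (C.coassoc v n p q h)
  simp only [map_sum, Bal₃.inl_eq_sw, Bal₃.inr_eq_sw, map_sw, hL] at this
  obtain ⟨τ, rfl⟩ := hτ.exists_trilin
  rw [hsw _ (by intros; simp), hsw _ (by intros; simp), this]

theorem sw_counit (v : V) : sw (C.δ v) (fun p q => bim.lact (op (K.ε q)) p) = v := by
  obtain ⟨n, p, q, h, hsw⟩ := exists_isSum_sw (P := V) (C.δ v)
  rw [hsw _ (by intros; simp), C.counit v n p q h]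

theorem isBal_t_mul {φ : V → H → P} (hφ : IsBal (fun b : B => bim.lact (op b)) K.ls φ) (X : H)
    (b : B) : IsBal (fun b : B => bim.lact (op b)) K.ls fun p q => φ p (K.t (op b) * q * X) := by
  have hb := hφ.bal
  obtain ⟨φ, rfl⟩ := hφ.exists_bilin
  refine .mk fun a x y => ?_
  simpa [← mul_assoc, K.s_t_comm] using hb a x (K.t (op b) * y * X)

/-- A comodule structure from the axioms in terms of Sweedler sums. -/
def ofSw (δ : V →ₗ[ℂ] LTens K bim)
    (δ_bimod : ∀ b b' v, δ (bim.lact (op b) (bim.ract (op b') v)) =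
      sw (δ v) fun p q => Bal.tmul _ _ p (K.t (op b) * q * K.t (op b')))
    (takeuchi : ∀ b v, sw (δ v) (fun p q =>
        Bal.tmul (fun b : B => bim.lact (op b)) K.ls (bim.ract (op b) p) q) =
      sw (δ v) fun p q => Bal.tmul _ _ p (q * K.s b))
    (coassoc : ∀ v, sw (δ v) (fun p q => sw (δ p) fun p' q' =>
        Bal₃.tmul (fun b : B => bim.lact (op b)) K.ls K.lt K.ls p' q' q) =
      sw (δ v) fun p q => sw (K.Δ q) fun x y => Bal₃.tmul _ _ _ _ p x y)
    (counit : ∀ v, sw (δ v) (fun p q => bim.lact (op (K.ε q)) p) = v) : RightLComodule K bim where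
  δ := δ
  δ_bimod a a' v n p q h := by
    rw [δ_bimod, h.sw_eq (isBal_t_mul isBal_tmul _ _)]
    rfl
  takeuchi v n p q h b := by
    have := takeuchi b v
    rwa [h.sw_eq, h.sw_eq] at this
    · exact .mk fun a m n => by
        rw [LinearMap.mulLeft_apply, mul_assoc]
        exact Bal.tmul_balanced (fun b : B => bim.lact (op b)) K.ls a m (n * K.s b)
    · exact .mk fun a m n => by
        rw [← bim.lact_ract]
        exact Bal.tmul_balanced (fun b : B => bim.lact (op b)) K.ls a (bim.ract (op b) m) n
  coassoc v n p q h := by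
    have := coassoc v
    rw [h.sw_eq, h.sw_eq] at this
    · simpa only [Bal₃.inl_eq_sw, Bal₃.inr_eq_sw] using this
    · exact .mk fun b m n => by
        rw [LinearMap.mulLeft_apply,
          K.sw_Δ_s_mul (.mk fun a m n => Bal₃.tmul_balanced₂ _ _ _ _ _ _ _ _)]
        exact sw_congr _ fun x y =>
          Bal₃.tmul_balanced₁ (fun b : B => bim.lact (op b)) K.ls K.lt K.ls _ _ _ _
    · exact .mk fun b m n => by
        have := δ_bimod b 1 m
        rw [op_one, bim.ract_one] at this
        rw [this, sw_sw]
        refine sw_congr _ fun x y => ?_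
        rw [sw_tmul (.mk fun a m n => Bal₃.tmul_balanced₁ _ _ _ _ _ _ _ _), map_one, mul_one]
        exact Bal₃.tmul_balanced₂ (fun b : B => bim.lact (op b)) K.ls K.lt K.ls _ _ _ _
  counit v n p q h := by
    have := counit v
    rwa [h.sw_eq (.mk fun b m n => by
      rw [← bim.lact_mul, LinearMap.mulLeft_apply, K.ε_s_mul, op_mul])] at this

end RightLComodule

namespace FullYD

variable (V : FullYD K) {P : Type*} [AddCommGroup P] [Module ℂ P]

theorem sw_mixed_LR {τ : V.carrier → H → H → P}
    (hτ : IsBal₃ (fun b : B => V.bim.lact (op b)) K.ls K.rs K.rt τ) (v : V.carrier) :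
    sw (V.δL v) (fun p q => sw (K.ΔR q) fun x y => τ p x y) =
      sw (V.δR v) fun p q => sw (V.δL p) fun p' q' => τ p' q' q := by
  obtain ⟨L, hL⟩ := Bal₃.exists_lift hτ
  obtain ⟨n, p, q, h, hsw⟩ := exists_isSum_sw (P := P) (V.δL v)
  obtain ⟨n', p', q', h', hsw'⟩ := exists_isSum_sw (P := P) (V.δR v)
  have := congrArg L (V.mixed_LR v n n' p q p' q' h h')
  simp only [map_sum, Bal₃.inl_eq_sw, Bal₃.inr_eq_sw, map_sw, hL] at this
  obtain ⟨τ, rfl⟩ := hτ.exists_trilin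
  rw [hsw _ (by intros; simp), hsw' _ (by intros; simp), this]

theorem sw_mixed_RL {τ : V.carrier → H → H → P}
    (hτ : IsBal₃ (fun a => V.bim.ract a) K.rt K.lt K.ls τ) (v : V.carrier) :
    sw (V.δR v) (fun p q => sw (K.Δ q) fun x y => τ p x y) =
      sw (V.δL v) fun p q => sw (V.δR p) fun p' q' => τ p' q' q := by
  obtain ⟨L, hL⟩ := Bal₃.exists_lift hτ
  obtain ⟨n, p, q, h, hsw⟩ := exists_isSum_sw (P := P) (V.δR v)
  obtain ⟨n', p', q', h', hsw'⟩ := exists_isSum_sw (P := P) (V.δL v)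
  have := congrArg L (V.mixed_RL v n n' p q p' q' h h')
  simp only [map_sum, Bal₃.inl_eq_sw, Bal₃.inr_eq_sw, map_sw, hL] at this
  obtain ⟨τ, rfl⟩ := hτ.exists_trilin
  rw [hsw _ (by intros; simp), hsw' _ (by intros; simp), this]

theorem isBal_mul_left {φ : V.carrier → H → P} (hφ : IsBal (fun a => V.bim.ract a) K.rt φ)
    (X : H) : IsBal (fun a => V.bim.ract a) K.rt fun p q => φ p (X * q) := by
  have hb := hφ.bal
  obtain ⟨φ, rfl⟩ := hφ.exists_bilin
  refine .mk fun b x y => ?_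
  simpa [mul_assoc] using hb b x (X * y)

theorem isBal_mul_right {φ : V.carrier → H → P}
    (hφ : IsBal (fun b : B => V.bim.lact (op b)) K.ls φ) (X : H) :
    IsBal (fun b : B => V.bim.lact (op b)) K.ls fun p q => φ p (q * X) := by
  have hb := hφ.bal
  obtain ⟨φ, rfl⟩ := hφ.exists_bilin
  refine .mk fun b x y => ?_
  simpa [mul_assoc] using hb b x (y * X)

theorem sw_yd {φ : V.carrier → H → P} (hφ : IsBal (fun a => V.bim.ract a) K.rt φ)
    (v : V.carrier) (X : H) :
    sw (K.ΔR X) (fun x y => sw (V.δR (V.act y v)) fun w z => φ w (x * z)) =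
      sw (V.δR v) fun w z => sw (K.ΔR X) fun x y => φ (V.act x w) (z * y) := by
  obtain ⟨n, p, q, h, hsw⟩ := exists_isSum_sw (P := P) (K.ΔR X)
  obtain ⟨m, w, z, h', hsw'⟩ := exists_isSum_sw (P := P) (V.δR v)
  have h0 : ∑ i, sw (V.δR (V.act (q i) v)) (fun w z => Bal.tmul (fun a => V.bim.ract a) K.rt w
      (p i * z)) = ∑ i, ∑ j, Bal.tmul (fun a => V.bim.ract a) K.rt (V.act (p i) (w j))
        (z j * q i) := by
    refine Eq.trans (Finset.sum_congr rfl fun i _ => ?_) (V.yd v X n m p q w z h h')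
    exact (mapRight_eq_sw (f := fun a => V.bim.ract a) (g := K.rt) (LinearMap.mulLeft ℂ (p i))
      (fun _ _ => (mul_assoc _ _ _).symm) (V.δR (V.act (q i) v))).symm
  have := congrArg (swLin _ _ φ) h0
  simp only [map_sum, swLin_apply, sw_sw, sw_tmul hφ] at this
  obtain ⟨φ, rfl⟩ := hφ.exists_bilin
  rw [hsw _ (by intros; simp), this, hsw' _ (by intros; simp), Finset.sum_comm]
  refine Finset.sum_congr rfl fun i _ => ?_
  rw [hsw]
  intros
  simp

/-! ### Galois maps between `V ⊗_B H` and `V ⊗_A H` -/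

theorem isBal_galois : IsBal (fun b : B => V.bim.lact (op b)) K.ls fun v X =>
    sw (V.δR v) fun p q => Bal.tmul (fun a => V.bim.ract a) K.rt p (K.S.symm X * q) := by
  refine .mk fun b v X => ?_
  rw [V.comodR.sw_δ_lact (V.isBal_mul_left isBal_tmul _)]
  simp [K.S_symm_mul, K.S_symm_s, FullHopfAlgebroid.sR, mul_assoc]

/-- The Galois map `v ⊗ X ↦ v_[0] ⊗ S⁻¹(X) v_[1]`. -/
def galois : LTens K V.bim →ₗ[ℂ] RTens K V.bim :=
  swLin _ _ fun v X => sw (V.δR v) fun p q => Bal.tmul _ _ p (K.S.symm X * q)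

theorem galois_tmul (v : V.carrier) (X : H) : V.galois (Bal.tmul _ _ v X) =
    sw (V.δR v) fun p q => Bal.tmul _ _ p (K.S.symm X * q) :=
  sw_tmul V.isBal_galois v X

/-- The inverse Galois map `v ⊗ X ↦ v_(0) ⊗ v_(1) S(X)`. -/
def galoisInv : RTens K V.bim →ₗ[ℂ] LTens K V.bim :=
  swLin _ _ fun v X => sw (V.δL v) fun p q => Bal.tmul _ _ p (q * K.S X)

theorem galoisInv_tmul (v : V.carrier) (X : H) : V.galoisInv (Bal.tmul _ _ v X) =
    sw (V.δL v) fun p q => Bal.tmul _ _ p (q * K.S X) := by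
  refine sw_tmul (.mk fun a v X => ?_) v X
  have := V.comodL.sw_δ_ract (V.isBal_mul_right isBal_tmul (K.S X)) (unop a) v
  simpa [K.S_mul, K.S_tR, FullHopfAlgebroid.sR, mul_assoc] using this

/-- The composite sends `v ⊗ X` to `v_[0](0) ⊗ v_[0](1) S(v_[1]) X`. The mixed axiom turns this into
`v_(0) ⊗ v_(1)[1] S(v_(1)[2]) X`; the antipode leaves `s_L(ε_L(v_(1)))`, which crosses the tensor
sign and is absorbed by the counit law. -/
theorem galoisInv_galois (z : LTens K V.bim) : V.galoisInv (V.galois z) = z := by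
  induction z using Bal.induction with
  | add x y hx hy => rw [map_add, map_add, hx, hy]
  | tmul v X =>
    rw [galois_tmul, map_sw]
    simp only [galoisInv_tmul, K.S_mul, LinearEquiv.apply_symm_apply]
    have := V.sw_mixed_LR (τ := fun p x y => Bal.tmul (fun b : B => V.bim.lact (op b)) K.ls p
      (x * (K.S y * X))) (.mk (fun b v x y => ?_) (fun a v x y => ?_)) v
    · rw [← this]
      have h1 : ∀ q, K.s (K.ε q) * X = sw (K.ΔR q) fun x y => x * (K.S y * X) := fun q => by
        rw [← K.sw_ΔR_mul_S, ← LinearMap.mulRight_apply ℂ, map_sw]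
        simp [mul_assoc]
      simp only [← map_sw, ← h1]
      have h2 : ∀ p q, Bal.tmul (fun b : B => V.bim.lact (op b)) K.ls p (K.s (K.ε q) * X) =
          Bal.tmul (fun b : B => V.bim.lact (op b)) K.ls (V.bim.lact (op (K.ε q)) p) X :=
        fun p q => (Bal.tmul_balanced (fun b : B => V.bim.lact (op b)) K.ls (K.ε q) p X).symm
      simp only [h2]
      conv_rhs => rw [← V.comodL.sw_counit v]
      exact (map_sw ((Bal.tmul (fun b : B => V.bim.lact (op b)) K.ls).flip X) _ _).symm
    · simpa [mul_assoc] using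
        Bal.tmul_balanced (fun b : B => V.bim.lact (op b)) K.ls b v (x * (K.S y * X))
    · simp [K.S_mul, K.S_tR, mul_assoc]

/-- Same scheme with the other mixed axiom: the factor `S⁻¹(v_(1)) v_(0)[1]` becomes `S⁻¹(x₂) x₁`
for the two components of one `v_[1]`, hence `t_R(ε_R(v_[1]))`. -/
theorem galois_galoisInv (z : RTens K V.bim) : V.galois (V.galoisInv z) = z := by
  induction z using Bal.induction with
  | add x y hx hy => rw [map_add, map_add, hx, hy]
  | tmul v X =>
    rw [galoisInv_tmul, map_sw]
    simp only [galois_tmul, K.S_symm_mul, LinearEquiv.symm_apply_apply]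
    have := V.sw_mixed_RL (τ := fun p x y => Bal.tmul (fun a => V.bim.ract a) K.rt p
      (X * K.S.symm y * x)) (.mk (fun b v x y => ?_) (fun a v x y => ?_)) v
    · rw [← this]
      have h1 : ∀ q, X * K.tR (K.εR q) = sw (K.Δ q) fun x y => X * K.S.symm y * x := fun q => by
        rw [← K.s_ε_S_symm, ← K.sw_Δ_S_symm_mul, ← LinearMap.mulLeft_apply ℂ, map_sw]
        simp [mul_assoc]
      simp only [← map_sw, ← h1]
      have h2 : ∀ p q, Bal.tmul (fun a => V.bim.ract a) K.rt p (X * K.tR (K.εR q)) =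
          Bal.tmul (fun a => V.bim.ract a) K.rt (V.bim.ract (K.εR q) p) X :=
        fun p q => (Bal.tmul_balanced (fun a => V.bim.ract a) K.rt (K.εR q) p X).symm
      simp only [h2]
      conv_rhs => rw [← V.comodR.sw_counit v]
      exact (map_sw ((Bal.tmul (fun a => V.bim.ract a) K.rt).flip X) _ _).symm
    · simpa [mul_assoc] using
        Bal.tmul_balanced (fun a => V.bim.ract a) K.rt b v (X * K.S.symm y * x)
    · simp [K.S_symm_mul, K.S_symm_s, mul_assoc]

/-- The coaction of the left bialgebroid is determined by the one of the right bialgebroid. -/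
theorem δL_eq_galoisInv (v : V.carrier) : V.δL v = V.galoisInv (Bal.tmul _ _ v 1) := by
  rw [galoisInv_tmul, K.S_one]
  simp [sw_self]

/-- The Yetter–Drinfeld condition for the coaction of the left bialgebroid. -/
theorem sw_ydL {φ : V.carrier → H → P} (hφ : IsBal (fun b : B => V.bim.lact (op b)) K.ls φ)
    (v : V.carrier) (Z : H) :
    sw (K.ΔR Z) (fun x y => sw (V.δL (V.act x v)) fun w z => φ w (z * K.S y)) =
      sw (V.δL v) fun w z => sw (K.ΔR Z) fun x y => φ (V.act y w) (K.S x * z) := by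
  -- The left side is the inverse Galois map at `v ◁ Z_[1] ⊗ Z_[2]`, so it suffices to compare
  -- images under the Galois map. There the right side involves only `δ_R` of `w ◁ y`, to which the
  -- given Yetter–Drinfeld condition applies.
  suffices h : sw (K.ΔR Z) (fun x y => V.galoisInv (Bal.tmul _ _ (V.act x v) y)) =
      sw (V.δL v) fun w z => sw (K.ΔR Z) fun x y => Bal.tmul _ _ (V.act y w) (K.S x * z) by
    simpa only [galoisInv_tmul, swLin_apply, map_sw, sw_sw, sw_tmul hφ] using
      congrArg (swLin _ _ φ) h
  rw [← V.galoisInv_galois (sw (V.δL v) _), ← map_sw]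
  congr 1
  simp only [map_sw, galois_tmul, K.S_symm_mul, LinearEquiv.symm_apply_apply]
  have h1 : ∀ w z, (sw (K.ΔR Z) fun x y => sw (V.δR (V.act y w)) fun p q =>
      Bal.tmul (fun a => V.bim.ract a) K.rt p (K.S.symm z * x * q)) =
      sw (V.δR w) fun p q => sw (K.ΔR Z) fun x y =>
        Bal.tmul (fun a => V.bim.ract a) K.rt (V.act x p) (K.S.symm z * q * y) := fun w z => by
    simpa only [mul_assoc] using V.sw_yd (V.isBal_mul_left isBal_tmul (K.S.symm z)) w Z
  simp only [h1]
  have hZ : ∀ p, IsBal K.rs K.rt fun x y => Bal.tmul (fun a => V.bim.ract a) K.rt (V.act x p) y :=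
    fun p => .mk fun a x y => by
      simp only [LinearMap.mulRight_apply, V.mod.act_mul, V.act_sR]
      exact Bal.tmul_balanced (fun a => V.bim.ract a) K.rt _ _ _
  -- A base element acting on `p` is absorbed into `Z_[1]` and reappears as `t_R(a)` in front of
  -- `Z_[2]` by the Takeuchi condition. This serves both the balancedness in `h2` and the counit in
  -- `h3`.
  have hZ' : ∀ p (a : Bᵐᵒᵖ) X, (sw (K.ΔR Z) fun x y =>
      Bal.tmul (fun a => V.bim.ract a) K.rt (V.act x (V.bim.ract a p)) (X * y)) =
      sw (K.ΔR Z) fun x y => Bal.tmul (fun a => V.bim.ract a) K.rt (V.act x p)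
        (X * K.tR a * y) := fun p a X => by
    have hb : IsBal K.rs K.rt fun x y =>
        Bal.tmul (fun a => V.bim.ract a) K.rt (V.act x p) (X * y) := by
      simpa using K.isBal_mul_left (hZ p) 1 X
    simpa only [mul_assoc, V.mod.act_mul, V.act_sR] using K.sw_ΔR_takeuchi hb a Z
  have h2 := V.sw_mixed_RL (τ := fun p x₁ x₂ => sw (K.ΔR Z) fun x y =>
    Bal.tmul (fun a => V.bim.ract a) K.rt (V.act x p) (K.S.symm x₂ * x₁ * y))
    (.mk (fun a p x₁ x₂ => by simpa [mul_assoc] using hZ' p a (K.S.symm x₂ * x₁))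
      (fun b p x₁ x₂ => by simp [K.S_symm_mul, K.S_symm_s, mul_assoc])) v
  rw [← h2]
  -- The mixed axiom has brought the two components of one `v_[1]` together, and `S⁻¹(x₂) x₁`
  -- collapses to `t_R(ε_R(q))`.
  have h3 : ∀ p q, (sw (K.Δ q) fun x₁ x₂ => sw (K.ΔR Z) fun x y =>
      Bal.tmul (fun a => V.bim.ract a) K.rt (V.act x p) (K.S.symm x₂ * x₁ * y)) =
      sw (K.ΔR Z) fun x y =>
        Bal.tmul (fun a => V.bim.ract a) K.rt (V.act x (V.bim.ract (K.εR q) p)) y := fun p q => by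
    have := hZ' p (K.εR q) 1
    simp only [one_mul] at this
    rw [this, sw_comm]
    refine sw_congr _ fun x y => ?_
    rw [← K.s_ε_S_symm, ← K.sw_Δ_S_symm_mul, ← LinearMap.mulRight_apply ℂ, map_sw, map_sw]
    simp
  simp only [h3]
  rw [sw_comm]
  refine sw_congr _ fun x y => ?_
  conv_lhs => rw [← V.comodR.sw_counit v]
  exact map_sw ((Bal.tmul (fun a => V.bim.ract a) K.rt).flip y ∘ₗ V.act x) _ _

/-- A map of right modules and of comodules of the right bialgebroid is a morphism. -/
def Hom.ofR {V W : FullYD K} (f : V.carrier →ₗ[ℂ] W.carrier)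
    (map_act : ∀ X v, f (V.act X v) = W.act X (f v))
    (map_δR : ∀ v, W.δR (f v) = sw (V.δR v) fun p q => Bal.tmul _ _ (f p) q) : V ⟶ W where
  map := f
  map_lact a v := by rw [← V.act_tR, map_act, W.act_tR]
  map_ract a v := by rw [← V.act_sR, map_act, W.act_sR]
  map_act := map_act
  map_δR v n p q h := by
    rw [map_δR, h.sw_eq (.mk fun a m n => by
      rw [← V.act_sR, map_act, W.act_sR]
      exact Bal.tmul_balanced (fun a => W.bim.ract a) K.rt _ _ _)]
    rfl
  map_δL v n p q h := by
    have hf : ∀ a v, f (V.bim.lact a v) = W.bim.lact a (f v) := fun a v => by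
      rw [← V.act_tR, map_act, W.act_tR]
    have hf' : ∀ a v, f (V.bim.ract a v) = W.bim.ract a (f v) := fun a v => by
      rw [← V.act_sR, map_act, W.act_sR]
    have hR : IsBal (fun a => V.bim.ract a) K.rt fun p q =>
        Bal.tmul (fun a => W.bim.ract a) K.rt (f p) q := .mk fun a m n => by
      rw [hf']; exact Bal.tmul_balanced (fun a => W.bim.ract a) K.rt _ _ _
    have hL : IsBal (fun b : B => V.bim.lact (op b)) K.ls fun p q =>
        Bal.tmul (fun b : B => W.bim.lact (op b)) K.ls (f p) q := .mk fun a m n => by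
      rw [hf]; exact Bal.tmul_balanced (fun b : B => W.bim.lact (op b)) K.ls _ _ _
    suffices h' : W.δL (f v) = sw (V.δL v) fun p q => Bal.tmul _ _ (f p) q by
      rw [h', h.sw_eq hL]; rfl
    rw [δL_eq_galoisInv, ← W.galoisInv_galois (sw _ _), map_sw]
    congr 1
    -- `f ⊗ id` intertwines the Galois maps, which are built from `δ_R` alone. Inverting them yields
    -- compatibility with `δ_L`.
    have key : ∀ p q, W.galois (Bal.tmul (fun b : B => W.bim.lact (op b)) K.ls (f p) q) =
        swLin _ _ (fun p q => Bal.tmul (fun a => W.bim.ract a) K.rt (f p) q)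
          (V.galois (Bal.tmul (fun b : B => V.bim.lact (op b)) K.ls p q)) := fun p q => by
      rw [galois_tmul, galois_tmul, map_δR, map_sw, sw_sw]
      refine sw_congr _ fun x y => ?_
      rw [sw_tmul (W.isBal_mul_left isBal_tmul _), swLin_apply, sw_tmul hR]
    simp only [key]
    rw [← map_sw, ← map_sw, sw_self, V.δL_eq_galoisInv, galois_galoisInv, swLin_apply, sw_tmul hR]

end FullYD

end YDSweedler

/-! ### The tensor product of Yetter–Drinfeld modules -/

section YDTensor

variable {B H : Type u} [Ring B] [Algebra ℂ B] [Ring H] [Algebra ℂ H] {K : FullHopfAlgebroid B H}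

open Bal

/-- The Takeuchi condition for `Δ_R` makes the right side of the Yetter–Drinfeld condition well
defined. Only a bimodule and an action are assumed, so this applies to unit, tensor product and
conjugate before they are known to be Yetter–Drinfeld modules. -/
theorem isBal_sw_act_mul {V : Type u} [AddCommGroup V] [Module ℂ V] {P : Type*} [AddCommGroup P]
    [Module ℂ P] {bim : BimoduleStr Bᵐᵒᵖ V} {mod : RightModuleStr H V}
    (act_sR : ∀ a v, mod.act (K.sR a) v = bim.ract a v) {φ : V → H → P}
    (hφ : IsBal (fun a => bim.ract a) K.rt φ) (X : H) :
    IsBal (fun a => bim.ract a) K.rt fun w z =>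
      sw (K.ΔR X) fun x y => φ (mod.act x w) (z * y) := by
  have hb := hφ.bal
  obtain ⟨φ, rfl⟩ := hφ.exists_bilin
  have h1 : ∀ w z, IsBal K.rs K.rt fun x y => φ (mod.act x w) (z * y) := fun w z =>
    .mk fun a x y => by
      simpa [mod.act_mul, act_sR, mul_assoc] using hb a (mod.act x w) (z * y)
  refine .mk fun a w z => ?_
  simpa [mod.act_mul, act_sR, mul_assoc] using K.sw_ΔR_takeuchi (h1 w z) a X

namespace FullYD

/-- A Yetter–Drinfeld module from the axioms in terms of Sweedler sums. -/
def ofSw (V : Type u) [AddCommGroup V] [Module ℂ V] (bim : BimoduleStr Bᵐᵒᵖ V)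
    (mod : RightModuleStr H V) (act_tR : ∀ a v, mod.act (K.tR a) v = bim.lact a v)
    (act_sR : ∀ a v, mod.act (K.sR a) v = bim.ract a v) (comodR : RightRComodule K bim)
    (comodL : RightLComodule K bim)
    (mixed_LR : ∀ v, (sw (comodL.δ v) fun p q => sw (K.ΔR q) fun x y =>
        Bal₃.tmul (fun b : B => bim.lact (op b)) K.ls K.rs K.rt p x y) =
      sw (comodR.δ v) fun p q => sw (comodL.δ p) fun p' q' => Bal₃.tmul _ _ _ _ p' q' q)
    (mixed_RL : ∀ v, (sw (comodR.δ v) fun p q => sw (K.Δ q) fun x y =>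
        Bal₃.tmul (fun a => bim.ract a) K.rt K.lt K.ls p x y) =
      sw (comodL.δ v) fun p q => sw (comodR.δ p) fun p' q' => Bal₃.tmul _ _ _ _ p' q' q)
    (yd : ∀ v X, (sw (K.ΔR X) fun x y => sw (comodR.δ (mod.act y v)) fun w z =>
        Bal.tmul (fun a => bim.ract a) K.rt w (x * z)) =
      sw (comodR.δ v) fun w z => sw (K.ΔR X) fun x y => Bal.tmul _ _ (mod.act x w) (z * y)) :
    FullYD K where
  carrier := V
  bim := bim
  mod := mod
  act_tR := act_tR
  act_sR := act_sR
  comodR := comodR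
  comodL := comodL
  mixed_LR v n m p q p' q' h h' := by
    have := mixed_LR v
    rw [h.sw_eq, h'.sw_eq] at this
    · simpa only [Bal₃.inl_eq_sw, Bal₃.inr_eq_sw] using this
    · refine .mk fun a m n => ?_
      have hb : IsBal (fun b : B => bim.lact (op b)) K.ls fun p' q' =>
          Bal₃.tmul (fun b : B => bim.lact (op b)) K.ls K.rs K.rt p' q' n :=
        .mk fun b m n => Bal₃.tmul_balanced₁ (fun b : B => bim.lact (op b)) K.ls K.rs K.rt _ _ _ _
      refine (comodL.sw_δ_ract hb (unop a) m).trans (sw_congr _ fun x y => ?_)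
      exact Bal₃.tmul_balanced₂ (fun b : B => bim.lact (op b)) K.ls K.rs K.rt _ _ _ _
    · refine .mk fun b m n => ?_
      have hb : IsBal K.rs K.rt fun x y =>
          Bal₃.tmul (fun b : B => bim.lact (op b)) K.ls K.rs K.rt m x y :=
        .mk fun a x y => Bal₃.tmul_balanced₂ (fun b : B => bim.lact (op b)) K.ls K.rs K.rt _ _ _ _
      -- Here `id ⊗ Δ_R` has to descend to `⊗_B`, which uses that the images of `s_L` and `t_R`
      -- coincide.
      refine Eq.trans (sw_congr _ fun x y => ?_) (K.sw_ΔR_s_mul hb b n).symm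
      exact Bal₃.tmul_balanced₁ (fun b : B => bim.lact (op b)) K.ls K.rs K.rt _ _ _ _
  mixed_RL v n m p q p' q' h h' := by
    have := mixed_RL v
    rw [h.sw_eq, h'.sw_eq] at this
    · simpa only [Bal₃.inl_eq_sw, Bal₃.inr_eq_sw] using this
    · refine .mk fun b m n => ?_
      have hb : IsBal (fun a => bim.ract a) K.rt fun p' q' =>
          Bal₃.tmul (fun a => bim.ract a) K.rt K.lt K.ls p' q' n :=
        .mk fun b m n => Bal₃.tmul_balanced₁ (fun a => bim.ract a) K.rt K.lt K.ls _ _ _ _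
      refine (comodR.sw_δ_lact hb (op b) m).trans (sw_congr _ fun x y => ?_)
      exact Bal₃.tmul_balanced₂ (fun a => bim.ract a) K.rt K.lt K.ls _ _ _ _
    · refine .mk fun a m n => ?_
      have hb : IsBal K.lt K.ls fun x y =>
          Bal₃.tmul (fun a => bim.ract a) K.rt K.lt K.ls m x y :=
        .mk fun b x y => Bal₃.tmul_balanced₂ (fun a => bim.ract a) K.rt K.lt K.ls _ _ _ _
      refine Eq.trans (sw_congr _ fun x y => ?_) (K.sw_Δ_mul_tR hb a n).symm
      exact Bal₃.tmul_balanced₁ (fun a => bim.ract a) K.rt K.lt K.ls _ _ _ _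
  yd v X n m p q w y hX hv := by
    have hφ : IsBal (fun a => bim.ract a) K.rt fun v X =>
        Bal.tmul (fun a => bim.ract a) K.rt v X := isBal_tmul
    have := yd v X
    rw [hv.sw_eq (isBal_sw_act_mul act_sR hφ X), hX.sw_eq] at this
    · refine (Finset.sum_congr rfl fun i _ => ?_).trans (this.trans ?_)
      · exact mapRight_eq_sw (f := fun a => bim.ract a) (g := K.rt) (LinearMap.mulLeft ℂ (p i))
          (fun _ _ => (mul_assoc _ _ _).symm) (comodR.δ (mod.act (q i) v))
      · rw [Finset.sum_comm]
        refine Finset.sum_congr rfl fun i _ => hX.sw_eq (.mk fun a x z => ?_)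
        simp only [LinearMap.mulRight_apply, mod.act_mul, act_sR, ← mul_assoc]
        exact Bal.tmul_balanced (fun a => bim.ract a) K.rt _ _ _
    · refine .mk fun a x z => ?_
      have hb : IsBal (fun a => bim.ract a) K.rt fun v X =>
          Bal.tmul (fun a => bim.ract a) K.rt v (x * X) := by
        simpa [K.sR_one] using RightRComodule.isBal_sR_mul hφ x 1
      simp only [LinearMap.mulRight_apply, mod.act_mul, act_tR, comodR.sw_δ_lact hb, mul_assoc]

variable (V W : FullYD K) {P : Type*} [AddCommGroup P] [Module ℂ P]

theorem tm_balanced (a : Bᵐᵒᵖ) (v : V.carrier) (w : W.carrier) :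
    tm (V.bim.ract a v) w = tm v (W.bim.lact a w) :=
  Bal.tmul_balanced V.ract W.lact a v w

variable {V W} in
@[simp] theorem tm_add_left (v v' : V.carrier) (w : W.carrier) :
    tm (v + v') w = tm v w + tm v' w := LinearMap.map_add₂ _ _ _ _

variable {V W} in
@[simp] theorem tm_smul_left (c : ℂ) (v : V.carrier) (w : W.carrier) :
    tm (c • v) w = c • tm v w := LinearMap.map_smul₂ _ _ _ _

/-- The left action on `V ⊗_A W`. -/
def tensLact : Bᵐᵒᵖ →ₗ[ℂ] Module.End ℂ (Tens V W) :=
  LinearMap.mk₂ ℂ (fun a z => sw z fun v w => tm (V.bim.lact a v) w)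
    (by intros; simp) (by intros; simp) (by intros; simp) (by intros; simp)

/-- The right action on `V ⊗_A W`. -/
def tensRact : Bᵐᵒᵖ →ₗ[ℂ] Module.End ℂ (Tens V W) :=
  LinearMap.mk₂ ℂ (fun a z => sw z fun v w => tm v (W.bim.ract a w))
    (by intros; simp) (by intros; simp) (by intros; simp) (by intros; simp)

theorem tensLact_tm (a : Bᵐᵒᵖ) (v : V.carrier) (w : W.carrier) :
    tensLact V W a (tm v w) = tm (V.bim.lact a v) w :=
  sw_tmul (.mk fun b v w => by rw [V.bim.lact_ract, tm_balanced]) v w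

theorem tensRact_tm (a : Bᵐᵒᵖ) (v : V.carrier) (w : W.carrier) :
    tensRact V W a (tm v w) = tm v (W.bim.ract a w) :=
  sw_tmul (.mk fun b v w => by rw [← W.bim.lact_ract, tm_balanced]) v w

/-- The bimodule structure of `V ⊗_A W`. -/
def tensBim : BimoduleStr Bᵐᵒᵖ (Tens V W) where
  lact := tensLact V W
  ract := tensRact V W
  lact_one v := by simp [tensLact, V.bim.lact_one, sw_self]
  lact_mul a b z := by
    induction z using Bal.induction with
    | add x y hx hy => simp only [map_add, hx, hy]
    | tmul v w => simp only [tensLact_tm, V.bim.lact_mul]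
  ract_one v := by simp [tensRact, W.bim.ract_one, sw_self]
  ract_mul a b z := by
    induction z using Bal.induction with
    | add x y hx hy => simp only [map_add, hx, hy]
    | tmul v w => simp only [tensRact_tm, W.bim.ract_mul]
  lact_ract a b z := by
    induction z using Bal.induction with
    | add x y hx hy => simp only [map_add, hx, hy]
    | tmul v w => simp only [tensRact_tm, tensLact_tm]

theorem tensBim_lact_tm (a : Bᵐᵒᵖ) (v : V.carrier) (w : W.carrier) :
    (tensBim V W).lact a (tm v w) = tm (V.bim.lact a v) w := tensLact_tm V W a v w

theorem tensBim_ract_tm (a : Bᵐᵒᵖ) (v : V.carrier) (w : W.carrier) :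
    (tensBim V W).ract a (tm v w) = tm v (W.bim.ract a w) := tensRact_tm V W a v w

theorem isBal_tm_act (v : V.carrier) (w : W.carrier) :
    IsBal K.rs K.rt fun x y => tm (V.act x v) (W.act y w) :=
  .mk fun a x y => by
    simp only [LinearMap.mulRight_apply, V.mod.act_mul, W.mod.act_mul, V.act_sR, W.act_tR,
      tm_balanced]

/-- The diagonal action respects `v a ⊗ w = v ⊗ a w` because `s_R(a) X_[1] ⊗ X_[2] = X_[1] ⊗ t_R(a)
X_[2]`. -/
theorem isBal_sw_tm_act (X : H) :
    IsBal V.ract W.lact fun v w => sw (K.ΔR X) fun x y => tm (V.act x v) (W.act y w) :=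
  .mk fun a v w => by
    simpa only [V.mod.act_mul, W.mod.act_mul, V.act_sR, W.act_tR] using
      K.sw_ΔR_takeuchi (V.isBal_tm_act W v w) a X

/-- The action on `V ⊗_A W`. -/
def tensAct : H →ₗ[ℂ] Module.End ℂ (Tens V W) :=
  LinearMap.mk₂ ℂ
    (fun X z => sw z fun v w => sw (K.ΔR X) fun x y => tm (V.act x v) (W.act y w))
    (by intros; simp) (by intros; simp) (by intros; simp) (by intros; simp)

theorem tensAct_tm (X : H) (v : V.carrier) (w : W.carrier) :
    tensAct V W X (tm v w) = sw (K.ΔR X) fun x y => tm (V.act x v) (W.act y w) :=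
  sw_tmul (V.isBal_sw_tm_act W X) v w

/-- The right module structure of `V ⊗_A W`. -/
def tensMod : RightModuleStr H (Tens V W) where
  act := tensAct V W
  act_one z := by
    induction z using Bal.induction with
    | add x y hx hy => rw [map_add, hx, hy]
    | tmul v w =>
      rw [tensAct_tm, K.sw_ΔR_one (V.isBal_tm_act W v w), V.mod.act_one, W.mod.act_one]
  act_mul X Y z := by
    induction z using Bal.induction with
    | add x y hx hy => rw [map_add, map_add, map_add, hx, hy]
    | tmul v w =>
      rw [tensAct_tm, tensAct_tm, K.sw_ΔR_mul (V.isBal_tm_act W v w), map_sw]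
      simp only [tensAct_tm, V.mod.act_mul, W.mod.act_mul]

theorem tensAct_tR (a : Bᵐᵒᵖ) (z : Tens V W) : tensAct V W (K.tR a) z = (tensBim V W).lact a z := by
  induction z using Bal.induction with
  | add x y hx hy => rw [map_add, map_add, hx, hy]
  | tmul v w =>
    rw [tensAct_tm, K.sw_ΔR_tR (V.isBal_tm_act W v w), tensBim_lact_tm, V.act_tR, W.mod.act_one]

theorem tensAct_sR (a : Bᵐᵒᵖ) (z : Tens V W) : tensAct V W (K.sR a) z = (tensBim V W).ract a z := by
  induction z using Bal.induction with
  | add x y hx hy => rw [map_add, map_add, hx, hy]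
  | tmul v w =>
    rw [tensAct_tm, K.sw_ΔR_sR (V.isBal_tm_act W v w), tensBim_ract_tm, W.act_sR, V.mod.act_one]

variable {V W}

theorem isBal_tensR_right {φ : Tens V W → H → P}
    (hφ : IsBal (fun a => (tensBim V W).ract a) K.rt φ) (p : V.carrier) (X : H) :
    IsBal (fun a => W.bim.ract a) K.rt fun q y => φ (tm p q) (X * y) := by
  have hb := hφ.bal
  obtain ⟨φ, rfl⟩ := hφ.exists_bilin
  refine .mk fun a q y => ?_
  rw [← tensBim_ract_tm]
  simpa [mul_assoc] using hb a (tm p q) (X * y)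

/-- The sum over `W` is placed inside: a base element on the right of `p` moves to the left of `q`,
and the Takeuchi condition for `W` turns it into `t_R(a)` between the two factors from `H`. -/
theorem isBal_tensR_left {φ : Tens V W → H → P}
    (hφ : IsBal (fun a => (tensBim V W).ract a) K.rt φ) (X : H) (w : W.carrier) :
    IsBal (fun a => V.bim.ract a) K.rt fun p x => sw (W.δR w) fun q y =>
      φ (tm p q) (X * (x * y)) := by
  have ht := fun p x a => W.comodR.sw_takeuchi (isBal_tensR_right hφ p (X * x)) a w
  obtain ⟨φ, rfl⟩ := hφ.exists_bilin
  refine .mk fun a p x => ?_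
  simpa [tm_balanced, mul_assoc] using ht p x a

/-- Both `v a ⊗ w` and `v ⊗ a w` produce `v_[1] s_R(a) w_[1]` in the last factor. -/
theorem isBal_tensR {φ : Tens V W → H → P} (hφ : IsBal (fun a => (tensBim V W).ract a) K.rt φ) :
    IsBal V.ract W.lact fun v w => sw (V.δR v) fun p x => sw (W.δR w) fun q y =>
      φ (tm p q) (x * y) := by
  have h1 := fun w a v => V.comodR.sw_δ_ract (isBal_tensR_left hφ 1 w) a v
  have h2 := fun p x a w => W.comodR.sw_δ_lact (isBal_tensR_right hφ p x) a w
  obtain ⟨φ, rfl⟩ := hφ.exists_bilin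
  refine .mk fun a v w => ?_
  simp only [one_mul] at h1
  rw [h1]
  simp only [h2, mul_assoc]

variable (V W) in
/-- The coaction of the right bialgebroid on `V ⊗_A W`. -/
def tensδR : Tens V W →ₗ[ℂ] RTens K (tensBim V W) :=
  swLin _ _ fun v w => sw (V.δR v) fun p x => sw (W.δR w) fun q y => Bal.tmul _ _ (tm p q) (x * y)

theorem tensδR_tm (v : V.carrier) (w : W.carrier) : tensδR V W (tm v w) =
    sw (V.δR v) fun p x => sw (W.δR w) fun q y => Bal.tmul _ _ (tm p q) (x * y) :=
  sw_tmul (isBal_tensR isBal_tmul) v w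

theorem sw_tensδR_tm {φ : Tens V W → H → P}
    (hφ : IsBal (fun a => (tensBim V W).ract a) K.rt φ) (v : V.carrier) (w : W.carrier) :
    sw (tensδR V W (tm v w)) φ =
      sw (V.δR v) fun p x => sw (W.δR w) fun q y => φ (tm p q) (x * y) := by
  rw [tensδR_tm]
  simp only [sw_sw, sw_tmul hφ]

theorem isBal_tensL_left {φ : Tens V W → H → P}
    (hφ : IsBal (fun b : B => (tensBim V W).lact (op b)) K.ls φ) (q : W.carrier) (X : H) :
    IsBal (fun b : B => V.bim.lact (op b)) K.ls fun p x => φ (tm p q) (x * X) := by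
  have hb := hφ.bal
  obtain ⟨φ, rfl⟩ := hφ.exists_bilin
  refine .mk fun a p x => ?_
  rw [← tensBim_lact_tm]
  simpa [mul_assoc] using hb a (tm p q) (x * X)

/-- For the left bialgebroid the Takeuchi condition absorbs right multiplication by the base, so it
is used for `V`. The order of the sums is therefore opposite to that for `δ_R`. -/
theorem isBal_tensL_right {φ : Tens V W → H → P}
    (hφ : IsBal (fun b : B => (tensBim V W).lact (op b)) K.ls φ) (X : H) (v : V.carrier) :
    IsBal (fun b : B => W.bim.lact (op b)) K.ls fun q y => sw (V.δL v) fun p x =>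
      φ (tm p q) (x * y * X) := by
  have ht := fun q y a => V.comodL.sw_takeuchi (isBal_tensL_left hφ q (y * X)) a v
  obtain ⟨φ, rfl⟩ := hφ.exists_bilin
  refine .mk fun a q y => ?_
  simpa [tm_balanced, mul_assoc] using (ht q y a)

theorem isBal_tensL {φ : Tens V W → H → P}
    (hφ : IsBal (fun b : B => (tensBim V W).lact (op b)) K.ls φ) :
    IsBal V.ract W.lact fun v w => sw (W.δL w) fun q y => sw (V.δL v) fun p x =>
      φ (tm p q) (x * y) := by
  have h1 := fun v a w => W.comodL.sw_δ_lact (isBal_tensL_right hφ 1 v) a w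
  have h2 := fun q y a v => V.comodL.sw_δ_ract (isBal_tensL_left hφ q y) a v
  obtain ⟨φ, rfl⟩ := hφ.exists_bilin
  refine .mk fun a v w => ?_
  obtain ⟨b, rfl⟩ : ∃ b, a = op b := ⟨unop a, rfl⟩
  simp only [mul_one] at h1
  rw [h1]
  simp only [h2, mul_assoc]

variable (V W) in
/-- The coaction of the left bialgebroid on `V ⊗_A W`. -/
def tensδL : Tens V W →ₗ[ℂ] LTens K (tensBim V W) :=
  swLin _ _ fun v w => sw (W.δL w) fun q y => sw (V.δL v) fun p x => Bal.tmul _ _ (tm p q) (x * y)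

theorem tensδL_tm (v : V.carrier) (w : W.carrier) : tensδL V W (tm v w) =
    sw (W.δL w) fun q y => sw (V.δL v) fun p x => Bal.tmul _ _ (tm p q) (x * y) :=
  sw_tmul (isBal_tensL isBal_tmul) v w

theorem sw_tensδL_tm {φ : Tens V W → H → P}
    (hφ : IsBal (fun b : B => (tensBim V W).lact (op b)) K.ls φ) (v : V.carrier) (w : W.carrier) :
    sw (tensδL V W (tm v w)) φ =
      sw (W.δL w) fun q y => sw (V.δL v) fun p x => φ (tm p q) (x * y) := by
  rw [tensδL_tm]
  simp only [sw_sw, sw_tmul hφ]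

end FullYD

end YDTensor

/-! ### Comodule axioms, mixed axioms and Yetter–Drinfeld condition for `V ⊗_A W` -/

section YDTensorComodule

variable {B H : Type u} [Ring B] [Algebra ℂ B] [Ring H] [Algebra ℂ H] {K : FullHopfAlgebroid B H}

open Bal

namespace FullYD

variable {V W : FullYD K} {P : Type*} [AddCommGroup P] [Module ℂ P]

theorem tensR_takeuchi {φ : Tens V W → H → P} (hφ : IsBal (fun a => (tensBim V W).ract a) K.rt φ)
    (p : V.carrier) (X : H) (a : Bᵐᵒᵖ) (w : W.carrier) :
    (sw (W.δR w) fun q y => φ (tm (V.bim.ract a p) q) (X * y)) =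
      sw (W.δR w) fun q y => φ (tm p q) (X * (K.tR a * y)) := by
  simpa only [tm_balanced] using W.comodR.sw_takeuchi (isBal_tensR_right hφ p X) a w

theorem tensL_takeuchi {φ : Tens V W → H → P}
    (hφ : IsBal (fun b : B => (tensBim V W).lact (op b)) K.ls φ)
    (q : W.carrier) (X : H) (b : B) (v : V.carrier) :
    (sw (V.δL v) fun p x => φ (tm p (W.bim.lact (op b) q)) (x * X)) =
      sw (V.δL v) fun p x => φ (tm p q) (x * K.s b * X) := by
  simpa only [tm_balanced] using V.comodL.sw_takeuchi (isBal_tensL_left hφ q X) b v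

theorem isBal_lact_left {φ : Tens V W → H → P}
    (hφ : IsBal (fun a => (tensBim V W).ract a) K.rt φ) (a : Bᵐᵒᵖ) :
    IsBal (fun a => (tensBim V W).ract a) K.rt fun z X => φ ((tensBim V W).lact a z) X := by
  have hb := hφ.bal
  obtain ⟨φ, rfl⟩ := hφ.exists_bilin
  exact .mk fun b z X => by simpa [(tensBim V W).lact_ract] using hb b ((tensBim V W).lact a z) X

theorem isBal_ract_left {φ : Tens V W → H → P}
    (hφ : IsBal (fun b : B => (tensBim V W).lact (op b)) K.ls φ) (a : Bᵐᵒᵖ) :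
    IsBal (fun b : B => (tensBim V W).lact (op b)) K.ls
      fun z X => φ ((tensBim V W).ract a z) X := by
  have hb := hφ.bal
  obtain ⟨φ, rfl⟩ := hφ.exists_bilin
  exact .mk fun b z X => by simpa [← (tensBim V W).lact_ract] using hb b ((tensBim V W).ract a z) X

theorem sw_tensδR_bimod {φ : Tens V W → H → P}
    (hφ : IsBal (fun a => (tensBim V W).ract a) K.rt φ) (a a' : Bᵐᵒᵖ) (z : Tens V W) :
    sw (tensδR V W ((tensBim V W).lact a ((tensBim V W).ract a' z))) φ =
      sw (tensδR V W z) fun P X => φ P (K.sR a * X * K.sR a') := by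
  induction z using Bal.induction with
  | add x y hx hy => simp only [map_add, sw_add, hx, hy]
  | tmul v w =>
    have h1 := isBal_tensR_left hφ 1 (W.bim.ract a' w)
    simp only [one_mul] at h1
    rw [tensBim_ract_tm, tensBim_lact_tm, sw_tensδR_tm hφ, V.comodR.sw_δ_lact h1,
      sw_tensδR_tm (RightRComodule.isBal_sR_mul hφ _ _)]
    refine sw_congr _ fun p x => ?_
    rw [W.comodR.sw_δ_ract (isBal_tensR_right hφ p (K.sR a * x))]
    simp only [mul_assoc]

theorem sw_tensδR_takeuchi {φ : Tens V W → H → P}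
    (hφ : IsBal (fun a => (tensBim V W).ract a) K.rt φ) (a : Bᵐᵒᵖ) (z : Tens V W) :
    sw (tensδR V W z) (fun P X => φ ((tensBim V W).lact a P) X) =
      sw (tensδR V W z) fun P X => φ P (K.tR a * X) := by
  induction z using Bal.induction with
  | add x y hx hy => simp only [map_add, sw_add, hx, hy]
  | tmul v w =>
    have h1 := isBal_tensR_left hφ 1 w
    simp only [one_mul] at h1
    have h2 : IsBal (fun a => (tensBim V W).ract a) K.rt fun z X => φ z (K.tR a * X) := by
      simpa [K.sR_one] using RightRComodule.isBal_sR_mul hφ (K.tR a) 1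
    rw [sw_tensδR_tm (isBal_lact_left hφ a), sw_tensδR_tm h2]
    simp only [tensBim_lact_tm, ← mul_assoc]
    exact V.comodR.sw_takeuchi h1 a v

/-- Multiplicativity of `Δ_R` reduces this to coassociativity of `W` with the components of `V`
frozen (`e₁`), then of `V` (`e₂`). Since sums commute, each can be applied to an innermost pair; the
remaining work is the balancedness of the summands, which comes from Takeuchi conditions. -/
theorem sw_tensδR_coassoc (z : Tens V W) :
    (sw (tensδR V W z) fun P X => sw (tensδR V W P) fun P' X' =>
        Bal₃.tmul (fun a => (tensBim V W).ract a) K.rt K.rs K.rt P' X' X) =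
      sw (tensδR V W z) fun P X => sw (K.ΔR X) fun x y =>
        Bal₃.tmul (fun a => (tensBim V W).ract a) K.rt K.rs K.rt P x y := by
  set τ := Bal₃.tmul (fun a => (tensBim V W).ract a) K.rt K.rs K.rt with hτ
  have b₁ : ∀ a z x y, τ ((tensBim V W).ract a z) x y = τ z (x * K.tR a) y :=
    Bal₃.tmul_balanced₁ (fun a => (tensBim V W).ract a) K.rt K.rs K.rt
  have b₂ : ∀ a z x y, τ z (x * K.sR a) y = τ z x (y * K.tR a) :=
    Bal₃.tmul_balanced₂ (fun a => (tensBim V W).ract a) K.rt K.rs K.rt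
  -- From here on only the two balancing rules of the threefold tensor product matter.
  clear_value τ
  have c₁ : ∀ y, IsBal (fun a => (tensBim V W).ract a) K.rt fun z x => τ z x y :=
    fun y => .mk fun a z x => b₁ a z x y
  have c₂ : ∀ z, IsBal K.rs K.rt fun x y => τ z x y := fun z => .mk fun a x y => b₂ a z x y
  induction z using Bal.induction with
  | add x y hx hy => simp only [map_add, sw_add, hx, hy]
  | tmul v w =>
    have d₁ : IsBal (fun a => (tensBim V W).ract a) K.rt fun P X =>
        sw (tensδR V W P) fun P' X' => τ P' X' X := .mk fun a P X => by
      have := sw_tensδR_bimod (c₁ X) 1 a P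
      simp only [(tensBim V W).lact_one, K.sR_one, one_mul, b₂] at this
      exact this
    have d₂ : IsBal (fun a => (tensBim V W).ract a) K.rt fun P X =>
        sw (K.ΔR X) fun x y => τ P x y := .mk fun a P X => by
      rw [LinearMap.mulRight_apply, K.sw_ΔR_mul_tR (c₂ P)]
      simp only [b₁]
    rw [sw_tensδR_tm d₁, sw_tensδR_tm d₂]
    simp only [sw_tensδR_tm (c₁ _), fun z X Y => K.sw_ΔR_mul (c₂ z) X Y]
    have e₁ : ∀ (p' : V.carrier) (x' x : H),
        (sw (W.δR w) fun q y => sw (W.δR q) fun q' y' => τ (tm p' q') (x' * y') (x * y)) =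
        sw (W.δR w) fun q y => sw (K.ΔR y) fun y₁ y₂ => τ (tm p' q) (x' * y₁) (x * y₂) :=
      fun p' x' x => W.comodR.sw_coassoc (.mk
        (fun a q y₁ y₂ => by rw [← tensBim_ract_tm, b₁]; simp [mul_assoc])
        (fun a q y₁ y₂ => by simpa [mul_assoc] using b₂ a (tm p' q) (x' * y₁) (x * y₂))) w
    have e₂ := V.comodR.sw_coassoc (τ := fun p x₁ x₂ => sw (W.δR w) fun q y =>
      sw (K.ΔR y) fun y₁ y₂ => τ (tm p q) (x₁ * y₁) (x₂ * y₂)) (.mk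
        (fun a p x₁ x₂ => by
          have f : IsBal (fun a => (tensBim V W).ract a) K.rt fun P X =>
              sw (K.ΔR X) fun y₁ y₂ => τ P (x₁ * y₁) (x₂ * y₂) := .mk fun a P X => by
            rw [LinearMap.mulRight_apply, K.sw_ΔR_mul_tR (K.isBal_mul_left (c₂ P) x₁ x₂)]
            simp only [b₁, mul_assoc]
          have := tensR_takeuchi f p 1 a w
          simpa only [one_mul, fun P X => K.sw_ΔR_tR_mul (K.isBal_mul_left (c₂ P) x₁ x₂) a X,
            LinearMap.mulRight_apply, mul_assoc] using this)
        (fun a p x₁ x₂ => by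
          refine sw_congr _ fun q y => ?_
          simpa [mul_assoc] using K.sw_ΔR_takeuchi (K.isBal_mul_left (c₂ (tm p q)) x₁ x₂) a y)) v
    calc _ = sw (V.δR v) fun p x => sw (V.δR p) fun p' x' => sw (W.δR w) fun q y =>
          sw (W.δR q) fun q' y' => τ (tm p' q') (x' * y') (x * y) :=
          sw_congr _ fun p x => sw_comm _ _ _
      _ = _ := by
        simp only [e₁]
        rw [e₂]
        exact sw_congr _ fun p x => sw_comm _ _ _

/-- As `ε_R(x y) = ε_R(t_R(ε_R(x)) y)`, the Takeuchi condition for `W` turns `ε_R(x)` into a left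
multiplication on `W`. The counit law of `W` applies, `ε_R(x)` crosses to `V`, and the counit law of
`V` finishes. -/
theorem sw_tensδR_counit (z : Tens V W) :
    (sw (tensδR V W z) fun P X => (tensBim V W).ract (K.εR X) P) = z := by
  induction z using Bal.induction with
  | add x y hx hy => simp only [map_add, sw_add, hx, hy]
  | tmul v w =>
    rw [sw_tensδR_tm (.mk fun a z X => by
      rw [LinearMap.mulRight_apply, K.εR_mul_tR, (tensBim V W).ract_mul])]
    have h : ∀ p x, (sw (W.δR w) fun q y => (tensBim V W).ract (K.εR (x * y)) (tm p q)) =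
        tm (V.bim.ract (K.εR x) p) w := fun p x => by
      have hb : IsBal (fun a => W.bim.ract a) K.rt fun q y =>
          tm p (W.bim.ract (K.εR y) q) := .mk fun a q y => by
        rw [LinearMap.mulRight_apply, K.εR_mul_tR, W.bim.ract_mul]
      have := W.comodR.sw_takeuchi hb (K.εR x) w
      simp only [K.εR_tR_mul, ← W.bim.lact_ract] at this
      simp only [tensBim_ract_tm, ← this, tm_balanced]
      conv_rhs => rw [← W.comodR.sw_counit w]
      exact (map_sw (Bal.tmul V.ract W.lact p ∘ₗ W.bim.lact (K.εR x)) _ _).symm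
    simp only [h]
    conv_rhs => rw [← V.comodR.sw_counit v]
    exact (map_sw ((Bal.tmul V.ract W.lact).flip w) _ _).symm

variable (V W) in
/-- The comodule structure of `V ⊗_A W` over the right bialgebroid. -/
def tensComodR : RightRComodule K (tensBim V W) :=
  .ofSw (tensδR V W)
    (fun a a' z => by rw [← sw_tensδR_bimod isBal_tmul, sw_self])
    (sw_tensδR_takeuchi isBal_tmul) sw_tensδR_coassoc sw_tensδR_counit

theorem sw_tensδL_bimod {φ : Tens V W → H → P}
    (hφ : IsBal (fun b : B => (tensBim V W).lact (op b)) K.ls φ) (b b' : B) (z : Tens V W) :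
    sw (tensδL V W ((tensBim V W).lact (op b) ((tensBim V W).ract (op b') z))) φ =
      sw (tensδL V W z) fun P X => φ P (K.t (op b) * X * K.t (op b')) := by
  induction z using Bal.induction with
  | add x y hx hy => simp only [map_add, sw_add, hx, hy]
  | tmul v w =>
    have h1 := isBal_tensL_right hφ 1 (V.bim.lact (op b) v)
    simp only [mul_one] at h1
    rw [tensBim_ract_tm, tensBim_lact_tm, sw_tensδL_tm hφ, W.comodL.sw_δ_ract h1,
      sw_tensδL_tm (RightLComodule.isBal_t_mul hφ _ _)]
    refine sw_congr _ fun q y => ?_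
    rw [V.comodL.sw_δ_lact (isBal_tensL_left hφ q (y * K.t (op b')))]
    simp only [mul_assoc]

theorem sw_tensδL_takeuchi {φ : Tens V W → H → P}
    (hφ : IsBal (fun b : B => (tensBim V W).lact (op b)) K.ls φ) (b : B) (z : Tens V W) :
    sw (tensδL V W z) (fun P X => φ ((tensBim V W).ract (op b) P) X) =
      sw (tensδL V W z) fun P X => φ P (X * K.s b) := by
  induction z using Bal.induction with
  | add x y hx hy => simp only [map_add, sw_add, hx, hy]
  | tmul v w =>
    have h1 := isBal_tensL_right hφ 1 v
    simp only [mul_one] at h1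
    have h2 : IsBal (fun b : B => (tensBim V W).lact (op b)) K.ls fun z X => φ z (X * K.s b) := by
      simpa using RightLComodule.isBal_t_mul hφ (K.s b) 1
    rw [sw_tensδL_tm (isBal_ract_left hφ (op b)), sw_tensδL_tm h2]
    simp only [tensBim_ract_tm, mul_assoc]
    exact W.comodL.sw_takeuchi h1 b w

/-- Mirror image of the case of `δ_R`: coassociativity of `V` comes first and that of `W` second, in
accordance with the reversed order of the sums. -/
theorem sw_tensδL_coassoc (z : Tens V W) :
    (sw (tensδL V W z) fun P X => sw (tensδL V W P) fun P' X' =>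
        Bal₃.tmul (fun b : B => (tensBim V W).lact (op b)) K.ls K.lt K.ls P' X' X) =
      sw (tensδL V W z) fun P X => sw (K.Δ X) fun x y =>
        Bal₃.tmul (fun b : B => (tensBim V W).lact (op b)) K.ls K.lt K.ls P x y := by
  set τ := Bal₃.tmul (fun b : B => (tensBim V W).lact (op b)) K.ls K.lt K.ls with hτ
  have b₁ : ∀ (b : B) z x y, τ ((tensBim V W).lact (op b) z) x y = τ z (K.s b * x) y :=
    Bal₃.tmul_balanced₁ (fun b : B => (tensBim V W).lact (op b)) K.ls K.lt K.ls
  have b₂ : ∀ (b : B) z x y, τ z (K.t (op b) * x) y = τ z x (K.s b * y) :=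
    Bal₃.tmul_balanced₂ (fun b : B => (tensBim V W).lact (op b)) K.ls K.lt K.ls
  clear_value τ
  have c₁ : ∀ y, IsBal (fun b : B => (tensBim V W).lact (op b)) K.ls fun z x => τ z x y :=
    fun y => .mk fun a z x => b₁ a z x y
  have c₂ : ∀ z, IsBal K.lt K.ls fun x y => τ z x y := fun z => .mk fun a x y => b₂ a z x y
  induction z using Bal.induction with
  | add x y hx hy => simp only [map_add, sw_add, hx, hy]
  | tmul v w =>
    have d₁ : IsBal (fun b : B => (tensBim V W).lact (op b)) K.ls fun P X =>
        sw (tensδL V W P) fun P' X' => τ P' X' X := .mk fun b P X => by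
      have := sw_tensδL_bimod (c₁ X) b 1 P
      simp only [op_one, (tensBim V W).ract_one, map_one, mul_one, b₂] at this
      exact this
    have d₂ : IsBal (fun b : B => (tensBim V W).lact (op b)) K.ls fun P X =>
        sw (K.Δ X) fun x y => τ P x y := .mk fun a P X => by
      rw [LinearMap.mulLeft_apply, K.sw_Δ_s_mul (c₂ P)]
      simp only [b₁]
    rw [sw_tensδL_tm d₁, sw_tensδL_tm d₂]
    simp only [sw_tensδL_tm (c₁ _), fun z X Y => K.sw_Δ_mul (c₂ z) X Y]
    have e₁ : ∀ (q' : W.carrier) (y' y : H),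
        (sw (V.δL v) fun p x => sw (V.δL p) fun p' x' => τ (tm p' q') (x' * y') (x * y)) =
        sw (V.δL v) fun p x => sw (K.Δ x) fun x₁ x₂ => τ (tm p q') (x₁ * y') (x₂ * y) :=
      fun q' y' y => V.comodL.sw_coassoc (.mk
        (fun a p x₁ x₂ => by rw [← tensBim_lact_tm, b₁]; simp [mul_assoc])
        (fun a p x₁ x₂ => by simpa [mul_assoc] using b₂ a (tm p q') (x₁ * y') (x₂ * y))) v
    have e₂ := W.comodL.sw_coassoc (τ := fun q y₁ y₂ => sw (V.δL v) fun p x =>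
      sw (K.Δ x) fun x₁ x₂ => τ (tm p q) (x₁ * y₁) (x₂ * y₂)) (.mk
        (fun a q y₁ y₂ => by
          have f : IsBal (fun b : B => (tensBim V W).lact (op b)) K.ls fun P X =>
              sw (K.Δ X) fun x₁ x₂ => τ P (x₁ * y₁) (x₂ * y₂) := .mk fun a P X => by
            rw [LinearMap.mulLeft_apply, K.sw_Δ_s_mul (K.isBal_mul_right (c₂ P) y₁ y₂)]
            simp only [b₁, mul_assoc]
          have := tensL_takeuchi f q 1 a v
          simpa only [mul_one, fun P X => K.sw_Δ_mul_s (K.isBal_mul_right (c₂ P) y₁ y₂) a X,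
            LinearMap.mulLeft_apply, mul_assoc] using this)
        (fun a q y₁ y₂ => by
          refine sw_congr _ fun p x => ?_
          simpa [mul_assoc] using K.sw_Δ_takeuchi (K.isBal_mul_right (c₂ (tm p q)) y₁ y₂) a x)) w
    calc _ = sw (W.δL w) fun q y => sw (W.δL q) fun q' y' => sw (V.δL v) fun p x =>
          sw (V.δL p) fun p' x' => τ (tm p' q') (x' * y') (x * y) :=
          sw_congr _ fun p x => sw_comm _ _ _
      _ = _ := by
        simp only [e₁]
        rw [e₂]
        exact sw_congr _ fun p x => sw_comm _ _ _

/-- Here `ε_L(x y) = ε_L(x s_L(ε_L(y)))`, so the Takeuchi condition and the counit law are used for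
`V` first. -/
theorem sw_tensδL_counit (z : Tens V W) :
    (sw (tensδL V W z) fun P X => (tensBim V W).lact (op (K.ε X)) P) = z := by
  induction z using Bal.induction with
  | add x y hx hy => simp only [map_add, sw_add, hx, hy]
  | tmul v w =>
    rw [sw_tensδL_tm (.mk fun a z X => by
      rw [LinearMap.mulLeft_apply, K.ε_s_mul, op_mul, (tensBim V W).lact_mul])]
    have h : ∀ q y, (sw (V.δL v) fun p x => (tensBim V W).lact (op (K.ε (x * y))) (tm p q)) =
        tm v (W.bim.lact (op (K.ε y)) q) := fun q y => by
      have hb : IsBal (fun b : B => V.bim.lact (op b)) K.ls fun p x =>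
          tm (V.bim.lact (op (K.ε x)) p) q := .mk fun a p x => by
        rw [LinearMap.mulLeft_apply, K.ε_s_mul, op_mul, V.bim.lact_mul]
      have := V.comodL.sw_takeuchi hb (K.ε y) v
      simp only [← K.ε_mul_s, V.bim.lact_ract] at this
      simp only [tensBim_lact_tm, ← this, tm_balanced]
      conv_rhs => rw [← V.comodL.sw_counit v]
      exact (map_sw ((Bal.tmul V.ract W.lact).flip (W.bim.lact (op (K.ε y)) q)) _ _).symm
    simp only [h]
    conv_rhs => rw [← W.comodL.sw_counit w, map_sw]

variable (V W) in
/-- The comodule structure of `V ⊗_A W` over the left bialgebroid. -/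
def tensComodL : RightLComodule K (tensBim V W) :=
  .ofSw (tensδL V W)
    (fun b b' z => by rw [← sw_tensδL_bimod isBal_tmul, sw_self])
    (sw_tensδL_takeuchi isBal_tmul) sw_tensδL_coassoc sw_tensδL_counit

/-- After `Δ_R` is expanded on the product, the mixed axiom is applied to `V` and then to `W`, with
an exchange of independent sums between the two. -/
theorem tens_mixed_LR (z : Tens V W) :
    (sw (tensδL V W z) fun P X => sw (K.ΔR X) fun x y =>
        Bal₃.tmul (fun b : B => (tensBim V W).lact (op b)) K.ls K.rs K.rt P x y) =
      sw (tensδR V W z) fun P X => sw (tensδL V W P) fun P' X' =>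
        Bal₃.tmul (fun b : B => (tensBim V W).lact (op b)) K.ls K.rs K.rt P' X' X := by
  set τ := Bal₃.tmul (fun b : B => (tensBim V W).lact (op b)) K.ls K.rs K.rt with hτ
  have b₁ : ∀ (b : B) z x y, τ ((tensBim V W).lact (op b) z) x y = τ z (K.s b * x) y :=
    Bal₃.tmul_balanced₁ (fun b : B => (tensBim V W).lact (op b)) K.ls K.rs K.rt
  have b₂ : ∀ a z x y, τ z (x * K.sR a) y = τ z x (y * K.tR a) :=
    Bal₃.tmul_balanced₂ (fun b : B => (tensBim V W).lact (op b)) K.ls K.rs K.rt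
  clear_value τ
  have c₁ : ∀ y, IsBal (fun b : B => (tensBim V W).lact (op b)) K.ls fun z x => τ z x y :=
    fun y => .mk fun a z x => b₁ a z x y
  have c₂ : ∀ z, IsBal K.rs K.rt fun x y => τ z x y := fun z => .mk fun a x y => b₂ a z x y
  induction z using Bal.induction with
  | add x y hx hy => simp only [map_add, sw_add, hx, hy]
  | tmul v w =>
    have d₁ : IsBal (fun a => (tensBim V W).ract a) K.rt fun P X =>
        sw (tensδL V W P) fun P' X' => τ P' X' X := .mk fun a P X => by
      have := sw_tensδL_bimod (c₁ X) 1 (unop a) P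
      simp only [op_one, (tensBim V W).lact_one, map_one, one_mul] at this
      exact this.trans (sw_congr _ fun x y => b₂ a x y X)
    have d₂ : IsBal (fun b : B => (tensBim V W).lact (op b)) K.ls fun P X =>
        sw (K.ΔR X) fun x y => τ P x y := .mk fun a P X => by
      rw [LinearMap.mulLeft_apply, K.sw_ΔR_s_mul (c₂ P)]
      simp only [b₁]
    rw [sw_tensδR_tm d₁, sw_tensδL_tm d₂]
    simp only [sw_tensδL_tm (c₁ _), fun z X Y => K.sw_ΔR_mul (c₂ z) X Y]
    have e₁ : ∀ (q : W.carrier) (y : H),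
        (sw (V.δL v) fun p x => sw (K.ΔR x) fun x₁ x₂ => sw (K.ΔR y) fun y₁ y₂ =>
          τ (tm p q) (x₁ * y₁) (x₂ * y₂)) =
        sw (V.δR v) fun p x => sw (V.δL p) fun p' x' => sw (K.ΔR y) fun y₁ y₂ =>
          τ (tm p' q) (x' * y₁) (x * y₂) :=
      fun q y => V.sw_mixed_LR (.mk
        (fun a p x₁ x₂ => by simp only [← tensBim_lact_tm, b₁, LinearMap.mulLeft_apply, mul_assoc])
        (fun a p x₁ x₂ => by
          simpa [mul_assoc] using K.sw_ΔR_takeuchi (K.isBal_mul_left (c₂ (tm p q)) x₁ x₂) a y)) v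
    have e₂ : ∀ (p : V.carrier) (x : H),
        (sw (W.δL w) fun q y => sw (K.ΔR y) fun y₁ y₂ => sw (V.δL p) fun p' x' =>
          τ (tm p' q) (x' * y₁) (x * y₂)) =
        sw (W.δR w) fun q y => sw (W.δL q) fun q' y' => sw (V.δL p) fun p' x' =>
          τ (tm p' q') (x' * y') (x * y) :=
      fun p x => W.sw_mixed_LR (τ := fun q y₁ y₂ => sw (V.δL p) fun p' x' =>
          τ (tm p' q) (x' * y₁) (x * y₂)) (.mk
        (fun a q y₁ y₂ => by simpa [mul_assoc] using tensL_takeuchi (c₁ (x * y₂)) q y₁ a p)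
        (fun a q y₁ y₂ => sw_congr _ fun p' x' => by
          simpa [mul_assoc] using b₂ a (tm p' q) (x' * y₁) (x * y₂))) w
    simp only [e₁]
    rw [sw_comm]
    refine sw_congr _ fun p x => (Eq.trans (sw_congr _ fun q y => sw_comm _ _ _) (e₂ p x))

theorem tens_mixed_RL (z : Tens V W) :
    (sw (tensδR V W z) fun P X => sw (K.Δ X) fun x y =>
        Bal₃.tmul (fun a => (tensBim V W).ract a) K.rt K.lt K.ls P x y) =
      sw (tensδL V W z) fun P X => sw (tensδR V W P) fun P' X' =>
        Bal₃.tmul (fun a => (tensBim V W).ract a) K.rt K.lt K.ls P' X' X := by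
  set τ := Bal₃.tmul (fun a => (tensBim V W).ract a) K.rt K.lt K.ls with hτ
  have b₁ : ∀ a z x y, τ ((tensBim V W).ract a z) x y = τ z (x * K.tR a) y :=
    Bal₃.tmul_balanced₁ (fun a => (tensBim V W).ract a) K.rt K.lt K.ls
  have b₂ : ∀ (b : B) z x y, τ z (K.t (op b) * x) y = τ z x (K.s b * y) :=
    Bal₃.tmul_balanced₂ (fun a => (tensBim V W).ract a) K.rt K.lt K.ls
  clear_value τ
  have c₁ : ∀ y, IsBal (fun a => (tensBim V W).ract a) K.rt fun z x => τ z x y :=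
    fun y => .mk fun a z x => b₁ a z x y
  have c₂ : ∀ z, IsBal K.lt K.ls fun x y => τ z x y := fun z => .mk fun a x y => b₂ a z x y
  induction z using Bal.induction with
  | add x y hx hy => simp only [map_add, sw_add, hx, hy]
  | tmul v w =>
    have d₁ : IsBal (fun b : B => (tensBim V W).lact (op b)) K.ls fun P X =>
        sw (tensδR V W P) fun P' X' => τ P' X' X := .mk fun b P X => by
      have := sw_tensδR_bimod (c₁ X) (op b) 1 P
      simp only [(tensBim V W).ract_one, K.sR_one, mul_one] at this
      exact this.trans (sw_congr _ fun x y => b₂ b x y X)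
    have d₂ : IsBal (fun a => (tensBim V W).ract a) K.rt fun P X =>
        sw (K.Δ X) fun x y => τ P x y := .mk fun a P X => by
      rw [LinearMap.mulRight_apply, K.sw_Δ_mul_tR (c₂ P)]
      simp only [b₁]
    rw [sw_tensδL_tm d₁, sw_tensδR_tm d₂]
    simp only [sw_tensδR_tm (c₁ _), fun z X Y => K.sw_Δ_mul (c₂ z) X Y]
    have e₁ : ∀ (p : V.carrier) (x : H),
        (sw (W.δR w) fun q y => sw (K.Δ y) fun y₁ y₂ => sw (K.Δ x) fun x₁ x₂ =>
          τ (tm p q) (x₁ * y₁) (x₂ * y₂)) =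
        sw (W.δL w) fun q y => sw (W.δR q) fun q' y' => sw (K.Δ x) fun x₁ x₂ =>
          τ (tm p q') (x₁ * y') (x₂ * y) :=
      fun p x => W.sw_mixed_RL (.mk
        (fun a q y₁ y₂ => by simp only [← tensBim_ract_tm, b₁, LinearMap.mulRight_apply, mul_assoc])
        (fun a q y₁ y₂ => by
          simpa [mul_assoc] using K.sw_Δ_takeuchi (K.isBal_mul_right (c₂ (tm p q)) y₁ y₂) a x)) w
    have e₂ : ∀ (q : W.carrier) (y : H),
        (sw (V.δR v) fun p x => sw (K.Δ x) fun x₁ x₂ => sw (W.δR q) fun q' y' =>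
          τ (tm p q') (x₁ * y') (x₂ * y)) =
        sw (V.δL v) fun p x => sw (V.δR p) fun p' x' => sw (W.δR q) fun q' y' =>
          τ (tm p' q') (x' * y') (x * y) :=
      fun q y => V.sw_mixed_RL (τ := fun p x₁ x₂ => sw (W.δR q) fun q' y' =>
          τ (tm p q') (x₁ * y') (x₂ * y)) (.mk
        (fun a p x₁ x₂ => by simpa [mul_assoc] using tensR_takeuchi (c₁ (x₂ * y)) p x₁ a q)
        (fun a p x₁ x₂ => sw_congr _ fun q' y' => by
          simpa [mul_assoc] using b₂ a (tm p q') (x₁ * y') (x₂ * y))) v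
    simp only [e₁]
    rw [sw_comm]
    refine sw_congr _ fun q y => (Eq.trans (sw_congr _ fun p x => sw_comm _ _ _) (e₂ q y))

/-- With `X` split into three components, the condition for `V` moves the first component past
`v_[1]`, and the condition for `W` then moves the middle one past `w_[1]`. Coassociativity of `Δ_R`
regroups the components before, between and after these moves (`e₁`, `e₃`, `e₅`). -/
theorem tens_yd (z : Tens V W) (X : H) :
    (sw (K.ΔR X) fun x y => sw (tensδR V W (tensAct V W y z)) fun P Z =>
        Bal.tmul (fun a => (tensBim V W).ract a) K.rt P (x * Z)) =
      sw (tensδR V W z) fun P Z => sw (K.ΔR X) fun x y =>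
        Bal.tmul (fun a => (tensBim V W).ract a) K.rt (tensAct V W x P) (Z * y) := by
  have hφ : IsBal (fun a => (tensBim V W).ract a) K.rt fun P Z =>
      Bal.tmul (fun a => (tensBim V W).ract a) K.rt P Z := isBal_tmul
  set φ := Bal.tmul (fun a => (tensBim V W).ract a) K.rt
  clear_value φ
  have hb : ∀ a P Z, φ ((tensBim V W).ract a P) Z = φ P (Z * K.tR a) := hφ.bal
  have hφ' : ∀ x, IsBal (fun a => (tensBim V W).ract a) K.rt fun P Z => φ P (x * Z) := fun x => by
    simpa [K.sR_one] using RightRComodule.isBal_sR_mul hφ x 1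
  induction z using Bal.induction with
  | add x y hx hy => simp only [map_add, sw_add, sw_fun_add, hx, hy]
  | tmul v w =>
    have hA : IsBal (fun a => (tensBim V W).ract a) K.rt fun P Z =>
        sw (K.ΔR X) fun x y => φ (tensAct V W x P) (Z * y) :=
      isBal_sw_act_mul (mod := tensMod V W) (tensAct_sR V W) hφ X
    rw [sw_tensδR_tm hA]
    simp only [tensAct_tm, map_sw, sw_sw, fun x v w => sw_tensδR_tm (hφ' x) v w]
    have hL : ∀ (x : H) (w : W.carrier), IsBal (fun a => V.bim.ract a) K.rt fun p α =>
        sw (W.δR w) fun q β => φ (tm p q) (x * (α * β)) := fun x w => isBal_tensR_left hφ x w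
    have hR : ∀ (p : V.carrier) (x : H), IsBal (fun a => W.bim.ract a) K.rt fun q β =>
        φ (tm p q) (x * β) := fun p x => isBal_tensR_right hφ p x
    have e₁ := K.sw_ΔR_coassoc (τ := fun x₁ x₂ x₃ => sw (V.δR (V.act x₂ v)) fun p α =>
      sw (W.δR (W.act x₃ w)) fun q β => φ (tm p q) (x₁ * (α * β))) (.mk
        (fun a x₁ x₂ x₃ => by
          simp only [LinearMap.mulRight_apply, V.mod.act_mul, V.act_tR,
            fun x w a v => V.comodR.sw_δ_lact (hL x w) a v, mul_assoc])
        (fun a x₁ x₂ x₃ => by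
          simp only [LinearMap.mulRight_apply, V.mod.act_mul, W.mod.act_mul, V.act_sR, W.act_tR,
            fun x w a v => V.comodR.sw_δ_ract (hL x w) a v, mul_assoc]
          refine sw_congr _ fun p α => ?_
          have := W.comodR.sw_δ_lact (hR p (x₁ * α)) a (W.act x₃ w)
          simpa only [mul_assoc] using this.symm)) X
    have e₂ : ∀ (x : H) (w : W.carrier),
        (sw (K.ΔR x) fun x₁ x₂ => sw (V.δR (V.act x₂ v)) fun p α =>
          sw (W.δR w) fun q β => φ (tm p q) (x₁ * (α * β))) =
        sw (V.δR v) fun p α => sw (K.ΔR x) fun x₁ x₂ =>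
          sw (W.δR w) fun q β => φ (tm (V.act x₁ p) q) (α * (x₂ * β)) := fun x w => by
      simpa [mul_assoc] using V.sw_yd (hL 1 w) v x
    have e₃ : ∀ (p : V.carrier) (α : H),
        (sw (K.ΔR X) fun x y => sw (K.ΔR x) fun x₁ x₂ => sw (W.δR (W.act y w)) fun q β =>
          φ (tm (V.act x₁ p) q) (α * (x₂ * β))) =
        sw (K.ΔR X) fun x y => sw (K.ΔR y) fun x₁ x₂ => sw (W.δR (W.act x₂ w)) fun q β =>
          φ (tm (V.act x p) q) (α * (x₁ * β)) := fun p α =>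
      K.sw_ΔR_coassoc (τ := fun x₁ x₂ x₃ => sw (W.δR (W.act x₃ w)) fun q β =>
          φ (tm (V.act x₁ p) q) (α * (x₂ * β))) (.mk
        (fun a x₁ x₂ x₃ => by
          simpa [V.mod.act_mul, V.act_sR, mul_assoc] using
            tensR_takeuchi hφ (V.act x₁ p) (α * x₂) a (W.act x₃ w))
        (fun a x₁ x₂ x₃ => by
          simpa [W.mod.act_mul, W.act_tR, mul_assoc] using
            (W.comodR.sw_δ_lact (hR (V.act x₁ p) (α * x₂)) a (W.act x₃ w)).symm)) X
    have e₄ : ∀ (p : V.carrier) (α y : H),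
        (sw (K.ΔR y) fun x₁ x₂ => sw (W.δR (W.act x₂ w)) fun q β =>
          φ (tm p q) (α * (x₁ * β))) =
        sw (W.δR w) fun q β => sw (K.ΔR y) fun y₁ y₂ => φ (tm p (W.act y₁ q)) (α * (β * y₂)) :=
      fun p α y => W.sw_yd (hR p α) w y
    have e₅ : ∀ (p : V.carrier) (q : W.carrier) (Z : H),
        (sw (K.ΔR X) fun x y => sw (K.ΔR x) fun x₁ x₂ =>
          φ (tm (V.act x₁ p) (W.act x₂ q)) (Z * y)) =
        sw (K.ΔR X) fun x y => sw (K.ΔR y) fun x₁ x₂ =>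
          φ (tm (V.act x p) (W.act x₁ q)) (Z * x₂) := fun p q Z =>
      K.sw_ΔR_coassoc (τ := fun x₁ x₂ x₃ => φ (tm (V.act x₁ p) (W.act x₂ q)) (Z * x₃)) (.mk
        (fun a x₁ x₂ x₃ => by
          simp [V.mod.act_mul, V.act_sR, W.mod.act_mul, W.act_tR, tm_balanced])
        (fun a x₁ x₂ x₃ => by
          simp [W.mod.act_mul, W.act_sR, ← tensBim_ract_tm, hb, mul_assoc])) X
    rw [← e₁]
    simp only [e₂]
    rw [sw_comm]
    refine sw_congr _ fun p α => ?_
    rw [e₃]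
    simp only [e₄]
    rw [sw_comm]
    refine sw_congr _ fun q β => ?_
    have e₆ : ∀ (x Z : H), (sw (K.ΔR x) fun x₁ x₂ => φ (tm (V.act x₁ p) (W.act x₂ q))) Z =
        sw (K.ΔR x) fun x₁ x₂ => φ (tm (V.act x₁ p) (W.act x₂ q)) Z := fun x Z =>
      map_sw (LinearMap.applyₗ Z) _ _
    simp only [e₆]
    rw [e₅]
    simp only [mul_assoc]

end FullYD

end YDTensorComodule

/-! ### The unit object and the tensor product as objects -/

section YDObjects

variable {B H : Type u} [Ring B] [Algebra ℂ B] [Ring H] [Algebra ℂ H]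
  (K : FullHopfAlgebroid B H) {P : Type*} [AddCommGroup P] [Module ℂ P]

open Bal

/-- The algebra `A` as a bimodule over itself. -/
def regularBim (A : Type u) [Ring A] [Algebra ℂ A] : BimoduleStr A A where
  lact := LinearMap.mul ℂ A
  ract := (LinearMap.mul ℂ A).flip
  lact_one v := one_mul v
  lact_mul a b v := mul_assoc a b v
  ract_one v := mul_one v
  ract_mul a b v := (mul_assoc v a b).symm
  lact_ract a b v := (mul_assoc a v b).symm

@[simp] theorem regularBim_lact {A : Type u} [Ring A] [Algebra ℂ A] (a b : A) :
    (regularBim A).lact a b = a * b := rfl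

@[simp] theorem regularBim_ract {A : Type u} [Ring A] [Algebra ℂ A] (a b : A) :
    (regularBim A).ract a b = b * a := rfl

namespace FullHopfAlgebroid

/-- The action of the algebra on the base: `a ◁ X = ε_R(s_R(a) X)`. -/
def unitMod : RightModuleStr H Bᵐᵒᵖ where
  act := LinearMap.mk₂ ℂ (fun X a => K.εR (K.sR a * X)) (by intros; simp [mul_add])
    (by intros; simp) (by intros; simp [add_mul]) (by intros; simp)
  act_one a := by simp [K.εR_sR]
  act_mul X Y a := by simp [K.εR_sR_mul, mul_assoc]

theorem unitMod_act (X : H) (a : Bᵐᵒᵖ) : K.unitMod.act X a = K.εR (K.sR a * X) := rfl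

/-- The coaction `a ↦ 1 ⊗ s_R(a)` of the right bialgebroid on the base. -/
def unitδR : Bᵐᵒᵖ →ₗ[ℂ] RTens K (regularBim Bᵐᵒᵖ) :=
  Bal.tmul _ _ 1 ∘ₗ K.t.toLinearMap

theorem unitδR_apply (a : Bᵐᵒᵖ) : K.unitδR a = Bal.tmul _ _ 1 (K.sR a) := rfl

theorem sw_unitδR {φ : Bᵐᵒᵖ → H → P} (hφ : IsBal (fun a => (regularBim Bᵐᵒᵖ).ract a) K.rt φ)
    (a : Bᵐᵒᵖ) : sw (K.unitδR a) φ = φ 1 (K.sR a) := sw_tmul hφ _ _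

/-- The coaction `a ↦ 1 ⊗ t_L(a)` of the left bialgebroid on the base. -/
def unitδL : Bᵐᵒᵖ →ₗ[ℂ] LTens K (regularBim Bᵐᵒᵖ) :=
  Bal.tmul _ _ 1 ∘ₗ K.t.toLinearMap

theorem unitδL_apply (a : Bᵐᵒᵖ) : K.unitδL a = Bal.tmul _ _ 1 (K.t a) := rfl

theorem sw_unitδL {φ : Bᵐᵒᵖ → H → P}
    (hφ : IsBal (fun b : B => (regularBim Bᵐᵒᵖ).lact (op b)) K.ls φ)
    (a : Bᵐᵒᵖ) : sw (K.unitδL a) φ = φ 1 (K.t a) := sw_tmul hφ _ _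

/-- The comodule of the right bialgebroid on the base. -/
def unitComodR : RightRComodule K (regularBim Bᵐᵒᵖ) :=
  .ofSw K.unitδR
    (fun a a' v => by
      rw [K.sw_unitδR (RightRComodule.isBal_sR_mul isBal_tmul _ _), unitδR_apply]
      simp [sR_mul, mul_assoc])
    (fun a v => by
      have h := fun X => Bal.tmul_balanced (fun a => (regularBim Bᵐᵒᵖ).ract a) K.rt a 1 X
      have h1 : IsBal (fun a => (regularBim Bᵐᵒᵖ).ract a) K.rt fun p q =>
          Bal.tmul (fun a => (regularBim Bᵐᵒᵖ).ract a) K.rt p (K.tR a * q) := by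
        simpa [K.sR_one] using RightRComodule.isBal_sR_mul (K := K) (bim := regularBim Bᵐᵒᵖ)
          isBal_tmul (K.tR a) 1
      rw [K.sw_unitδR h1, K.sw_unitδR (.mk fun b m n => by
        rw [(regularBim Bᵐᵒᵖ).lact_ract]
        exact Bal.tmul_balanced (fun a => (regularBim Bᵐᵒᵖ).ract a) K.rt _ _ _)]
      simpa [tR_sR_comm] using h (K.sR v))
    (fun v => by
      have b₁ := Bal₃.tmul_balanced₁ (fun a => (regularBim Bᵐᵒᵖ).ract a) K.rt K.rs K.rt
      have b₂ := Bal₃.tmul_balanced₂ (fun a => (regularBim Bᵐᵒᵖ).ract a) K.rt K.rs K.rt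
      have c₁ : ∀ y, IsBal (fun a => (regularBim Bᵐᵒᵖ).ract a) K.rt fun z x =>
        Bal₃.tmul (fun a => (regularBim Bᵐᵒᵖ).ract a) K.rt K.rs K.rt z x y :=
        fun y => .mk fun a z x => b₁ a z x y
      have c₂ : ∀ z, IsBal K.rs K.rt fun x y =>
        Bal₃.tmul (fun a => (regularBim Bᵐᵒᵖ).ract a) K.rt K.rs K.rt z x y :=
        fun z => .mk fun a x y => b₂ a z x y
      simp only [K.sw_unitδR (c₁ _)]
      rw [K.sw_unitδR, K.sw_unitδR, K.sw_ΔR_sR (c₂ 1), K.sR_one]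
      · exact .mk fun a z X => (sw_congr _ fun x y => b₁ a z x y).trans
          (K.sw_ΔR_mul_tR (c₂ z) a X).symm
      · exact .mk fun a z X => by
          have := b₂ a 1 (K.sR z) X
          simpa [sR_mul] using this)
    (fun v => by
      rw [K.sw_unitδR (.mk fun a z X => by simp [K.εR_mul_tR, mul_assoc])]
      simp [K.εR_sR])

/-- The comodule of the left bialgebroid on the base. -/
def unitComodL : RightLComodule K (regularBim Bᵐᵒᵖ) :=
  .ofSw K.unitδL
    (fun b b' v => by
      rw [K.sw_unitδL (RightLComodule.isBal_t_mul isBal_tmul _ _), unitδL_apply]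
      simp [mul_assoc])
    (fun b v => by
      have h := fun X => Bal.tmul_balanced (fun b : B => (regularBim Bᵐᵒᵖ).lact (op b)) K.ls b 1 X
      have h1 : IsBal (fun b : B => (regularBim Bᵐᵒᵖ).lact (op b)) K.ls fun p q =>
          Bal.tmul (fun b : B => (regularBim Bᵐᵒᵖ).lact (op b)) K.ls p (q * K.s b) := by
        simpa using RightLComodule.isBal_t_mul (bim := regularBim Bᵐᵒᵖ) isBal_tmul
          (K.s b) 1
      rw [K.sw_unitδL h1, K.sw_unitδL (.mk fun b m n => by
        rw [← (regularBim Bᵐᵒᵖ).lact_ract]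
        exact Bal.tmul_balanced (fun b : B => (regularBim Bᵐᵒᵖ).lact (op b)) K.ls _ _ _)]
      have hc : K.s b * K.t v = K.t v * K.s b := K.s_t_comm b (unop v)
      simpa [hc] using h (K.t v))
    (fun v => by
      have b₁ := Bal₃.tmul_balanced₁ (fun b : B => (regularBim Bᵐᵒᵖ).lact (op b)) K.ls K.lt K.ls
      have b₂ := Bal₃.tmul_balanced₂ (fun b : B => (regularBim Bᵐᵒᵖ).lact (op b)) K.ls K.lt K.ls
      have c₁ : ∀ y, IsBal (fun b : B => (regularBim Bᵐᵒᵖ).lact (op b)) K.ls fun z x =>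
        Bal₃.tmul (fun b : B => (regularBim Bᵐᵒᵖ).lact (op b)) K.ls K.lt K.ls z x y :=
        fun y => .mk fun a z x => b₁ a z x y
      have c₂ : ∀ z, IsBal K.lt K.ls fun x y =>
        Bal₃.tmul (fun b : B => (regularBim Bᵐᵒᵖ).lact (op b)) K.ls K.lt K.ls z x y :=
        fun z => .mk fun a x y => b₂ a z x y
      simp only [K.sw_unitδL (c₁ _)]
      obtain ⟨b, rfl⟩ : ∃ b, v = op b := ⟨unop v, rfl⟩
      rw [K.sw_unitδL, K.sw_unitδL, K.sw_Δ_t (c₂ 1), map_one K.t]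
      · exact .mk fun a z X => (sw_congr _ fun x y => b₁ a z x y).trans
          (K.sw_Δ_s_mul (c₂ z) a X).symm
      · exact .mk fun a z X => by
          have := b₂ a 1 (K.t z) X
          simpa using this)
    (fun v => by
      rw [K.sw_unitδL (.mk fun a z X => by simp [K.ε_s_mul, mul_assoc])]
      obtain ⟨b, rfl⟩ : ∃ b, v = op b := ⟨unop v, rfl⟩
      simp [K.ε_t])

/-- The unit object: the base algebra. -/
def unitYD : FullYD K :=
  .ofSw Bᵐᵒᵖ (regularBim Bᵐᵒᵖ) K.unitMod
    (fun a v => by simp [unitMod_act, εR_mul_tR, εR_sR])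
    (fun a v => by simp [unitMod_act, εR_mul_sR, εR_sR])
    K.unitComodR K.unitComodL
    (fun v => by
      have b₁ := Bal₃.tmul_balanced₁ (fun b : B => (regularBim Bᵐᵒᵖ).lact (op b)) K.ls K.rs K.rt
      have b₂ := Bal₃.tmul_balanced₂ (fun b : B => (regularBim Bᵐᵒᵖ).lact (op b)) K.ls K.rs K.rt
      have c₁ : ∀ y, IsBal (fun b : B => (regularBim Bᵐᵒᵖ).lact (op b)) K.ls fun z x =>
        Bal₃.tmul (fun b : B => (regularBim Bᵐᵒᵖ).lact (op b)) K.ls K.rs K.rt z x y :=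
        fun y => .mk fun a z x => b₁ a z x y
      have c₂ : ∀ z, IsBal K.rs K.rt fun x y =>
        Bal₃.tmul (fun b : B => (regularBim Bᵐᵒᵖ).lact (op b)) K.ls K.rs K.rt z x y :=
        fun z => .mk fun a x y => b₂ a z x y
      show (sw (K.unitδL v) _) = sw (K.unitδR v) fun p q => sw (K.unitδL p) _
      simp only [K.sw_unitδL (c₁ _)]
      rw [K.sw_unitδL, K.sw_unitδR]
      · exact (K.sw_ΔR_sR (c₂ 1) v).trans (by rw [map_one K.t])
      · exact .mk fun a z X => by
          have := b₂ a 1 (K.t z) X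
          simpa [sR] using this
      · exact .mk fun a z X => (sw_congr _ fun x y => b₁ a z x y).trans
          (K.sw_ΔR_s_mul (c₂ z) a X).symm)
    (fun v => by
      have b₁ := Bal₃.tmul_balanced₁ (fun a => (regularBim Bᵐᵒᵖ).ract a) K.rt K.lt K.ls
      have b₂ := Bal₃.tmul_balanced₂ (fun a => (regularBim Bᵐᵒᵖ).ract a) K.rt K.lt K.ls
      have c₁ : ∀ y, IsBal (fun a => (regularBim Bᵐᵒᵖ).ract a) K.rt fun z x =>
        Bal₃.tmul (fun a => (regularBim Bᵐᵒᵖ).ract a) K.rt K.lt K.ls z x y :=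
        fun y => .mk fun a z x => b₁ a z x y
      have c₂ : ∀ z, IsBal K.lt K.ls fun x y =>
        Bal₃.tmul (fun a => (regularBim Bᵐᵒᵖ).ract a) K.rt K.lt K.ls z x y :=
        fun z => .mk fun a x y => b₂ a z x y
      show (sw (K.unitδR v) _) = sw (K.unitδL v) fun p q => sw (K.unitδR p) _
      simp only [K.sw_unitδR (c₁ _)]
      rw [K.sw_unitδL, K.sw_unitδR]
      · exact (K.sw_Δ_t (c₂ 1) (unop v)).trans (by rw [K.sR_one]; rfl)
      · exact .mk fun a z X => (sw_congr _ fun x y => b₁ a z x y).trans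
          (K.sw_Δ_mul_tR (c₂ z) a X).symm
      · exact .mk fun a z X => by
          have := b₂ a 1 (K.t z) X
          simpa [sR] using this)
    (fun v X => by
      have b : ∀ a z X, Bal.tmul (fun a => (regularBim Bᵐᵒᵖ).ract a) K.rt (z * a) X =
        Bal.tmul (fun a => (regularBim Bᵐᵒᵖ).ract a) K.rt z (X * K.tR a) :=
        Bal.tmul_balanced (fun a => (regularBim Bᵐᵒᵖ).ract a) K.rt
      have c : IsBal (fun a => (regularBim Bᵐᵒᵖ).ract a) K.rt fun z X =>
        Bal.tmul (fun a => (regularBim Bᵐᵒᵖ).ract a) K.rt z X := isBal_tmul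
      have c' : ∀ x, IsBal (fun a => (regularBim Bᵐᵒᵖ).ract a) K.rt fun z X =>
        Bal.tmul (fun a => (regularBim Bᵐᵒᵖ).ract a) K.rt z (x * X) := fun x => by
        simpa [K.sR_one] using RightRComodule.isBal_sR_mul (bim := regularBim Bᵐᵒᵖ) c x 1
      have hR : ∀ a v, K.unitMod.act (K.sR a) v = (regularBim Bᵐᵒᵖ).ract a v := fun a v => by
        simp [unitMod_act, εR_mul_sR, εR_sR]
      show (sw (K.ΔR X) fun x y => sw (K.unitδR _) _) = sw (K.unitδR v) _
      rw [K.sw_unitδR (isBal_sw_act_mul (mod := K.unitMod) hR c X)]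
      simp only [K.sw_unitδR (c' _), unitMod_act, sR_one, one_mul]
      -- Both sides equal `1 ⊗ s_R(v) X`: one by the left counit law after `ε_R(x)` crosses the
      -- tensor sign, the other by the right counit law at `s_R(v) X`.
      have e₁ : ∀ x y, Bal.tmul (fun a => (regularBim Bᵐᵒᵖ).ract a) K.rt (K.εR x) (K.sR v * y) =
          Bal.tmul (fun a => (regularBim Bᵐᵒᵖ).ract a) K.rt 1 (K.sR v * (y * K.tR (K.εR x))) :=
        fun x y => by rw [← mul_assoc, ← b, one_mul]
      have e₂ := K.sw_ΔR_sR_mul (φ := fun x y => x * K.sR (K.εR y))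
        (.mk fun a x y => by simp [εR_mul_tR, sR_mul, mul_assoc]) v X
      rw [sw_ΔR_counit_right] at e₂
      simp only [e₁]
      rw [← map_sw, ← e₂, ← map_sw]
      conv_lhs => rw [← K.sw_ΔR_counit_left X]
      rw [← LinearMap.mulLeft_apply ℂ, map_sw]
      rfl)

end FullHopfAlgebroid

namespace FullYD

variable {K} (V W : FullYD K)

/-- The tensor product of Yetter–Drinfeld modules. -/
def tens : FullYD K :=
  .ofSw (Tens V W) (tensBim V W) (tensMod V W) (tensAct_tR V W) (tensAct_sR V W)
    (tensComodR V W) (tensComodL V W) tens_mixed_LR tens_mixed_RL tens_yd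

/-- The underlying space of the tensor product. -/
def tensEquiv : Tens V W ≃ₗ[ℂ] (tens V W).carrier := LinearEquiv.refl ℂ _

/-- The element `v ⊗ w` of the tensor product. -/
def tmk : V.carrier →ₗ[ℂ] W.carrier →ₗ[ℂ] (tens V W).carrier := Bal.tmul V.ract W.lact

variable {V W}

theorem tmk_balanced (a : Bᵐᵒᵖ) (v : V.carrier) (w : W.carrier) :
    tmk V W (V.bim.ract a v) w = tmk V W v (W.bim.lact a w) := tm_balanced V W a v w

theorem lact_tmk (a : Bᵐᵒᵖ) (v : V.carrier) (w : W.carrier) :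
    (tens V W).bim.lact a (tmk V W v w) = tmk V W (V.bim.lact a v) w := tensBim_lact_tm V W a v w

theorem ract_tmk (a : Bᵐᵒᵖ) (v : V.carrier) (w : W.carrier) :
    (tens V W).bim.ract a (tmk V W v w) = tmk V W v (W.bim.ract a w) := tensBim_ract_tm V W a v w

theorem act_tmk (X : H) (v : V.carrier) (w : W.carrier) :
    (tens V W).mod.act X (tmk V W v w) =
      sw (K.ΔR X) fun x y => tmk V W (V.mod.act x v) (W.mod.act y w) := tensAct_tm V W X v w

theorem isBal_tmk_act (v : V.carrier) (w : W.carrier) :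
    IsBal K.rs K.rt fun x y => tmk V W (V.mod.act x v) (W.mod.act y w) := isBal_tm_act V W v w

theorem δR_tmk (v : V.carrier) (w : W.carrier) :
    (tens V W).comodR.δ (tmk V W v w) = sw (V.comodR.δ v) fun p x => sw (W.comodR.δ w) fun q y =>
      Bal.tmul _ _ (tmk V W p q) (x * y) := tensδR_tm v w

theorem δL_tmk (v : V.carrier) (w : W.carrier) :
    (tens V W).comodL.δ (tmk V W v w) = sw (W.comodL.δ w) fun q y => sw (V.comodL.δ v) fun p x =>
      Bal.tmul _ _ (tmk V W p q) (x * y) := tensδL_tm v w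

theorem isBal_tmkR_right {φ : (tens V W).carrier → H → P}
    (hφ : IsBal (fun a => (tens V W).bim.ract a) K.rt φ) (p : V.carrier) (X : H) :
    IsBal (fun a => W.bim.ract a) K.rt fun q y => φ (tmk V W p q) (X * y) :=
  isBal_tensR_right (V := V) (W := W) (φ := φ) hφ p X

theorem isBal_tmkR_left {φ : (tens V W).carrier → H → P}
    (hφ : IsBal (fun a => (tens V W).bim.ract a) K.rt φ) (X : H) (w : W.carrier) :
    IsBal (fun a => V.bim.ract a) K.rt fun p x => sw (W.comodR.δ w) fun q y =>
      φ (tmk V W p q) (X * (x * y)) :=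
  isBal_tensR_left (V := V) (W := W) (φ := φ) hφ X w

theorem sw_δR_tmk {φ : (tens V W).carrier → H → P}
    (hφ : IsBal (fun a => (tens V W).bim.ract a) K.rt φ) (v : V.carrier) (w : W.carrier) :
    sw ((tens V W).comodR.δ (tmk V W v w)) φ = sw (V.comodR.δ v) fun p x =>
      sw (W.comodR.δ w) fun q y => φ (tmk V W p q) (x * y) :=
  sw_tensδR_tm (V := V) (W := W) (φ := φ) hφ v w

theorem isBal_tmkL_left {φ : (tens V W).carrier → H → P}
    (hφ : IsBal (fun b : B => (tens V W).bim.lact (op b)) K.ls φ) (q : W.carrier) (X : H) :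
    IsBal (fun b : B => V.bim.lact (op b)) K.ls fun p x => φ (tmk V W p q) (x * X) :=
  isBal_tensL_left (V := V) (W := W) (φ := φ) hφ q X

theorem isBal_tmkL_right {φ : (tens V W).carrier → H → P}
    (hφ : IsBal (fun b : B => (tens V W).bim.lact (op b)) K.ls φ) (X : H) (v : V.carrier) :
    IsBal (fun b : B => W.bim.lact (op b)) K.ls fun q y => sw (V.comodL.δ v) fun p x =>
      φ (tmk V W p q) (x * y * X) :=
  isBal_tensL_right (V := V) (W := W) (φ := φ) hφ X v

theorem sw_δL_tmk {φ : (tens V W).carrier → H → P}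
    (hφ : IsBal (fun b : B => (tens V W).bim.lact (op b)) K.ls φ) (v : V.carrier) (w : W.carrier) :
    sw ((tens V W).comodL.δ (tmk V W v w)) φ = sw (W.comodL.δ w) fun q y =>
      sw (V.comodL.δ v) fun p x => φ (tmk V W p q) (x * y) :=
  sw_tensδL_tm (V := V) (W := W) (φ := φ) hφ v w

@[elab_as_elim] theorem tens_induction {motive : (tens V W).carrier → Prop}
    (z : (tens V W).carrier) (tmk : ∀ v w, motive (tmk V W v w))
    (add : ∀ x y, motive x → motive y → motive (x + y)) : motive z :=
  Bal.induction (f := V.ract) (g := W.lact) (motive := motive) z tmk add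

/-- The linear map on the tensor product given by a balanced bilinear map. -/
def tensLift (φ : V.carrier → W.carrier → P) : (tens V W).carrier →ₗ[ℂ] P :=
  swLin V.ract W.lact φ

theorem tensLift_tmk {φ : V.carrier → W.carrier → P}
    (hφ : IsBal (fun a => V.bim.ract a) (fun a => W.bim.lact a) φ) (v : V.carrier) (w : W.carrier) :
    tensLift φ (tmk V W v w) = φ v w := sw_tmul hφ v w

@[simp] theorem tensLift_fun_add (φ ψ : V.carrier → W.carrier → P) (z : (tens V W).carrier) :
    tensLift (fun v w => φ v w + ψ v w) z = tensLift φ z + tensLift ψ z := sw_fun_add z φ ψ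

@[simp] theorem tensLift_fun_smul (c : ℂ) (φ : V.carrier → W.carrier → P)
    (z : (tens V W).carrier) :
    tensLift (fun v w => c • φ v w) z = c • tensLift φ z := sw_fun_smul c z φ

theorem tens_linearMap_ext {L L' : (tens V W).carrier →ₗ[ℂ] P}
    (h : ∀ v w, L (tmk V W v w) = L' (tmk V W v w)) : L = L' :=
  Bal.hom_ext (f := V.ract) (g := W.lact) h

end FullYD

end YDObjects

/-! ### The monoidal category of Yetter–Drinfeld modules -/

section YDMonoidal

variable {B H : Type u} [Ring B] [Algebra ℂ B] [Ring H] [Algebra ℂ H]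
  {K : FullHopfAlgebroid B H} {P : Type*} [AddCommGroup P] [Module ℂ P]

open Bal

namespace FullYD

variable {U V W : FullYD K}

theorem hom_ext_lin {f g : V ⟶ W} (h : lin f = lin g) : f = g := Hom.ext h

theorem lin_lact (f : V ⟶ W) (a : Bᵐᵒᵖ) (v : V.carrier) :
    lin f (V.bim.lact a v) = W.bim.lact a (lin f v) := f.map_lact a v

theorem lin_ract (f : V ⟶ W) (a : Bᵐᵒᵖ) (v : V.carrier) :
    lin f (V.bim.ract a v) = W.bim.ract a (lin f v) := f.map_ract a v

theorem lin_act (f : V ⟶ W) (X : H) (v : V.carrier) :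
    lin f (V.mod.act X v) = W.mod.act X (lin f v) := f.map_act X v

theorem isBal_linR (f : V ⟶ W) : IsBal (fun a => V.bim.ract a) K.rt fun p q =>
    Bal.tmul (fun a => W.bim.ract a) K.rt (lin f p) q :=
  .mk fun a p q => by
    rw [lin_ract]
    exact Bal.tmul_balanced (fun a => W.bim.ract a) K.rt a _ _

theorem isBal_linL (f : V ⟶ W) : IsBal (fun b : B => V.bim.lact (op b)) K.ls fun p q =>
    Bal.tmul (fun b : B => W.bim.lact (op b)) K.ls (lin f p) q :=
  .mk fun a p q => by
    rw [lin_lact]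
    exact Bal.tmul_balanced (fun b : B => W.bim.lact (op b)) K.ls a _ _

theorem δR_lin (f : V ⟶ W) (v : V.carrier) :
    W.comodR.δ (lin f v) = sw (V.comodR.δ v) fun p q => Bal.tmul _ _ (lin f p) q := by
  obtain ⟨n, p, q, h⟩ := exists_isSum (V.comodR.δ v)
  rw [h.sw_eq (isBal_linR f)]
  exact f.map_δR v n p q h

theorem δL_lin (f : V ⟶ W) (v : V.carrier) :
    W.comodL.δ (lin f v) = sw (V.comodL.δ v) fun p q => Bal.tmul _ _ (lin f p) q := by
  obtain ⟨n, p, q, h⟩ := exists_isSum (V.comodL.δ v)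
  rw [h.sw_eq (isBal_linL f)]
  exact f.map_δL v n p q h

theorem sw_δR_lin (f : V ⟶ W) {φ : W.carrier → H → P}
    (hφ : IsBal (fun a => W.bim.ract a) K.rt φ) (v : V.carrier) :
    sw (W.comodR.δ (lin f v)) φ = sw (V.comodR.δ v) fun p q => φ (lin f p) q := by
  rw [δR_lin, sw_sw]
  exact sw_congr _ fun p q => sw_tmul hφ _ _

/-- A bijective morphism is an isomorphism. -/
def isoOfInverse (f : V ⟶ W) (g : W.carrier →ₗ[ℂ] V.carrier)
    (gf : ∀ v, g (lin f v) = v) (fg : ∀ w, lin f (g w) = w) : V ≅ W where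
  hom := f
  inv := Hom.ofR g
    (fun X w => by
      conv_lhs => rw [← fg w, ← lin_act, gf])
    (fun w => by
      conv_rhs => rw [← fg w]
      rw [sw_δR_lin f (.mk fun a p q => by
        have : g (W.bim.ract a p) = V.bim.ract a (g p) := by
          conv_lhs => rw [← fg p, ← lin_ract, gf]
        rw [this]
        exact Bal.tmul_balanced (fun a => V.bim.ract a) K.rt a _ _)]
      simp only [gf]
      exact (sw_self _).symm)
  hom_inv_id := hom_ext_lin (LinearMap.ext gf)
  inv_hom_id := hom_ext_lin (LinearMap.ext fg)

theorem lin_ofR (f : V.carrier →ₗ[ℂ] W.carrier) (h h') :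
    lin (Hom.ofR f h h') = f := rfl

variable {V' W' : FullYD K}

theorem isBal_tmk_map (f : V ⟶ V') (g : W ⟶ W') :
    IsBal (fun a => V.bim.ract a) (fun a => W.bim.lact a) fun v w =>
      tmk V' W' (lin f v) (lin g w) :=
  .mk fun a v w => by rw [lin_ract, lin_lact, tmk_balanced]

/-- The tensor product of morphisms. -/
def tensMap (f : V ⟶ V') (g : W ⟶ W') : tens V W ⟶ tens V' W' :=
  Hom.ofR (tensLift fun v w => tmk V' W' (lin f v) (lin g w))
    (fun X z => by
      induction z using tens_induction with
      | add x y hx hy => simp only [map_add, hx, hy]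
      | tmk v w =>
        simp only [act_tmk, map_sw, tensLift_tmk (isBal_tmk_map f g), lin_act])
    (fun z => by
      induction z using tens_induction with
      | add x y hx hy => simp only [map_add, sw_add, hx, hy]
      | tmk v w =>
        have h : IsBal (fun a => (tens V W).bim.ract a) K.rt fun p q =>
            Bal.tmul (fun a => (tens V' W').bim.ract a) K.rt
              (tensLift (fun v w => tmk V' W' (lin f v) (lin g w)) p) q := .mk fun a z X => by
          have : tensLift (fun v w => tmk V' W' (lin f v) (lin g w)) ((tens V W).bim.ract a z) =
              (tens V' W').bim.ract a
                (tensLift (fun v w => tmk V' W' (lin f v) (lin g w)) z) := by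
            induction z using tens_induction with
            | add x y hx hy => simp only [map_add, hx, hy]
            | tmk v w => simp only [ract_tmk, tensLift_tmk (isBal_tmk_map f g), lin_ract]
          rw [this]
          exact Bal.tmul_balanced (fun a => (tens V' W').bim.ract a) K.rt a _ _
        rw [tensLift_tmk (isBal_tmk_map f g), δR_tmk, sw_δR_tmk h]
        simp only [tensLift_tmk (isBal_tmk_map f g)]
        have h1 := isBal_tmkR_left (V := V') (W := W') (φ := fun z X =>
          Bal.tmul (fun a => (tens V' W').bim.ract a) K.rt z X) isBal_tmul 1 (lin g w)
        simp only [one_mul] at h1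
        rw [sw_δR_lin f h1]
        refine sw_congr _ fun p x => ?_
        rw [sw_δR_lin g (isBal_tmkR_right (V := V') (W := W') (φ := fun z X =>
          Bal.tmul (fun a => (tens V' W').bim.ract a) K.rt z X) isBal_tmul (lin f p) x)])

theorem tensMap_tmk (f : V ⟶ V') (g : W ⟶ W') (v : V.carrier) (w : W.carrier) :
    lin (tensMap f g) (tmk V W v w) = tmk V' W' (lin f v) (lin g w) :=
  tensLift_tmk (isBal_tmk_map f g) v w

variable (U V W) in
/-- The associativity constraint as a linear map. -/
def assocLin : (tens (tens U V) W).carrier →ₗ[ℂ] (tens U (tens V W)).carrier :=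
  tensLift fun z w => tensLift (fun u v => tmk U (tens V W) u (tmk V W v w)) z

theorem isBal_assoc (w : W.carrier) :
    IsBal (fun a => U.bim.ract a) (fun a => V.bim.lact a) fun u v =>
      tmk U (tens V W) u (tmk V W v w) :=
  .mk fun a u v => by rw [tmk_balanced, lact_tmk]

theorem assocLin_tmk (u : U.carrier) (v : V.carrier) (w : W.carrier) :
    assocLin U V W (tmk (tens U V) W (tmk U V u v) w) = tmk U (tens V W) u (tmk V W v w) := by
  rw [assocLin, tensLift_tmk, tensLift_tmk (isBal_assoc w)]
  refine .mk fun a z w => ?_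
  induction z using tens_induction with
  | add x y hx hy => simp only [map_add, hx, hy]
  | tmk u v => rw [ract_tmk, tensLift_tmk (isBal_assoc _), tensLift_tmk (isBal_assoc _),
      tmk_balanced]

variable (U V W) in
/-- The inverse associativity constraint as a linear map. -/
def assocInvLin : (tens U (tens V W)).carrier →ₗ[ℂ] (tens (tens U V) W).carrier :=
  tensLift fun u z => tensLift (fun v w => tmk (tens U V) W (tmk U V u v) w) z

theorem isBal_assocInv (u : U.carrier) :
    IsBal (fun a => V.bim.ract a) (fun a => W.bim.lact a) fun v w =>
      tmk (tens U V) W (tmk U V u v) w :=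
  .mk fun a v w => by rw [← tmk_balanced, ract_tmk]

theorem assocInvLin_tmk (u : U.carrier) (v : V.carrier) (w : W.carrier) :
    assocInvLin U V W (tmk U (tens V W) u (tmk V W v w)) = tmk (tens U V) W (tmk U V u v) w := by
  rw [assocInvLin, tensLift_tmk, tensLift_tmk (isBal_assocInv u)]
  refine .mk fun a u z => ?_
  induction z using tens_induction with
  | add x y hx hy => simp only [map_add, hx, hy]
  | tmk v w => rw [lact_tmk, tensLift_tmk (isBal_assocInv _), tensLift_tmk (isBal_assocInv _),
      tmk_balanced]

@[elab_as_elim] theorem tens_induction₃ {motive : (tens (tens U V) W).carrier → Prop}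
    (z : (tens (tens U V) W).carrier)
    (tmk : ∀ u v w, motive (tmk (tens U V) W (tmk U V u v) w))
    (add : ∀ x y, motive x → motive y → motive (x + y)) : motive z := by
  induction z using tens_induction with
  | add x y hx hy => exact add x y hx hy
  | tmk x w =>
    induction x using tens_induction with
    | tmk u v => exact tmk u v w
    | add x y hx hy => rw [map_add, LinearMap.add_apply]; exact add _ _ hx hy

@[elab_as_elim] theorem tens_induction₃' {motive : (tens U (tens V W)).carrier → Prop}
    (z : (tens U (tens V W)).carrier)
    (tmk : ∀ u v w, motive (tmk U (tens V W) u (tmk V W v w)))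
    (add : ∀ x y, motive x → motive y → motive (x + y)) : motive z := by
  induction z using tens_induction with
  | add x y hx hy => exact add x y hx hy
  | tmk u x =>
    induction x using tens_induction with
    | tmk v w => exact tmk u v w
    | add x y hx hy => rw [map_add]; exact add _ _ hx hy

theorem assocLin_ract (a : Bᵐᵒᵖ) (z : (tens (tens U V) W).carrier) :
    assocLin U V W ((tens (tens U V) W).bim.ract a z) =
      (tens U (tens V W)).bim.ract a (assocLin U V W z) := by
  induction z using tens_induction₃ with
  | add x y hx hy => simp only [map_add, hx, hy]
  | tmk u v w => simp only [ract_tmk, assocLin_tmk]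

/-- The two triple actions differ by coassociativity of `Δ_R`. -/
theorem assocLin_act (X : H) (z : (tens (tens U V) W).carrier) :
    assocLin U V W ((tens (tens U V) W).mod.act X z) =
      (tens U (tens V W)).mod.act X (assocLin U V W z) := by
  induction z using tens_induction₃ with
  | add x y hx hy => simp only [map_add, hx, hy]
  | tmk u v w =>
    have h : ∀ (x : H) (w' : W.carrier), (sw (K.ΔR x) fun x' y' =>
        tmk (tens U V) W (tmk U V (U.mod.act x' u) (V.mod.act y' v))) w' =
        sw (K.ΔR x) fun x' y' =>
          tmk (tens U V) W (tmk U V (U.mod.act x' u) (V.mod.act y' v)) w' :=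
      fun x w' => map_sw (LinearMap.applyₗ w') _ _
    simp only [act_tmk, assocLin_tmk, map_sw, h]
    exact K.sw_ΔR_coassoc (τ := fun x y z => tmk U (tens V W) (U.mod.act x u)
      (tmk V W (V.mod.act y v) (W.mod.act z w))) (.mk
        (fun a x y z => by
          simp only [LinearMap.mulRight_apply, U.mod.act_mul, V.mod.act_mul, U.act_sR, V.act_tR,
            tmk_balanced, lact_tmk])
        (fun a x y z => by
          simp only [LinearMap.mulRight_apply, W.mod.act_mul, V.mod.act_mul, V.act_sR, W.act_tR,
            tmk_balanced])) X

/-- The two triple coactions differ only by the bracketing of a product in `H`. -/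
theorem δR_assocLin (z : (tens (tens U V) W).carrier) :
    (tens U (tens V W)).comodR.δ (assocLin U V W z) =
      sw ((tens (tens U V) W).comodR.δ z) fun p q => Bal.tmul _ _ (assocLin U V W p) q := by
  induction z using tens_induction₃ with
  | add x y hx hy => simp only [map_add, sw_add, hx, hy]
  | tmk u v w =>
    have h : IsBal (fun a => (tens (tens U V) W).bim.ract a) K.rt fun p q =>
        Bal.tmul (fun a => (tens U (tens V W)).bim.ract a) K.rt (assocLin U V W p) q :=
      .mk fun a z X => by
        rw [assocLin_ract]
        exact Bal.tmul_balanced (fun a => (tens U (tens V W)).bim.ract a) K.rt a _ _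
    have h1 := isBal_tmkR_left h 1 w
    simp only [one_mul] at h1
    rw [assocLin_tmk, δR_tmk, sw_δR_tmk h, sw_δR_tmk h1]
    refine sw_congr _ fun p x => ?_
    rw [sw_δR_tmk (isBal_tmkR_right (V := U) (W := tens V W) (φ := fun z X =>
          Bal.tmul (fun a => (tens U (tens V W)).bim.ract a) K.rt z X) isBal_tmul p x)]
    simp only [assocLin_tmk, mul_assoc]

variable (U V W) in
/-- The associativity constraint. -/
def assocIso : tens (tens U V) W ≅ tens U (tens V W) :=
  isoOfInverse (Hom.ofR (assocLin U V W) assocLin_act δR_assocLin) (assocInvLin U V W)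
    (fun z => by
      rw [lin_ofR]
      induction z using tens_induction₃ with
      | add x y hx hy => simp only [map_add, hx, hy]
      | tmk u v w => rw [assocLin_tmk, assocInvLin_tmk])
    (fun z => by
      rw [lin_ofR]
      induction z using tens_induction₃' with
      | add x y hx hy => simp only [map_add, hx, hy]
      | tmk u v w => rw [assocInvLin_tmk, assocLin_tmk])

theorem assocIso_hom_tmk (u : U.carrier) (v : V.carrier) (w : W.carrier) :
    lin (assocIso U V W).hom (tmk (tens U V) W (tmk U V u v) w) =
      tmk U (tens V W) u (tmk V W v w) := assocLin_tmk u v w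

theorem assocIso_inv_tmk (u : U.carrier) (v : V.carrier) (w : W.carrier) :
    lin (assocIso U V W).inv (tmk U (tens V W) u (tmk V W v w)) =
      tmk (tens U V) W (tmk U V u v) w := assocInvLin_tmk u v w

/-! The unit constraints. -/

variable (K) in
/-- The identification of the base algebra with the unit object. -/
def unitEquiv : Bᵐᵒᵖ ≃ₗ[ℂ] K.unitYD.carrier := LinearEquiv.refl ℂ _

theorem lact_unitEquiv (a b : Bᵐᵒᵖ) :
    K.unitYD.bim.lact a (unitEquiv K b) = unitEquiv K (a * b) := rfl

theorem ract_unitEquiv (a b : Bᵐᵒᵖ) :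
    K.unitYD.bim.ract a (unitEquiv K b) = unitEquiv K (b * a) := rfl

theorem act_unitEquiv (X : H) (a : Bᵐᵒᵖ) :
    K.unitYD.mod.act X (unitEquiv K a) = unitEquiv K (K.εR (K.sR a * X)) := rfl

theorem δR_unitEquiv (a : Bᵐᵒᵖ) :
    K.unitYD.comodR.δ (unitEquiv K a) = Bal.tmul _ _ (unitEquiv K 1) (K.sR a) := rfl

theorem δL_unitEquiv (a : Bᵐᵒᵖ) :
    K.unitYD.comodL.δ (unitEquiv K a) = Bal.tmul _ _ (unitEquiv K 1) (K.t a) := rfl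

theorem sw_δR_unitEquiv {φ : K.unitYD.carrier → H → P}
    (hφ : IsBal (fun a => K.unitYD.bim.ract a) K.rt φ) (a : Bᵐᵒᵖ) :
    sw (K.unitYD.comodR.δ (unitEquiv K a)) φ = φ (unitEquiv K 1) (K.sR a) := by
  rw [δR_unitEquiv, sw_tmul hφ]

@[elab_as_elim] theorem unit_induction {motive : K.unitYD.carrier → Prop} (z : K.unitYD.carrier)
    (h : ∀ a, motive (unitEquiv K a)) : motive z := h z

variable (V) in
/-- The left unit constraint as a linear map. -/
def leftUnitLin : (tens K.unitYD V).carrier →ₗ[ℂ] V.carrier :=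
  tensLift fun a v => V.bim.lact ((unitEquiv K).symm a) v

theorem leftUnitLin_tmk (a : Bᵐᵒᵖ) (v : V.carrier) :
    leftUnitLin V (tmk K.unitYD V (unitEquiv K a) v) = V.bim.lact a v := by
  rw [leftUnitLin, tensLift_tmk, LinearEquiv.symm_apply_apply]
  refine .mk fun a z v => ?_
  induction z using unit_induction with | _ b
  rw [ract_unitEquiv, LinearEquiv.symm_apply_apply, LinearEquiv.symm_apply_apply, V.bim.lact_mul]

-- Base elements can be moved across the tensor sign, so tensors with the unit `1` suffice. On these
-- the coaction of the unit object is trivial, which shortens the checks below.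
@[elab_as_elim] theorem unit_tens_induction {motive : (tens K.unitYD V).carrier → Prop}
    (z : (tens K.unitYD V).carrier) (tmk : ∀ v, motive (tmk K.unitYD V (unitEquiv K 1) v))
    (add : ∀ x y, motive x → motive y → motive (x + y)) : motive z := by
  induction z using tens_induction with
  | add x y hx hy => exact add x y hx hy
  | tmk z v =>
    induction z using unit_induction with | _ b
    rw [← one_mul b, ← ract_unitEquiv, tmk_balanced]
    exact tmk _

@[elab_as_elim] theorem tens_unit_induction {motive : (tens V K.unitYD).carrier → Prop}
    (z : (tens V K.unitYD).carrier) (tmk : ∀ v, motive (tmk V K.unitYD v (unitEquiv K 1)))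
    (add : ∀ x y, motive x → motive y → motive (x + y)) : motive z := by
  induction z using tens_induction with
  | add x y hx hy => exact add x y hx hy
  | tmk v z =>
    induction z using unit_induction with | _ b
    rw [← mul_one b, ← lact_unitEquiv, ← tmk_balanced]
    exact tmk _

theorem leftUnitLin_tmk_one (v : V.carrier) :
    leftUnitLin V (tmk K.unitYD V (unitEquiv K 1) v) = v := by
  rw [leftUnitLin_tmk, V.bim.lact_one]

/-- The base element `ε_R(X_[1])` acts as `t_R`, which leaves `v ◁ X_[2] t_R(ε_R(X_[1]))`, and the
left counit law applies. -/
theorem leftUnitLin_act (X : H) (z : (tens K.unitYD V).carrier) :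
    leftUnitLin V ((tens K.unitYD V).mod.act X z) = V.mod.act X (leftUnitLin V z) := by
  induction z using unit_tens_induction with
  | add x y hx hy => simp only [map_add, hx, hy]
  | tmk v =>
    simp only [act_tmk, map_sw, act_unitEquiv, leftUnitLin_tmk, K.sR_one, one_mul,
      V.bim.lact_one, ← V.act_tR, ← V.mod.act_mul]
    conv_rhs => rw [← K.sw_ΔR_counit_left X]
    exact (map_sw (V.mod.act.flip v) _ _).symm

/-- The right base action is the action of `s_R(a)`, so a module map respects it and `f ⊗ id` is
defined. -/
theorem isBal_of_act (f : V.carrier →ₗ[ℂ] W.carrier)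
    (hf : ∀ X v, f (V.mod.act X v) = W.mod.act X (f v)) :
    IsBal (fun a => V.bim.ract a) K.rt fun p q =>
      Bal.tmul (fun a => W.bim.ract a) K.rt (f p) q :=
  .mk fun a p q => by
    rw [← V.act_sR, hf, W.act_sR]
    exact Bal.tmul_balanced (fun a => W.bim.ract a) K.rt a _ _

theorem δR_leftUnitLin (z : (tens K.unitYD V).carrier) :
    V.comodR.δ (leftUnitLin V z) =
      sw ((tens K.unitYD V).comodR.δ z) fun p q => Bal.tmul _ _ (leftUnitLin V p) q := by
  induction z using unit_tens_induction with
  | add x y hx hy => simp only [map_add, sw_add, hx, hy]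
  | tmk v =>
    have h := isBal_of_act (leftUnitLin V) leftUnitLin_act
    have h1 := isBal_tmkR_left h 1 v
    simp only [one_mul] at h1
    rw [sw_δR_tmk h, sw_δR_unitEquiv h1]
    simp only [leftUnitLin_tmk_one, K.sR_one, one_mul, sw_self]

variable (V) in
/-- The left unit constraint. -/
def leftUnitIso : tens K.unitYD V ≅ V :=
  isoOfInverse (Hom.ofR (leftUnitLin V) leftUnitLin_act δR_leftUnitLin)
    (tmk K.unitYD V (unitEquiv K 1))
    (fun z => by
      rw [lin_ofR]
      induction z using unit_tens_induction with
      | add x y hx hy => simp only [map_add, hx, hy]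
      | tmk v => rw [leftUnitLin_tmk_one])
    (fun v => leftUnitLin_tmk_one v)

theorem leftUnitIso_hom_tmk (a : Bᵐᵒᵖ) (v : V.carrier) :
    lin (leftUnitIso V).hom (tmk K.unitYD V (unitEquiv K a) v) = V.bim.lact a v :=
  leftUnitLin_tmk a v

variable (V) in
/-- The right unit constraint as a linear map. -/
def rightUnitLin : (tens V K.unitYD).carrier →ₗ[ℂ] V.carrier :=
  tensLift fun v a => V.bim.ract ((unitEquiv K).symm a) v

theorem rightUnitLin_tmk (a : Bᵐᵒᵖ) (v : V.carrier) :
    rightUnitLin V (tmk V K.unitYD v (unitEquiv K a)) = V.bim.ract a v := by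
  rw [rightUnitLin, tensLift_tmk, LinearEquiv.symm_apply_apply]
  refine .mk fun a v z => ?_
  induction z using unit_induction with | _ b
  rw [lact_unitEquiv, LinearEquiv.symm_apply_apply, LinearEquiv.symm_apply_apply, V.bim.ract_mul]

theorem rightUnitLin_tmk_one (v : V.carrier) :
    rightUnitLin V (tmk V K.unitYD v (unitEquiv K 1)) = v := by
  rw [rightUnitLin_tmk, V.bim.ract_one]

theorem rightUnitLin_act (X : H) (z : (tens V K.unitYD).carrier) :
    rightUnitLin V ((tens V K.unitYD).mod.act X z) = V.mod.act X (rightUnitLin V z) := by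
  induction z using tens_unit_induction with
  | add x y hx hy => simp only [map_add, hx, hy]
  | tmk v =>
    simp only [act_tmk, map_sw, act_unitEquiv, rightUnitLin_tmk, K.sR_one, one_mul,
      V.bim.ract_one, ← V.act_sR, ← V.mod.act_mul]
    conv_rhs => rw [← K.sw_ΔR_counit_right X]
    exact (map_sw (V.mod.act.flip v) _ _).symm

theorem δR_rightUnitLin (z : (tens V K.unitYD).carrier) :
    V.comodR.δ (rightUnitLin V z) =
      sw ((tens V K.unitYD).comodR.δ z) fun p q => Bal.tmul _ _ (rightUnitLin V p) q := by
  induction z using tens_unit_induction with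
  | add x y hx hy => simp only [map_add, sw_add, hx, hy]
  | tmk v =>
    have h := isBal_of_act (rightUnitLin V) rightUnitLin_act
    rw [sw_δR_tmk h]
    simp only [sw_δR_unitEquiv (isBal_tmkR_right h _ _)]
    simp only [rightUnitLin_tmk_one, K.sR_one, mul_one, sw_self]

variable (V) in
/-- The right unit constraint. -/
def rightUnitIso : tens V K.unitYD ≅ V :=
  isoOfInverse (Hom.ofR (rightUnitLin V) rightUnitLin_act δR_rightUnitLin)
    ((tmk V K.unitYD).flip (unitEquiv K 1))
    (fun z => by
      rw [lin_ofR]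
      induction z using tens_unit_induction with
      | add x y hx hy => simp only [map_add, hx, hy]
      | tmk v => rw [rightUnitLin_tmk_one, LinearMap.flip_apply])
    (fun v => rightUnitLin_tmk_one v)

theorem rightUnitIso_hom_tmk (a : Bᵐᵒᵖ) (v : V.carrier) :
    lin (rightUnitIso V).hom (tmk V K.unitYD v (unitEquiv K a)) = V.bim.ract a v :=
  rightUnitLin_tmk a v

end FullYD

end YDMonoidal

/-! ### The monoidal structure -/

section YDMonoidalInstance

variable {B H : Type u} [Ring B] [Algebra ℂ B] [Ring H] [Algebra ℂ H]
  {K : FullHopfAlgebroid B H} {P : Type*} [AddCommGroup P] [Module ℂ P]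

open Bal

namespace FullYD

variable {U V W : FullYD K}

theorem tens_hom_ext {f g : tens V W ⟶ U}
    (h : ∀ v w, lin f (tmk V W v w) = lin g (tmk V W v w)) : f = g :=
  hom_ext_lin (tens_linearMap_ext h)

theorem tens_hom_ext₃ {T : FullYD K} {f g : tens (tens U V) W ⟶ T}
    (h : ∀ u v w, lin f (tmk (tens U V) W (tmk U V u v) w) =
      lin g (tmk (tens U V) W (tmk U V u v) w)) : f = g :=
  hom_ext_lin (LinearMap.ext fun z => by
    induction z using tens_induction₃ with
    | tmk u v w => exact h u v w
    | add x y hx hy => simp only [map_add, hx, hy])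

theorem tens_hom_ext₄ {S T : FullYD K} {f g : tens (tens (tens U V) W) S ⟶ T}
    (h : ∀ u v w s, lin f (tmk _ S (tmk (tens U V) W (tmk U V u v) w) s) =
      lin g (tmk _ S (tmk (tens U V) W (tmk U V u v) w) s)) : f = g :=
  tens_hom_ext fun z s => by
    induction z using tens_induction₃ with
    | tmk u v w => exact h u v w s
    | add x y hx hy => simp only [map_add, LinearMap.add_apply, hx, hy]

theorem lin_comp_apply (f : U ⟶ V) (g : V ⟶ W) (u : U.carrier) :
    lin (f ≫ g) u = lin g (lin f u) := rfl

theorem lin_id_apply (v : V.carrier) : lin (𝟙 V) v = v := rfl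

section

variable {U' V' W' S : FullYD K}

theorem tensMap_id : tensMap (𝟙 V) (𝟙 W) = 𝟙 (tens V W) :=
  tens_hom_ext fun v w => by rw [tensMap_tmk, lin_id_apply, lin_id_apply, lin_id_apply]

theorem tensMap_comp (f : U ⟶ U') (g : V ⟶ V') (f' : U' ⟶ W) (g' : V' ⟶ W') :
    tensMap f g ≫ tensMap f' g' = tensMap (f ≫ f') (g ≫ g') :=
  tens_hom_ext fun v w => by simp only [lin_comp_apply, tensMap_tmk]

theorem assocIso_naturality (f : U ⟶ U') (g : V ⟶ V') (h : W ⟶ W') :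
    tensMap (tensMap f g) h ≫ (assocIso U' V' W').hom =
      (assocIso U V W).hom ≫ tensMap f (tensMap g h) :=
  tens_hom_ext₃ fun u v w => by simp only [lin_comp_apply, tensMap_tmk, assocIso_hom_tmk]

theorem leftUnitIso_naturality (f : V ⟶ W) :
    tensMap (𝟙 K.unitYD) f ≫ (leftUnitIso W).hom = (leftUnitIso V).hom ≫ f :=
  tens_hom_ext fun a v => by
    induction a using unit_induction with | _ a
    simp only [lin_comp_apply, tensMap_tmk, lin_id_apply, leftUnitIso_hom_tmk, lin_lact]

theorem rightUnitIso_naturality (f : V ⟶ W) :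
    tensMap f (𝟙 K.unitYD) ≫ (rightUnitIso W).hom = (rightUnitIso V).hom ≫ f :=
  tens_hom_ext fun v a => by
    induction a using unit_induction with | _ a
    simp only [lin_comp_apply, tensMap_tmk, lin_id_apply, rightUnitIso_hom_tmk, lin_ract]

theorem assocIso_pentagon :
    tensMap (assocIso U V W).hom (𝟙 S) ≫ (assocIso U (tens V W) S).hom ≫
        tensMap (𝟙 U) (assocIso V W S).hom =
      (assocIso (tens U V) W S).hom ≫ (assocIso U V (tens W S)).hom :=
  tens_hom_ext₄ fun u v w s => by
    simp only [lin_comp_apply, tensMap_tmk, assocIso_hom_tmk, lin_id_apply]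

theorem assocIso_triangle :
    (assocIso V K.unitYD W).hom ≫ tensMap (𝟙 V) (leftUnitIso W).hom =
      tensMap (rightUnitIso V).hom (𝟙 W) :=
  tens_hom_ext₃ fun v a w => by
    induction a using unit_induction with | _ a
    simp only [lin_comp_apply, tensMap_tmk, assocIso_hom_tmk, lin_id_apply, leftUnitIso_hom_tmk,
      rightUnitIso_hom_tmk, tmk_balanced]

end

instance : MonoidalCategoryStruct (FullYD K) where
  tensorObj := tens
  whiskerLeft V _ _ f := tensMap (𝟙 V) f
  whiskerRight f W := tensMap f (𝟙 W)
  tensorHom := tensMap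
  tensorUnit := K.unitYD
  associator := assocIso
  leftUnitor := leftUnitIso
  rightUnitor := rightUnitIso

/-- The monoidal category of full Yetter–Drinfeld modules. -/
instance : MonoidalCategory (FullYD K) :=
  MonoidalCategory.ofTensorHom
    (id_tensorHom_id := fun _ _ => tensMap_id)
    (id_tensorHom := fun _ _ _ _ => rfl)
    (tensorHom_id := fun _ _ => rfl)
    (tensorHom_comp_tensorHom := fun f g h k => tensMap_comp f g h k)
    (associator_naturality := fun f g h => assocIso_naturality f g h)
    (leftUnitor_naturality := fun f => leftUnitIso_naturality f)
    (rightUnitor_naturality := fun f => rightUnitIso_naturality f)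
    (pentagon := fun _ _ _ _ => assocIso_pentagon)
    (triangle := fun _ _ => assocIso_triangle)

theorem lin_tensorHom_tmk {V' W' : FullYD K} (f : V ⟶ V') (g : W ⟶ W') (v : V.carrier)
    (w : W.carrier) : lin (f ⊗ₘ g) (tmk V W v w) = tmk V' W' (lin f v) (lin g w) :=
  tensMap_tmk f g v w

theorem lin_associator_hom_tmk (u : U.carrier) (v : V.carrier) (w : W.carrier) :
    lin (α_ U V W).hom (tmk (U ⊗ V) W (tmk U V u v) w) = tmk U (V ⊗ W) u (tmk V W v w) :=
  assocIso_hom_tmk u v w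

theorem lin_leftUnitor_hom_tmk (a : Bᵐᵒᵖ) (v : V.carrier) :
    lin (λ_ V).hom (tmk (𝟙_ (FullYD K)) V (unitEquiv K a) v) = V.bim.lact a v :=
  leftUnitIso_hom_tmk a v

theorem lin_rightUnitor_hom_tmk (a : Bᵐᵒᵖ) (v : V.carrier) :
    lin (ρ_ V).hom (tmk V (𝟙_ (FullYD K)) v (unitEquiv K a)) = V.bim.ract a v :=
  rightUnitIso_hom_tmk a v

end FullYD

variable (K) in
/-- The monoidal structure is the one of the tensor product over the base. -/
def tensorOverBase : TensorOverBase K where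
  e := FullYD.tensEquiv
  lact_e V W a v w := FullYD.lact_tmk a v w
  ract_e V W a v w := FullYD.ract_tmk a v w
  act_e V W v w X n p q h :=
    (FullYD.act_tmk X v w).trans (h.sw_eq (FullYD.isBal_tmk_act v w))
  δR_e V W v w n m p x q y hv hw := by
    have h := FullYD.isBal_tmkR_left (V := V) (W := W) isBal_tmul 1 w
    simp only [one_mul] at h
    refine (FullYD.δR_tmk v w).trans ((hv.sw_eq h).trans ?_)
    exact Finset.sum_congr rfl fun i _ => hw.sw_eq (FullYD.isBal_tmkR_right isBal_tmul _ _)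
  δL_e V W v w n m p x q y hv hw := by
    have h := FullYD.isBal_tmkL_right (V := V) (W := W) isBal_tmul 1 v
    simp only [mul_one] at h
    refine (FullYD.δL_tmk v w).trans ((hw.sw_eq h).trans ?_)
    rw [Finset.sum_comm]
    exact Finset.sum_congr rfl fun i _ => hv.sw_eq (FullYD.isBal_tmkL_left isBal_tmul _ _)
  map_e f g v w := FullYD.lin_tensorHom_tmk f g v w
  assoc_e U V W u v w := FullYD.lin_associator_hom_tmk u v w
  ι := FullYD.unitEquiv K
  lact_ι := FullYD.lact_unitEquiv
  ract_ι := FullYD.ract_unitEquiv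
  act_ι := FullYD.act_unitEquiv
  δR_ι := FullYD.δR_unitEquiv
  δL_ι := FullYD.δL_unitEquiv
  leftUnitor_e V a v := FullYD.lin_leftUnitor_hom_tmk a v
  rightUnitor_e V a v := FullYD.lin_rightUnitor_hom_tmk a v

end YDMonoidalInstance

/-! ### The braiding -/

section YDBraiding

variable {B H : Type u} [Ring B] [Algebra ℂ B] [Ring H] [Algebra ℂ H]
  {K : FullHopfAlgebroid B H} {P : Type*} [AddCommGroup P] [Module ℂ P]

open Bal

namespace FullYD

variable {U V W : FullYD K}

theorem isBal_braid (v : V.carrier) : IsBal (fun a => W.bim.ract a) K.rt fun q y =>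
    tmk W V q (V.mod.act y v) :=
  .mk fun a q y => by
    rw [tmk_balanced, LinearMap.mulRight_apply, V.mod.act_mul, V.act_tR]

theorem isBal_braidInv (v : V.carrier) :
    IsBal (fun b : B => W.bim.lact (op b)) K.ls fun q y =>
      tmk V W (V.mod.act (K.S.symm y) v) q :=
  .mk fun b q y => by
    rw [← tmk_balanced, LinearMap.mulLeft_apply, K.S_symm_mul, K.S_symm_s, V.mod.act_mul]
    exact congrArg (fun z => tmk V W z q) (V.act_sR _ _).symm

variable (V W) in
/-- The braiding `v ⊗ w ↦ w_[0] ⊗ v ◁ w_[1]` as a linear map. -/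
def braidLin : (tens V W).carrier →ₗ[ℂ] (tens W V).carrier :=
  tensLift fun v w => sw (W.comodR.δ w) fun q y => tmk W V q (V.mod.act y v)

variable (V W) in
/-- The inverse braiding `w ⊗ v ↦ v ◁ S⁻¹(w_(1)) ⊗ w_(0)` as a linear map. -/
def braidInvLin : (tens W V).carrier →ₗ[ℂ] (tens V W).carrier :=
  tensLift fun w v => sw (W.comodL.δ w) fun q y => tmk V W (V.mod.act (K.S.symm y) v) q

theorem braidLin_tmk (v : V.carrier) (w : W.carrier) : braidLin V W (tmk V W v w) =
    sw (W.comodR.δ w) fun q y => tmk W V q (V.mod.act y v) := by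
  rw [braidLin, tensLift_tmk]
  refine .mk fun a v w => ?_
  rw [W.comodR.sw_δ_lact (isBal_braid v)]
  simp only [V.mod.act_mul, V.act_sR]

theorem braidInvLin_tmk (w : W.carrier) (v : V.carrier) : braidInvLin V W (tmk W V w v) =
    sw (W.comodL.δ w) fun q y => tmk V W (V.mod.act (K.S.symm y) v) q := by
  rw [braidInvLin, tensLift_tmk]
  refine .mk fun a w v => ?_
  refine (W.comodL.sw_δ_ract (isBal_braidInv v) (unop a) w).trans (sw_congr _ fun q y => ?_)
  rw [K.S_symm_mul, V.mod.act_mul, ← V.act_tR]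
  rfl

/-- On pure tensors this is the Yetter–Drinfeld condition of `W`, evaluated on the map `q ⊗ y ↦ q ⊗
v ◁ y`. -/
theorem braidLin_act (X : H) (z : (tens V W).carrier) :
    braidLin V W ((tens V W).mod.act X z) = (tens W V).mod.act X (braidLin V W z) := by
  induction z using tens_induction with
  | add x y hx hy => simp only [map_add, hx, hy]
  | tmk v w =>
    simp only [act_tmk, map_sw, braidLin_tmk, ← V.mod.act_mul]
    exact W.sw_yd (isBal_braid v) w X

/-- Coassociativity of `W` (`h1`, `h2`) writes both sides in terms of `Δ_R(w_[1])`; they then agree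
by the Yetter–Drinfeld condition of `V` for the element `w_[1]`. -/
theorem δR_braidLin (z : (tens V W).carrier) :
    (tens W V).comodR.δ (braidLin V W z) =
      sw ((tens V W).comodR.δ z) fun p q => Bal.tmul _ _ (braidLin V W p) q := by
  induction z using tens_induction with
  | add x y hx hy => simp only [map_add, sw_add, hx, hy]
  | tmk v w =>
    have hT : IsBal (fun a => (tens W V).bim.ract a) K.rt fun z X =>
      Bal.tmul (fun a => (tens W V).bim.ract a) K.rt z X := isBal_tmul
    rw [sw_δR_tmk (isBal_of_act _ braidLin_act)]
    have e : ∀ p q X, (sw (W.comodR.δ q) fun q' y =>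
        Bal.tmul (fun a => (tens W V).bim.ract a) K.rt (tmk W V q' (V.mod.act y p))) X =
        sw (W.comodR.δ q) fun q' y => Bal.tmul (fun a => (tens W V).bim.ract a) K.rt
          (tmk W V q' (V.mod.act y p)) X := fun p q X => map_sw (LinearMap.applyₗ X) _ _
    simp only [braidLin_tmk, map_sw, δR_tmk, e]
    have h1 := W.comodR.sw_coassoc (τ := fun q z y => sw (V.comodR.δ (V.mod.act y v)) fun p x =>
      Bal.tmul (fun a => (tens W V).bim.ract a) K.rt (tmk W V q p) (z * x)) (.mk
        (fun a q z y => by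
          simp only [tmk_balanced, LinearMap.mulRight_apply, mul_assoc]
          exact V.comodR.sw_takeuchi (isBal_tmkR_right hT q z) a _)
        (fun a q z y => by
          simp only [LinearMap.mulRight_apply, V.mod.act_mul, V.act_tR]
          rw [V.comodR.sw_δ_lact (isBal_tmkR_right hT q z)]
          simp only [mul_assoc])) w
    have h2 := fun p x => W.comodR.sw_coassoc (τ := fun q z y =>
      Bal.tmul (fun a => (tens W V).bim.ract a) K.rt (tmk W V q (V.mod.act z p)) (x * y)) (.mk
        (fun a q z y => by
          simp only [tmk_balanced, LinearMap.mulRight_apply, V.mod.act_mul, V.act_tR])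
        (fun a q z y => by
          simp only [LinearMap.mulRight_apply, V.mod.act_mul, V.act_sR, ← ract_tmk]
          rw [← mul_assoc]
          exact Bal.tmul_balanced (fun a => (tens W V).bim.ract a) K.rt _ _ _)) w
    rw [h1]
    simp only [h2]
    rw [sw_comm]
    refine sw_congr _ fun q Y => ?_
    exact V.sw_yd (isBal_tmkR_right hT q 1 |> fun h => by simpa only [one_mul] using h) v Y

/-- The composite gives `v ◁ w_[1] S⁻¹(w_[0](1)) ⊗ w_[0](0)`. By the mixed axiom the acting element
becomes `X_[2] S⁻¹(X_[1]) = t_L(ε_L(X))` with `X = w_(1)`, and the counit law of `δ_L` ends the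
computation. -/
theorem braidInvLin_braidLin (z : (tens V W).carrier) :
    braidInvLin V W (braidLin V W z) = z := by
  induction z using tens_induction with
  | add x y hx hy => simp only [map_add, hx, hy]
  | tmk v w =>
    simp only [braidLin_tmk, map_sw, braidInvLin_tmk, ← V.mod.act_mul]
    rw [← W.sw_mixed_LR (τ := fun q x y => tmk V W (V.mod.act (y * K.S.symm x) v) q) (.mk
      (fun b q x y => by
        rw [← tmk_balanced, LinearMap.mulLeft_apply, K.S_symm_mul, K.S_symm_s, ← mul_assoc,
          V.mod.act_mul _ (K.t (op b))]
        exact congrArg (fun z => tmk V W z q) (V.act_sR _ _).symm)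
      (fun a q x y => by
        simp only [LinearMap.mulRight_apply, K.S_symm_mul, K.S_symm_sR, mul_assoc]))]
    have h : ∀ q Y, (sw (K.ΔR Y) fun x y => tmk V W (V.mod.act (y * K.S.symm x) v) q) =
        tmk V W v (W.bim.lact (op (K.ε Y)) q) := fun q Y => by
      rw [← tmk_balanced, ← V.act_sR]
      refine (map_sw ((tmk V W).flip q ∘ₗ V.mod.act.flip v) _ _).symm.trans ?_
      rw [K.sw_ΔR_mul_S_symm]
      rfl
    simp only [h]
    rw [← map_sw, W.comodL.sw_counit]

/-- Same scheme with the other mixed axiom, `S⁻¹(X₂) X₁ = t_R(ε_R(X))` and the counit law of `δ_R`.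
-/
theorem braidLin_braidInvLin (z : (tens W V).carrier) :
    braidLin V W (braidInvLin V W z) = z := by
  induction z using tens_induction with
  | add x y hx hy => simp only [map_add, hx, hy]
  | tmk w v =>
    simp only [braidLin_tmk, map_sw, braidInvLin_tmk, ← V.mod.act_mul]
    rw [← W.sw_mixed_RL (τ := fun q x y => tmk W V q (V.mod.act (K.S.symm y * x) v)) (.mk
      (fun a q x y => by
        rw [tmk_balanced, LinearMap.mulRight_apply, ← mul_assoc, V.mod.act_mul _ (K.tR a),
          V.act_tR])
      (fun b q x y => by
        simp only [LinearMap.mulLeft_apply, K.S_symm_mul, K.S_symm_s, mul_assoc]))]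
    have h : ∀ q Y, (sw (K.Δ Y) fun x y => tmk W V q (V.mod.act (K.S.symm y * x) v)) =
        tmk W V (W.bim.ract (K.εR Y) q) v := fun q Y => by
      rw [tmk_balanced, ← V.act_tR, ← K.s_ε_S_symm, ← K.sw_Δ_S_symm_mul]
      exact (map_sw (tmk W V q ∘ₗ V.mod.act.flip v) _ _).symm
    simp only [h]
    refine (map_sw ((tmk W V).flip v) _ _).symm.trans ?_
    rw [W.comodR.sw_counit, LinearMap.flip_apply]

variable (V W) in
/-- The braiding. -/
def braidIso : tens V W ≅ tens W V :=
  isoOfInverse (Hom.ofR (braidLin V W) braidLin_act δR_braidLin) (braidInvLin V W)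
    braidInvLin_braidLin braidLin_braidInvLin

theorem braidIso_hom_tmk (v : V.carrier) (w : W.carrier) : lin (braidIso V W).hom (tmk V W v w) =
    sw (W.comodR.δ w) fun q y => tmk W V q (V.mod.act y v) := braidLin_tmk v w

theorem braidIso_inv_tmk (w : W.carrier) (v : V.carrier) : lin (braidIso V W).inv (tmk W V w v) =
    sw (W.comodL.δ w) fun q y => tmk V W (V.mod.act (K.S.symm y) v) q := braidInvLin_tmk w v

theorem tens_hom_ext₃' {T : FullYD K} {f g : tens U (tens V W) ⟶ T}
    (h : ∀ u v w, lin f (tmk U (tens V W) u (tmk V W v w)) =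
      lin g (tmk U (tens V W) u (tmk V W v w))) : f = g :=
  hom_ext_lin (LinearMap.ext fun z => by
    induction z using tens_induction₃' with
    | tmk u v w => exact h u v w
    | add x y hx hy => simp only [map_add, hx, hy])

variable {V' W' : FullYD K}

theorem braidIso_naturality (f : V ⟶ V') (g : W ⟶ W') :
    tensMap f g ≫ (braidIso V' W').hom = (braidIso V W).hom ≫ tensMap g f :=
  tens_hom_ext fun v w => by
    simp only [lin_comp_apply, tensMap_tmk, braidIso_hom_tmk, map_sw,
      sw_δR_lin g (isBal_braid _), lin_act]

/-- Both sides make `v_[1] w_[1]` act on `u`: at once through the coaction of `V ⊗ W`, or in two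
steps. -/
theorem braidIso_hexagon_forward :
    (assocIso U V W).hom ≫ (braidIso U (tens V W)).hom ≫ (assocIso V W U).hom =
      tensMap (braidIso U V).hom (𝟙 W) ≫ (assocIso V U W).hom ≫
        tensMap (𝟙 V) (braidIso U W).hom :=
  tens_hom_ext₃ fun u v w => by
    have e : ∀ w, (sw (V.comodR.δ v) fun q y =>
        tmk (tens V U) W (tmk V U q (U.mod.act y u))) w = sw (V.comodR.δ v) fun q y =>
          tmk (tens V U) W (tmk V U q (U.mod.act y u)) w :=
      fun w => map_sw (LinearMap.applyₗ w) _ _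
    simp only [lin_comp_apply, tensMap_tmk, assocIso_hom_tmk, lin_id_apply, braidIso_hom_tmk,
      map_sw, e, sw_δR_tmk (isBal_braid _), U.mod.act_mul]

/-- The diagonal action of `w_[1]` on `u ⊗ v` is compared with two successive coactions on `w`:
coassociativity. -/
theorem braidIso_hexagon_reverse :
    (assocIso U V W).inv ≫ (braidIso (tens U V) W).hom ≫ (assocIso W U V).inv =
      tensMap (𝟙 U) (braidIso V W).hom ≫ (assocIso U W V).inv ≫
        tensMap (braidIso U W).hom (𝟙 V) :=
  tens_hom_ext₃' fun u v w => by
    have e : ∀ q v, (sw (W.comodR.δ q) fun q y =>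
        tmk (tens W U) V (tmk W U q (U.mod.act y u))) v = sw (W.comodR.δ q) fun q y =>
          tmk (tens W U) V (tmk W U q (U.mod.act y u)) v :=
      fun q v => map_sw (LinearMap.applyₗ v) _ _
    simp only [lin_comp_apply, tensMap_tmk, assocIso_inv_tmk, lin_id_apply, braidIso_hom_tmk,
      map_sw, e, act_tmk]
    exact (W.comodR.sw_coassoc (τ := fun q x y => tmk (tens W U) V (tmk W U q (U.mod.act x u))
      (V.mod.act y v)) (.mk
        (fun a q x y => by
          simp only [tmk_balanced, LinearMap.mulRight_apply, U.mod.act_mul, U.act_tR])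
        (fun a q x y => by
          simp only [LinearMap.mulRight_apply, U.mod.act_mul, V.mod.act_mul, U.act_sR, V.act_tR,
            ← tmk_balanced, ract_tmk])) w).symm

/-- The braided category of full Yetter–Drinfeld modules. -/
instance : BraidedCategory (FullYD K) where
  braiding := braidIso
  braiding_naturality_right X _ _ f := braidIso_naturality (𝟙 X) f
  braiding_naturality_left f Z := braidIso_naturality f (𝟙 Z)
  hexagon_forward _ _ _ := braidIso_hexagon_forward
  hexagon_reverse _ _ _ := braidIso_hexagon_reverse

theorem isYDBraiding : IsYDBraiding (tensorOverBase K) where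
  hom_e _ _ v w _ _ _ h := (braidIso_hom_tmk v w).trans (h.sw_eq (isBal_braid v))
  inv_e _ _ v w _ _ _ h := (braidIso_inv_tmk w v).trans (h.sw_eq (isBal_braidInv v))

end FullYD

end YDBraiding

/-! ### Complex conjugate vector spaces -/

section ConjugateSpaces

variable {V W P : Type*} [AddCommGroup V] [Module ℂ V] [AddCommGroup W] [Module ℂ W]
  [AddCommGroup P] [Module ℂ P]

/-- The complex conjugate of a complex vector space. -/
def Conj (V : Type*) : Type _ := V

namespace Conj

instance : AddCommGroup (Conj V) := inferInstanceAs (AddCommGroup V)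

instance : Module ℂ (Conj V) := Module.compHom V (starRingEnd ℂ)

variable (V) in
/-- The antilinear bijection `v ↦ v̄`. -/
def toConj : V ≃ₛₗ[starRingEnd ℂ] Conj V where
  toFun v := v
  invFun v := v
  map_add' _ _ := rfl
  map_smul' c v := show c • v = (starRingEnd ℂ) ((starRingEnd ℂ) c) • v by
    rw [Complex.conj_conj]
  left_inv _ := rfl
  right_inv _ := rfl

variable (V) in
/-- The antilinear bijection `v̄ ↦ v`. -/
abbrev ofConj : Conj V ≃ₛₗ[starRingEnd ℂ] V := (toConj V).symm

@[simp] theorem toConj_smul (c : ℂ) (v : V) :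
    toConj V (c • v) = (starRingEnd ℂ) c • toConj V v := map_smulₛₗ (toConj V) c v

@[simp] theorem ofConj_smul (c : ℂ) (v : Conj V) :
    ofConj V (c • v) = (starRingEnd ℂ) c • ofConj V v := map_smulₛₗ (ofConj V) c v

@[elab_as_elim] theorem induction {motive : Conj V → Prop} (z : Conj V)
    (h : ∀ v, motive (toConj V v)) : motive z := h z

/-- The linear map `v̄ ↦ f(v)‾`. -/
def map (f : V →ₗ[ℂ] W) : Conj V →ₗ[ℂ] Conj W where
  toFun v := toConj W (f (ofConj V v))
  map_add' _ _ := by simp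
  map_smul' _ _ := by simp

@[simp] theorem map_toConj (f : V →ₗ[ℂ] W) (v : V) :
    map f (toConj V v) = toConj W (f v) := by
  simp [map]

/-- A linear map to a conjugate space as a linear map on the conjugate space. -/
def descend (f : V →ₗ[ℂ] Conj P) : Conj V →ₗ[ℂ] P where
  toFun v := ofConj P (f (ofConj V v))
  map_add' _ _ := by simp
  map_smul' _ _ := by simp

@[simp] theorem descend_toConj (f : V →ₗ[ℂ] Conj P) (v : V) :
    descend f (toConj V v) = ofConj P (f v) := by
  simp [descend]

variable (P) in
/-- The linear bijection `p ↦ p̄̄`. -/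
def doubleConj : P ≃ₗ[ℂ] Conj (Conj P) := (toConj P).trans (toConj (Conj P))

@[simp] theorem doubleConj_apply (p : P) : doubleConj P p = toConj _ (toConj _ p) := rfl

end Conj

end ConjugateSpaces

/-! ### The involution of a full `*`-Hopf algebroid -/

section StarHopf

variable {B H : Type u} [Ring B] [Algebra ℂ B] [StarRing B]
  [Ring H] [Algebra ℂ H] [StarRing H]
  {K : FullHopfAlgebroid B H} {P : Type*} [AddCommGroup P] [Module ℂ P]

open Bal Conj

/-- The involution as a linear map on the conjugate space. -/
def starConj (H : Type*) [Ring H] [Algebra ℂ H] [StarRing H] [StarModule ℂ H] :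
    Conj H →ₗ[ℂ] H where
  toFun z := star (ofConj H z)
  map_add' _ _ := by simp
  map_smul' _ _ := by simp

theorem starConj_apply {H : Type*} [Ring H] [Algebra ℂ H] [StarRing H] [StarModule ℂ H]
    (z : Conj H) : starConj H z = star (ofConj H z) := rfl

namespace FullHopfAlgebroid.IsStar

variable (hK : K.IsStar)
include hK

theorem star_sR (a : Bᵐᵒᵖ) : star (K.sR a) = K.sR (star a) := hK.star_t (unop a)

theorem star_tR (a : Bᵐᵒᵖ) : star (K.tR a) = K.s (unop (star a)) := by
  have := hK.star_s (star (unop a))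
  rw [star_star, op_unop] at this
  rw [← this, star_star]
  rfl

theorem εR_star (X : H) : K.εR (star X) = star (op (K.ε X)) := by
  have := hK.ε_star (star X)
  rw [star_star] at this
  rw [this, star_star]

variable [StarModule ℂ H]

/-- The involution interchanges the relations of `H ⊗_A H` and `H ⊗_B H`. It is antilinear, so
values are taken in the conjugate space, where the summand becomes linear and the Sweedler calculus
applies. -/
theorem isBal_star {φ : H → H → P} (hφ : IsBal K.rs K.rt φ) :
    IsBal K.lt K.ls fun x y => toConj P (φ (star x) (star y)) := by
  have hb := hφ.bal
  obtain ⟨φ, rfl⟩ := hφ.exists_bilin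
  refine .mk fun b x y => ?_
  have := hb (op (star b)) (star x) (star y)
  simpa [hK.star_s, hK.star_t] using this

theorem isBal_star' {φ : H → H → P} (hφ : IsBal K.lt K.ls φ) :
    IsBal K.rs K.rt fun x y => toConj P (φ (star x) (star y)) := by
  have hb := hφ.bal
  obtain ⟨φ, rfl⟩ := hφ.exists_bilin
  refine .mk fun a x y => ?_
  have := hb (unop (star a)) (star x) (star y)
  have e : K.t (star a) = K.sR (star a) := rfl
  simpa [hK.star_sR, hK.star_tR, e] using this

theorem sw_ΔR_star {φ : H → H → P} (hφ : IsBal K.rs K.rt φ) (X : H) :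
    sw (K.ΔR (star X)) φ = ofConj P (sw (K.Δ X) fun x y => toConj P (φ (star x) (star y))) := by
  obtain ⟨n, p, q, h⟩ := exists_isSum (K.Δ X)
  rw [(hK.Δ_star X n p q h).sw_eq hφ, h.sw_eq (hK.isBal_star hφ)]
  simp

/-- The assumed rule at `X*`, read backwards: the involutions and the double conjugation cancel. -/
theorem sw_Δ_star {φ : H → H → P} (hφ : IsBal K.lt K.ls φ) (X : H) :
    sw (K.Δ (star X)) φ = ofConj P (sw (K.ΔR X) fun x y => toConj P (φ (star x) (star y))) := by
  have h := hK.sw_ΔR_star (hK.isBal_star' hφ) (star X)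
  simp only [star_star] at h
  rw [h]
  apply (doubleConj P).injective
  rw [← LinearEquiv.coe_coe, map_sw]
  simp

/-- `(S⁻¹(X*))* = S(X)`. -/
theorem star_S_symm_star (X : H) : star (K.S.symm (star X)) = K.S X := by
  -- With `T(X) = (S⁻¹(X*))*`, this says that `T(X₁) X₂` has the same value as `S(X₁) X₂`. It is the
  -- involution of `Y_[2] S⁻¹(Y_[1]) = t_L(ε_L(Y))` for `Y = X*`.
  have h1 : ∀ X, sw (K.Δ X) (fun x y => star (K.S.symm (star x)) * y) = K.sR (K.εR X) := fun X => by
    have hb : IsBal K.rs K.rt fun x y => y * K.S.symm x := .mk fun a x y => by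
      simp [K.S_symm_mul, K.S_symm_sR, mul_assoc]
    have h := hK.sw_ΔR_star hb X
    rw [K.sw_ΔR_mul_S_symm, hK.ε_star] at h
    have h' := congrArg star h
    rw [← starConj_apply, map_sw] at h'
    simp only [starConj_apply, LinearEquiv.symm_apply_apply, star_mul, star_star] at h'
    rw [← h']
    exact (hK.star_sR _).trans (by rw [star_star])
  have h2 : ∀ b X, star (K.S.symm (star (K.t (op b) * X))) =
      star (K.S.symm (star X)) * K.s b := fun b X => by
    rw [star_mul, K.S_symm_mul, star_mul, hK.star_t, K.S_symm_sR, hK.star_tR, unop_star, unop_op,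
      star_star]
  -- Convolution argument for uniqueness: `T(X)` is written as `T(X_[1](1)) X_[1](2) S(X_[2])`, and
  -- `h1` reduces it to `s_R(ε_R(X_[1])) S(X_[2])`, that is, to `S(X)`.
  have h3 := K.sw_ΔR_sw_Δ_mul_S (φ := fun x y => star (K.S.symm (star x)) * y)
    (.mk fun b x y => by simp only [LinearMap.mulLeft_apply, h2, mul_assoc]) X
  rw [mul_one] at h3
  rw [← h3]
  have h4 : ∀ x y, (sw (K.Δ x) fun x' y' => star (K.S.symm (star x')) * (y' * K.S y)) =
      K.S (y * K.tR (K.εR x)) := fun x y => by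
    rw [K.S_mul, K.S_tR, ← h1, ← LinearMap.mulRight_apply ℂ, map_sw]
    simp only [LinearMap.mulRight_apply, mul_assoc]
  simp only [h4]
  conv_rhs => rw [← K.sw_ΔR_counit_left X]
  exact (map_sw K.S.toLinearMap _ _).symm

end FullHopfAlgebroid.IsStar

end StarHopf

/-! ### Conjugate Yetter–Drinfeld modules -/

section ConjugateYD

variable {B H : Type u} [Ring B] [Algebra ℂ B] [StarRing B] [StarModule ℂ B]
  [Ring H] [Algebra ℂ H] [StarRing H] [StarModule ℂ H]
  {K : FullHopfAlgebroid B H} {P : Type*} [AddCommGroup P] [Module ℂ P]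

open Bal Conj

theorem map_ofConj_sw {I M N Q : Type*} [AddCommGroup M] [Module ℂ M] [AddCommGroup N] [Module ℂ N]
    [AddCommGroup Q] [Module ℂ Q] {f : I → Module.End ℂ M} {g : I → Module.End ℂ N}
    (L : P →ₗ[ℂ] Q) (z : Bal f g) (ψ : M → N → Conj P) :
    L (ofConj P (sw z ψ)) = ofConj Q (sw z fun m n => Conj.map L (ψ m n)) := by
  rw [← map_sw]
  exact Conj.induction (sw z ψ) fun v => by simp

/-- The conjugate bimodule: `a v̄ = (v a*)‾` and `v̄ a = (a* v)‾`. -/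
def BimoduleStr.bar {A V : Type u} [Ring A] [Algebra ℂ A] [StarRing A] [StarModule ℂ A]
    [AddCommGroup V] [Module ℂ V] (bim : BimoduleStr A V) : BimoduleStr A (Conj V) where
  lact := LinearMap.mk₂ ℂ (fun a v => toConj V (bim.ract (star a) (ofConj V v)))
    (by intros; simp) (by intros; simp) (by intros; simp) (by intros; simp)
  ract := LinearMap.mk₂ ℂ (fun a v => toConj V (bim.lact (star a) (ofConj V v)))
    (by intros; simp) (by intros; simp) (by intros; simp) (by intros; simp)
  lact_one v := by simp [bim.ract_one]
  lact_mul a b v := by simp [bim.ract_mul]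
  ract_one v := by simp [bim.lact_one]
  ract_mul a b v := by simp [bim.lact_mul]
  lact_ract a b v := by simp [bim.lact_ract]

@[simp] theorem BimoduleStr.bar_lact {A V : Type u} [Ring A] [Algebra ℂ A] [StarRing A]
    [StarModule ℂ A] [AddCommGroup V] [Module ℂ V] (bim : BimoduleStr A V) (a : A) (v : V) :
    bim.bar.lact a (toConj V v) = toConj V (bim.ract (star a) v) := by
  simp [bar]

@[simp] theorem BimoduleStr.bar_ract {A V : Type u} [Ring A] [Algebra ℂ A] [StarRing A]
    [StarModule ℂ A] [AddCommGroup V] [Module ℂ V] (bim : BimoduleStr A V) (a : A) (v : V) :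
    bim.bar.ract a (toConj V v) = toConj V (bim.lact (star a) v) := by
  simp [bar]

namespace FullYD

variable (V : FullYD K)

/-- The conjugate module: `v̄ ◁ X = (v ◁ S⁻¹(X*))‾`. -/
def barMod : RightModuleStr H (Conj V.carrier) where
  act := LinearMap.mk₂ ℂ (fun X v => toConj _ (V.mod.act (K.S.symm (star X)) (ofConj _ v)))
    (by intros; simp) (by intros; simp) (by intros; simp) (by intros; simp)
  act_one v := by simp [K.S_symm_one, V.mod.act_one]
  act_mul X Y v := by simp [K.S_symm_mul, V.mod.act_mul]

theorem barMod_act (X : H) (v : V.carrier) :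
    V.barMod.act X (toConj _ v) = toConj _ (V.mod.act (K.S.symm (star X)) v) := by
  simp [barMod]

/-- The coaction `v̄ ↦ v_(0)‾ ⊗ v_(1)*`. -/
def barδR : Conj V.carrier →ₗ[ℂ] RTens K V.bim.bar :=
  Conj.descend (swLin _ _ (fun p q => toConj _ (Bal.tmul _ _ (toConj _ p) (star q))) ∘ₗ V.comodL.δ)

/-- The coaction `v̄ ↦ v_[0]‾ ⊗ v_[1]*`. -/
def barδL : Conj V.carrier →ₗ[ℂ] LTens K V.bim.bar :=
  Conj.descend (swLin _ _ (fun p q => toConj _ (Bal.tmul _ _ (toConj _ p) (star q))) ∘ₗ V.comodR.δ)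

variable {V}

theorem sw_barδR {φ : Conj V.carrier → H → P}
    (hφ : IsBal (fun a => V.bim.bar.ract a) K.rt φ) (v : V.carrier) :
    sw (V.barδR (toConj _ v)) φ =
      ofConj P (sw (V.comodL.δ v) fun p q => toConj P (φ (toConj _ p) (star q))) := by
  rw [barδR, descend_toConj, LinearMap.comp_apply, swLin_apply, ← swLin_apply, map_ofConj_sw]
  simp only [map_toConj, swLin_apply, sw_tmul hφ]

theorem sw_barδL {φ : Conj V.carrier → H → P}
    (hφ : IsBal (fun b : B => V.bim.bar.lact (op b)) K.ls φ) (v : V.carrier) :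
    sw (V.barδL (toConj _ v)) φ =
      ofConj P (sw (V.comodR.δ v) fun p q => toConj P (φ (toConj _ p) (star q))) := by
  rw [barδL, descend_toConj, LinearMap.comp_apply, swLin_apply, ← swLin_apply, map_ofConj_sw]
  simp only [map_toConj, swLin_apply, sw_tmul hφ]

/-- Together with the next fact, this allows the Yetter–Drinfeld condition for `δ_L`, stated with
`Δ_R(Z)`, to be rewritten with `Δ (S Z)`. The involution turns the latter into `Δ_R` of `(S Z)*`. -/
theorem isBal_ydL_left {ψ : V.carrier → H → P}
    (hψ : IsBal (fun b : B => V.bim.lact (op b)) K.ls ψ) (v : V.carrier) :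
    IsBal K.rs K.rt fun x y => sw (V.comodL.δ (V.mod.act x v)) fun w z => ψ w (z * K.S y) := by
  have h := fun y (a : Bᵐᵒᵖ) => V.comodL.sw_δ_ract (V.isBal_mul_right hψ (K.S y)) (unop a)
  obtain ⟨ψ, rfl⟩ := hψ.exists_bilin
  refine .mk fun a x y => ?_
  rw [LinearMap.mulRight_apply, LinearMap.mulRight_apply, V.mod.act_mul, V.act_sR]
  refine (h y a _).trans (sw_congr _ fun w z => ?_)
  rw [K.S_mul, K.S_tR, mul_assoc]
  rfl

theorem isBal_ydL_right {ψ : V.carrier → H → P}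
    (hψ : IsBal (fun b : B => V.bim.lact (op b)) K.ls ψ) (w : V.carrier) (z : H) :
    IsBal K.rs K.rt fun x y => ψ (V.mod.act y w) (K.S x * z) := by
  have hb := hψ.bal
  obtain ⟨ψ, rfl⟩ := hψ.exists_bilin
  refine .mk fun a x y => ?_
  have := hb (unop a) (V.mod.act y w) (K.S x * z)
  simpa [K.S_mul, K.S_sR, V.mod.act_mul, V.act_tR, mul_assoc] using this.symm

variable (hK : K.IsStar)
include hK

/-- Conjugation exchanges left and right base actions and the involution turns `s_L` into `t_R`, so
the relations of `⊗_A` on the conjugate become those of `⊗_B` on `V`. -/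
theorem isBal_barR {φ : Conj V.carrier → H → P}
    (hφ : IsBal (fun a => V.bim.bar.ract a) K.rt φ) :
    IsBal (fun b : B => V.bim.lact (op b)) K.ls fun p q =>
      toConj P (φ (toConj _ p) (star q)) := by
  have hb := hφ.bal
  obtain ⟨φ, rfl⟩ := hφ.exists_bilin
  refine .mk fun b p q => ?_
  have := hb (op (star b)) (toConj _ p) (star q)
  simpa [hK.star_s] using this

theorem isBal_barL {φ : Conj V.carrier → H → P}
    (hφ : IsBal (fun b : B => V.bim.bar.lact (op b)) K.ls φ) :
    IsBal (fun a => V.bim.ract a) K.rt fun p q =>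
      toConj P (φ (toConj _ p) (star q)) := by
  have hb := hφ.bal
  obtain ⟨φ, rfl⟩ := hφ.exists_bilin
  refine .mk fun a p q => ?_
  have := hb (unop (star a)) (toConj _ p) (star q)
  simpa [hK.star_tR] using this

theorem sw_barδR_bimod {φ : Conj V.carrier → H → P}
    (hφ : IsBal (fun a => V.bim.bar.ract a) K.rt φ) (a a' : Bᵐᵒᵖ) (v : Conj V.carrier) :
    sw (V.barδR (V.bim.bar.lact a (V.bim.bar.ract a' v))) φ =
      sw (V.barδR v) fun p q => φ p (K.sR a * q * K.sR a') := by
  induction v using Conj.induction with | _ v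
  rw [BimoduleStr.bar_ract, BimoduleStr.bar_lact, ← V.bim.lact_ract, sw_barδR hφ,
    sw_barδR (RightRComodule.isBal_sR_mul hφ _ _)]
  refine congrArg (ofConj P) ((V.comodL.sw_δ_bimod (isBal_barR hK hφ)
    (unop (star a')) (unop (star a)) v).trans (sw_congr _ fun p q => ?_))
  have e : ∀ a : Bᵐᵒᵖ, star (K.t (star a)) = K.sR a := fun a =>
    (hK.star_sR (star a)).trans (by rw [star_star])
  simp only [op_unop, star_mul, e, mul_assoc]

theorem sw_barδL_bimod {φ : Conj V.carrier → H → P}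
    (hφ : IsBal (fun b : B => V.bim.bar.lact (op b)) K.ls φ) (b b' : B) (v : Conj V.carrier) :
    sw (V.barδL (V.bim.bar.lact (op b) (V.bim.bar.ract (op b') v))) φ =
      sw (V.barδL v) fun p q => φ p (K.t (op b) * q * K.t (op b')) := by
  induction v using Conj.induction with | _ v
  rw [BimoduleStr.bar_ract, BimoduleStr.bar_lact, ← V.bim.lact_ract, sw_barδL hφ,
    sw_barδL (RightLComodule.isBal_t_mul hφ _ _)]
  refine congrArg (ofConj P) ((V.comodR.sw_δ_bimod (isBal_barL hK hφ)
    (star (op b')) (star (op b)) v).trans (sw_congr _ fun p q => ?_))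
  have e : ∀ a : Bᵐᵒᵖ, star (K.sR (star a)) = K.t a := fun a =>
    (hK.star_sR (star a)).trans (by rw [star_star]; rfl)
  simp only [star_mul, e, mul_assoc]

/-- The conjugate comodule of the right bialgebroid. -/
def barComodR (V : FullYD K) : RightRComodule K V.bim.bar :=
  .ofSw V.barδR
    (fun a a' v => by
      have := sw_barδR_bimod hK isBal_tmul a a' v
      rwa [sw_self] at this)
    (fun a v => by
      induction v using Conj.induction with | _ v
      have hT : IsBal (fun a => V.bim.bar.ract a) K.rt fun p q =>
        Bal.tmul (fun a => V.bim.bar.ract a) K.rt p q := isBal_tmul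
      have h1 : IsBal (fun a => V.bim.bar.ract a) K.rt fun p q =>
          Bal.tmul (fun a => V.bim.bar.ract a) K.rt p (K.tR a * q) := by
        simpa [K.sR_one] using RightRComodule.isBal_sR_mul hT (K.tR a) 1
      rw [sw_barδR h1, sw_barδR (.mk fun b p q => by
        rw [V.bim.bar.lact_ract]
        exact Bal.tmul_balanced (fun a => V.bim.bar.ract a) K.rt _ _ _)]
      refine congrArg (ofConj _) (Eq.trans (sw_congr _ fun p q => ?_)
        ((V.comodL.sw_takeuchi (isBal_barR hK hT) (unop (star a)) v).trans
          (sw_congr _ fun p q => ?_)))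
      · rw [BimoduleStr.bar_lact, op_unop]
      · rw [star_mul, hK.star_s, op_star, op_unop, star_star])
    (fun v => by
      induction v using Conj.induction with | _ v
      have b₁ := Bal₃.tmul_balanced₁ (fun a => V.bim.bar.ract a) K.rt K.rs K.rt
      have b₂ := Bal₃.tmul_balanced₂ (fun a => V.bim.bar.ract a) K.rt K.rs K.rt
      have c₁ : ∀ y, IsBal (fun a => V.bim.bar.ract a) K.rt fun z x =>
        Bal₃.tmul (fun a => V.bim.bar.ract a) K.rt K.rs K.rt z x y :=
        fun y => .mk fun a z x => b₁ a z x y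
      have c₂ : ∀ z, IsBal K.rs K.rt fun x y =>
        Bal₃.tmul (fun a => V.bim.bar.ract a) K.rt K.rs K.rt z x y :=
        fun z => .mk fun a x y => b₂ a z x y
      rw [sw_barδR, sw_barδR]
      · simp only [sw_barδR (c₁ _), hK.sw_ΔR_star (c₂ _), LinearEquiv.apply_symm_apply]
        -- With the involutions carried out, what remains is coassociativity of `δ_L`.
        refine congrArg (ofConj _) (V.comodL.sw_coassoc (τ := fun p x y =>
          toConj _ (Bal₃.tmul (fun a => V.bim.bar.ract a) K.rt K.rs K.rt (toConj _ p) (star x)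
            (star y))) (.mk (fun b p x y => ?_) (fun b p x y => ?_)) v)
        · exact (isBal_barR hK (c₁ (star y))).bal b p x
        · exact (hK.isBal_star (c₂ (toConj _ p))).bal b x y
      · exact .mk fun a z X => (sw_congr _ fun x y => b₁ a z x y).trans
          (K.sw_ΔR_mul_tR (c₂ z) a X).symm
      · refine .mk fun a z X => ?_
        have := sw_barδR_bimod hK (c₁ X) 1 a z
        rw [V.bim.bar.lact_one] at this
        rw [this]
        refine sw_congr _ fun x y => ?_
        rw [K.sR_one, one_mul]
        exact b₂ a _ _ _)
    (fun v => by
      induction v using Conj.induction with | _ v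
      rw [sw_barδR (.mk fun a z X => by
        simp [K.εR_mul_tR, V.bim.bar.ract_mul])]
      simp only [hK.εR_star, BimoduleStr.bar_ract, star_star]
      refine (congrArg (ofConj _) (map_sw (doubleConj V.carrier).toLinearMap
        (V.comodL.δ v) fun p q => V.bim.lact (op (K.ε q)) p).symm).trans ?_
      rw [V.comodL.sw_counit]
      rfl)

/-- The conjugate comodule of the left bialgebroid. -/
def barComodL (V : FullYD K) : RightLComodule K V.bim.bar :=
  .ofSw V.barδL
    (fun b b' v => by
      have := sw_barδL_bimod hK isBal_tmul b b' v
      rwa [sw_self] at this)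
    (fun b v => by
      induction v using Conj.induction with | _ v
      have hT : IsBal (fun b : B => V.bim.bar.lact (op b)) K.ls fun p q =>
        Bal.tmul (fun b : B => V.bim.bar.lact (op b)) K.ls p q := isBal_tmul
      have h1 : IsBal (fun b : B => V.bim.bar.lact (op b)) K.ls fun p q =>
          Bal.tmul (fun b : B => V.bim.bar.lact (op b)) K.ls p (q * K.s b) := by
        simpa using RightLComodule.isBal_t_mul hT (K.s b) 1
      rw [sw_barδL h1, sw_barδL (.mk fun a p q => by
        rw [← V.bim.bar.lact_ract]
        exact Bal.tmul_balanced (fun b : B => V.bim.bar.lact (op b)) K.ls _ _ _)]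
      refine congrArg (ofConj _) (Eq.trans (sw_congr _ fun p q => ?_)
        ((V.comodR.sw_takeuchi (isBal_barL hK hT) (star (op b)) v).trans
          (sw_congr _ fun p q => ?_)))
      · rw [BimoduleStr.bar_ract]
      · rw [star_mul, hK.star_tR, star_star, unop_op])
    (fun v => by
      induction v using Conj.induction with | _ v
      have b₁ := Bal₃.tmul_balanced₁ (fun b : B => V.bim.bar.lact (op b)) K.ls K.lt K.ls
      have b₂ := Bal₃.tmul_balanced₂ (fun b : B => V.bim.bar.lact (op b)) K.ls K.lt K.ls
      have c₁ : ∀ y, IsBal (fun b : B => V.bim.bar.lact (op b)) K.ls fun z x =>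
        Bal₃.tmul (fun b : B => V.bim.bar.lact (op b)) K.ls K.lt K.ls z x y :=
        fun y => .mk fun a z x => b₁ a z x y
      have c₂ : ∀ z, IsBal K.lt K.ls fun x y =>
        Bal₃.tmul (fun b : B => V.bim.bar.lact (op b)) K.ls K.lt K.ls z x y :=
        fun z => .mk fun a x y => b₂ a z x y
      rw [sw_barδL, sw_barδL]
      · simp only [sw_barδL (c₁ _), hK.sw_Δ_star (c₂ _), LinearEquiv.apply_symm_apply]
        refine congrArg (ofConj _) (V.comodR.sw_coassoc (τ := fun p x y =>
          toConj _ (Bal₃.tmul (fun b : B => V.bim.bar.lact (op b)) K.ls K.lt K.ls (toConj _ p)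
            (star x) (star y))) (.mk (fun b p x y => ?_) (fun b p x y => ?_)) v)
        · exact (isBal_barL hK (c₁ (star y))).bal b p x
        · exact (hK.isBal_star' (c₂ (toConj _ p))).bal b x y
      · exact .mk fun a z X => (sw_congr _ fun x y => b₁ a z x y).trans
          (K.sw_Δ_s_mul (c₂ z) a X).symm
      · refine .mk fun a z X => ?_
        have := sw_barδL_bimod hK (c₁ X) a 1 z
        rw [op_one, V.bim.bar.ract_one] at this
        rw [this]
        refine sw_congr _ fun x y => ?_
        rw [map_one, mul_one]
        exact b₂ a _ _ _)
    (fun v => by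
      induction v using Conj.induction with | _ v
      rw [sw_barδL (.mk fun a z X => by
        simp [K.ε_s_mul, V.bim.bar.lact_mul])]
      simp only [hK.ε_star, BimoduleStr.bar_lact, star_star]
      refine (congrArg (ofConj _) (map_sw (doubleConj V.carrier).toLinearMap
        (V.comodR.δ v) fun p q => V.bim.ract (K.εR q) p).symm).trans ?_
      rw [V.comodR.sw_counit]
      rfl)

theorem barMod_act_tR (a : Bᵐᵒᵖ) (v : Conj V.carrier) :
    V.barMod.act (K.tR a) v = V.bim.bar.lact a v := by
  induction v using Conj.induction with | _ v
  rw [barMod_act, BimoduleStr.bar_lact, hK.star_tR, K.S_symm_s, op_unop]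
  exact congrArg _ (V.act_sR _ _)

theorem barMod_act_sR (a : Bᵐᵒᵖ) (v : Conj V.carrier) :
    V.barMod.act (K.sR a) v = V.bim.bar.ract a v := by
  induction v using Conj.induction with | _ v
  rw [barMod_act, BimoduleStr.bar_ract, hK.star_sR, K.S_symm_sR, V.act_tR]

/-- Conjugation exchanges the two coactions and the two coproducts, so each mixed axiom follows from
the other one for `V`. -/
theorem bar_mixed_LR (v : Conj V.carrier) :
    (sw (V.barδL v) fun p q => sw (K.ΔR q) fun x y =>
        Bal₃.tmul (fun b : B => V.bim.bar.lact (op b)) K.ls K.rs K.rt p x y) =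
      sw (V.barδR v) fun p q => sw (V.barδL p) fun p' q' => Bal₃.tmul _ _ _ _ p' q' q := by
  induction v using Conj.induction with | _ v
  have b₁ := Bal₃.tmul_balanced₁ (fun b : B => V.bim.bar.lact (op b)) K.ls K.rs K.rt
  have b₂ := Bal₃.tmul_balanced₂ (fun b : B => V.bim.bar.lact (op b)) K.ls K.rs K.rt
  have c₁ : ∀ y, IsBal (fun b : B => V.bim.bar.lact (op b)) K.ls fun z x =>
    Bal₃.tmul (fun b : B => V.bim.bar.lact (op b)) K.ls K.rs K.rt z x y :=
    fun y => .mk fun a z x => b₁ a z x y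
  have c₂ : ∀ z, IsBal K.rs K.rt fun x y =>
    Bal₃.tmul (fun b : B => V.bim.bar.lact (op b)) K.ls K.rs K.rt z x y :=
    fun z => .mk fun a x y => b₂ a z x y
  rw [sw_barδL, sw_barδR]
  · simp only [sw_barδL (c₁ _), hK.sw_ΔR_star (c₂ _), LinearEquiv.apply_symm_apply]
    refine congrArg (ofConj _) (V.sw_mixed_RL (τ := fun p x y =>
      toConj _ (Bal₃.tmul (fun b : B => V.bim.bar.lact (op b)) K.ls K.rs K.rt (toConj _ p)
        (star x) (star y))) (.mk (fun b p x y => ?_) (fun b p x y => ?_)) v)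
    · exact (isBal_barL hK (c₁ (star y))).bal b p x
    · exact (hK.isBal_star (c₂ (toConj _ p))).bal b x y
  · refine .mk fun a z X => ?_
    have := sw_barδL_bimod hK (c₁ X) 1 (unop a) z
    rw [op_one, V.bim.bar.lact_one, op_unop] at this
    rw [this]
    refine sw_congr _ fun x y => ?_
    rw [map_one, one_mul]
    exact b₂ a _ _ _
  · exact .mk fun a z X => (sw_congr _ fun x y => b₁ a z x y).trans
      (K.sw_ΔR_s_mul (c₂ z) a X).symm

theorem bar_mixed_RL (v : Conj V.carrier) :
    (sw (V.barδR v) fun p q => sw (K.Δ q) fun x y =>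
        Bal₃.tmul (fun a => V.bim.bar.ract a) K.rt K.lt K.ls p x y) =
      sw (V.barδL v) fun p q => sw (V.barδR p) fun p' q' => Bal₃.tmul _ _ _ _ p' q' q := by
  induction v using Conj.induction with | _ v
  have b₁ := Bal₃.tmul_balanced₁ (fun a => V.bim.bar.ract a) K.rt K.lt K.ls
  have b₂ := Bal₃.tmul_balanced₂ (fun a => V.bim.bar.ract a) K.rt K.lt K.ls
  have c₁ : ∀ y, IsBal (fun a => V.bim.bar.ract a) K.rt fun z x =>
    Bal₃.tmul (fun a => V.bim.bar.ract a) K.rt K.lt K.ls z x y :=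
    fun y => .mk fun a z x => b₁ a z x y
  have c₂ : ∀ z, IsBal K.lt K.ls fun x y =>
    Bal₃.tmul (fun a => V.bim.bar.ract a) K.rt K.lt K.ls z x y :=
    fun z => .mk fun a x y => b₂ a z x y
  rw [sw_barδR, sw_barδL]
  · simp only [sw_barδR (c₁ _), hK.sw_Δ_star (c₂ _), LinearEquiv.apply_symm_apply]
    refine congrArg (ofConj _) (V.sw_mixed_LR (τ := fun p x y =>
      toConj _ (Bal₃.tmul (fun a => V.bim.bar.ract a) K.rt K.lt K.ls (toConj _ p)
        (star x) (star y))) (.mk (fun b p x y => ?_) (fun b p x y => ?_)) v)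
    · exact (isBal_barR hK (c₁ (star y))).bal b p x
    · exact (hK.isBal_star' (c₂ (toConj _ p))).bal b x y
  · refine .mk fun b z X => ?_
    have := sw_barδR_bimod hK (c₁ X) (op b) 1 z
    rw [V.bim.bar.ract_one] at this
    rw [this]
    refine sw_congr _ fun x y => ?_
    rw [K.sR_one, mul_one]
    exact b₂ b _ _ _
  · exact .mk fun a z X => (sw_congr _ fun x y => b₁ a z x y).trans
      (K.sw_Δ_mul_tR (c₂ z) a X).symm

/-- For `X = S(Z)*` one has `v̄ ◁ X_[2] = (v ◁ Z_[1])‾`, while `X_[1]` multiplies as the involution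
of `S(Z_[2])`. The condition is then the conjugate of the one for `δ_L` at `Z`. -/
theorem bar_yd (v : Conj V.carrier) (X : H) :
    (sw (K.ΔR X) fun x y => sw (V.barδR (V.barMod.act y v)) fun w z =>
        Bal.tmul (fun a => V.bim.bar.ract a) K.rt w (x * z)) =
      sw (V.barδR v) fun w z => sw (K.ΔR X) fun x y =>
        Bal.tmul _ _ (V.barMod.act x w) (z * y) := by
  induction v using Conj.induction with | _ v
  obtain ⟨Z, rfl⟩ : ∃ Z, X = star (K.S Z) := ⟨K.S.symm (star X), by simp⟩
  have hT : IsBal (fun a => V.bim.bar.ract a) K.rt fun p q =>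
    Bal.tmul (fun a => V.bim.bar.ract a) K.rt p q := isBal_tmul
  have hT' : ∀ x, IsBal (fun a => V.bim.bar.ract a) K.rt fun p q =>
      Bal.tmul (fun a => V.bim.bar.ract a) K.rt p (x * q) := fun x => by
    simpa [K.sR_one] using RightRComodule.isBal_sR_mul hT x 1
  have e := isBal_sw_act_mul (mod := V.barMod) (barMod_act_sR hK) hT (star (K.S Z))
  have hl := V.sw_ydL (isBal_barR hK hT) v Z
  have hR : ∀ w z, IsBal K.rs K.rt fun x y => Bal.tmul (fun a => V.bim.bar.ract a) K.rt
      (V.barMod.act x w) (z * y) := fun w z => .mk fun a x y => by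
    rw [LinearMap.mulRight_apply, LinearMap.mulRight_apply, V.barMod.act_mul, barMod_act_sR hK,
      ← mul_assoc]
    exact Bal.tmul_balanced (fun a => V.bim.bar.ract a) K.rt _ _ _
  rw [sw_barδR e, hK.sw_ΔR_star]
  · have hψ := isBal_barR hK hT
    rw [K.sw_ΔR (isBal_ydL_left hψ v)] at hl
    have hr := fun w z => K.sw_ΔR (isBal_ydL_right hψ w z) Z
    simp only [LinearEquiv.apply_symm_apply, star_mul] at hl hr
    simp only [hK.sw_ΔR_star (hR _ _)]
    simp only [barMod_act, sw_barδR (hT' _), LinearEquiv.apply_symm_apply, star_star, hl]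
    exact congrArg (ofConj _) (sw_congr _ fun w z => hr w z)
  · refine .mk fun a x y => ?_
    have := sw_barδR_bimod hK (hT' x) a 1 (V.barMod.act y (toConj _ v))
    rw [V.bim.bar.ract_one] at this
    rw [LinearMap.mulRight_apply, LinearMap.mulRight_apply, V.barMod.act_mul, barMod_act_tR hK,
      this]
    simp only [K.sR_one, mul_one, mul_assoc]

variable (V) in
/-- The conjugate Yetter–Drinfeld module. -/
def bar : FullYD K :=
  .ofSw (Conj V.carrier) V.bim.bar V.barMod (barMod_act_tR hK) (barMod_act_sR hK)
    (barComodR hK V) (barComodL hK V) (bar_mixed_LR hK) (bar_mixed_RL hK) (bar_yd hK)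

end FullYD

end ConjugateYD

/-! ### The bar category of Yetter–Drinfeld modules -/

section YDBarCategory

variable {B H : Type u} [Ring B] [Algebra ℂ B] [StarRing B] [StarModule ℂ B]
  [Ring H] [Algebra ℂ H] [StarRing H] [StarModule ℂ H]
  {K : FullHopfAlgebroid B H} {P : Type*} [AddCommGroup P] [Module ℂ P]

open Bal Conj

namespace FullYD

variable (hK : K.IsStar) {U V W : FullYD K}

variable (V) in
/-- The antilinear bijection from a Yetter–Drinfeld module to its conjugate. -/
def barMk : V.carrier ≃ₛₗ[starRingEnd ℂ] (V.bar hK).carrier := toConj V.carrier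

@[simp] theorem barMk_smul (c : ℂ) (v : V.carrier) :
    V.barMk hK (c • v) = (starRingEnd ℂ) c • V.barMk hK v := map_smulₛₗ (V.barMk hK) c v

@[simp] theorem barMk_symm_smul (c : ℂ) (v : (V.bar hK).carrier) :
    (V.barMk hK).symm (c • v) = (starRingEnd ℂ) c • (V.barMk hK).symm v :=
  map_smulₛₗ (V.barMk hK).symm c v

/-- A linear map to a conjugate space as a linear map on the conjugate module. -/
def barDescend (f : V.carrier →ₗ[ℂ] Conj P) : (V.bar hK).carrier →ₗ[ℂ] P where
  toFun z := ofConj P (f ((V.barMk hK).symm z))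
  map_add' _ _ := by simp
  map_smul' _ _ := by simp

theorem barDescend_barMk (f : V.carrier →ₗ[ℂ] Conj P) (v : V.carrier) :
    barDescend hK f (V.barMk hK v) = ofConj P (f v) := by
  rw [barDescend, LinearMap.coe_mk, AddHom.coe_mk, LinearEquiv.symm_apply_apply]

@[elab_as_elim] theorem bar_induction {motive : (V.bar hK).carrier → Prop} (z : (V.bar hK).carrier)
    (h : ∀ v, motive (V.barMk hK v)) : motive z := h z

theorem lact_barMk (a : Bᵐᵒᵖ) (v : V.carrier) :
    (V.bar hK).bim.lact a (V.barMk hK v) = V.barMk hK (V.bim.ract (star a) v) :=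
  V.bim.bar_lact a v

theorem ract_barMk (a : Bᵐᵒᵖ) (v : V.carrier) :
    (V.bar hK).bim.ract a (V.barMk hK v) = V.barMk hK (V.bim.lact (star a) v) :=
  V.bim.bar_ract a v

theorem act_barMk (X : H) (v : V.carrier) :
    (V.bar hK).mod.act X (V.barMk hK v) = V.barMk hK (V.mod.act (K.S.symm (star X)) v) :=
  V.barMod_act X v

theorem isBal_barMkR {φ : (V.bar hK).carrier → H → P}
    (hφ : IsBal (fun a => (V.bar hK).bim.ract a) K.rt φ) :
    IsBal (fun b : B => V.bim.lact (op b)) K.ls fun p q =>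
      toConj P (φ (V.barMk hK p) (star q)) := isBal_barR hK hφ

theorem isBal_barMkL {φ : (V.bar hK).carrier → H → P}
    (hφ : IsBal (fun b : B => (V.bar hK).bim.lact (op b)) K.ls φ) :
    IsBal (fun a => V.bim.ract a) K.rt fun p q =>
      toConj P (φ (V.barMk hK p) (star q)) := isBal_barL hK hφ

theorem sw_δR_barMk {φ : (V.bar hK).carrier → H → P}
    (hφ : IsBal (fun a => (V.bar hK).bim.ract a) K.rt φ) (v : V.carrier) :
    sw ((V.bar hK).comodR.δ (V.barMk hK v)) φ =
      ofConj P (sw (V.comodL.δ v) fun p q => toConj P (φ (V.barMk hK p) (star q))) :=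
  sw_barδR hφ v

theorem sw_δL_barMk {φ : (V.bar hK).carrier → H → P}
    (hφ : IsBal (fun b : B => (V.bar hK).bim.lact (op b)) K.ls φ) (v : V.carrier) :
    sw ((V.bar hK).comodL.δ (V.barMk hK v)) φ =
      ofConj P (sw (V.comodR.δ v) fun p q => toConj P (φ (V.barMk hK p) (star q))) :=
  sw_barδL hφ v

theorem δR_barMk (v : V.carrier) : (V.bar hK).comodR.δ (V.barMk hK v) =
    ofConj _ (sw (V.comodL.δ v) fun p q =>
      toConj _ (Bal.tmul (fun a => (V.bar hK).bim.ract a) K.rt (V.barMk hK p) (star q))) := by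
  rw [← sw_δR_barMk hK isBal_tmul, sw_self]

theorem δL_barMk (v : V.carrier) : (V.bar hK).comodL.δ (V.barMk hK v) =
    ofConj _ (sw (V.comodR.δ v) fun p q => toConj _
      (Bal.tmul (fun b : B => (V.bar hK).bim.lact (op b)) K.ls (V.barMk hK p) (star q))) := by
  rw [← sw_δL_barMk hK isBal_tmul, sw_self]

theorem map_sw_barMk {I M N : Type*} [AddCommGroup M] [Module ℂ M] [AddCommGroup N] [Module ℂ N]
    {f : I → Module.End ℂ M} {g : I → Module.End ℂ N} (z : Bal f g) (ψ : M → N → V.carrier) :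
    V.barMk hK (sw z ψ) = ofConj _ (sw z fun m n => toConj _ (V.barMk hK (ψ m n))) :=
  congrArg (ofConj _) (map_sw (doubleConj V.carrier).toLinearMap z ψ)

theorem sw_δL_lin (f : V ⟶ W) {φ : W.carrier → H → P}
    (hφ : IsBal (fun b : B => W.bim.lact (op b)) K.ls φ) (v : V.carrier) :
    sw (W.comodL.δ (lin f v)) φ = sw (V.comodL.δ v) fun p q => φ (lin f p) q := by
  rw [δL_lin, sw_sw]
  exact sw_congr _ fun p q => sw_tmul hφ _ _

/-- The conjugate of a linear map. -/
def barLin (f : V.carrier →ₗ[ℂ] W.carrier) : (V.bar hK).carrier →ₗ[ℂ] (W.bar hK).carrier where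
  toFun z := W.barMk hK (f ((V.barMk hK).symm z))
  map_add' _ _ := by simp
  map_smul' _ _ := by simp

theorem barLin_barMk (f : V.carrier →ₗ[ℂ] W.carrier) (v : V.carrier) :
    barLin hK f (V.barMk hK v) = W.barMk hK (f v) := by
  rw [barLin, LinearMap.coe_mk, AddHom.coe_mk, LinearEquiv.symm_apply_apply]

theorem barLin_act (f : V ⟶ W) (X : H) (v : (V.bar hK).carrier) :
    barLin hK (lin f) ((V.bar hK).mod.act X v) = (W.bar hK).mod.act X (barLin hK (lin f) v) := by
  induction v using bar_induction hK with | _ v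
  rw [act_barMk, barLin_barMk, barLin_barMk, act_barMk, lin_act]

/-- The conjugate of a morphism. -/
def barMap (f : V ⟶ W) : V.bar hK ⟶ W.bar hK :=
  Hom.ofR (barLin hK (lin f)) (barLin_act hK f) fun v => by
    induction v using bar_induction hK with | _ v
    rw [sw_δR_barMk hK (isBal_of_act _ (barLin_act hK f)), barLin_barMk, δR_barMk,
      sw_δL_lin f (isBal_barMkR hK isBal_tmul)]
    simp only [barLin_barMk]

theorem barMap_barMk (f : V ⟶ W) (v : V.carrier) :
    lin (barMap hK f) (V.barMk hK v) = W.barMk hK (lin f v) := barLin_barMk hK (lin f) v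

theorem bar_hom_ext {f g : V.bar hK ⟶ W}
    (h : ∀ v, lin f (V.barMk hK v) = lin g (V.barMk hK v)) : f = g :=
  hom_ext_lin (LinearMap.ext h)

/-- The bar functor. -/
def barFunctor : FullYD K ⥤ FullYD K where
  obj V := V.bar hK
  map f := barMap hK f
  map_id V := bar_hom_ext hK fun v => by rw [barMap_barMk, lin_id_apply, lin_id_apply]
  map_comp f g := bar_hom_ext hK fun v => by
    rw [lin_comp_apply, barMap_barMk, barMap_barMk, barMap_barMk, lin_comp_apply]

/-! The isomorphism `(v ⊗ w)‾ ↦ w̄ ⊗ v̄`. -/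

theorem isBal_tensConj : IsBal (fun a => V.bim.ract a) (fun a => W.bim.lact a) fun v w =>
    toConj _ (tmk (W.bar hK) (V.bar hK) (W.barMk hK w) (V.barMk hK v)) :=
  .mk fun a v w => by
    have h1 := ract_barMk hK (V := W) (star a) w
    have h2 := lact_barMk hK (V := V) (star a) v
    rw [star_star] at h1 h2
    rw [← h1, ← h2, tmk_balanced]

theorem isBal_tensConjInv :
    IsBal (fun a => (W.bar hK).bim.ract a) (fun a => (V.bar hK).bim.lact a) fun w v =>
      (tens V W).barMk hK (tmk V W ((V.barMk hK).symm v) ((W.barMk hK).symm w)) :=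
  .mk fun a w v => by
    induction v using bar_induction hK with | _ v
    induction w using bar_induction hK with | _ w
    simp only [ract_barMk, lact_barMk, LinearEquiv.symm_apply_apply, tmk_balanced]

variable (V W) in
/-- The map `(v ⊗ w)‾ ↦ w̄ ⊗ v̄`. -/
def tensConj : ((tens V W).bar hK).carrier →ₗ[ℂ] (tens (W.bar hK) (V.bar hK)).carrier :=
  barDescend hK (tensLift fun v w =>
    toConj _ (tmk (W.bar hK) (V.bar hK) (W.barMk hK w) (V.barMk hK v)))

variable (V W) in
/-- The map `w̄ ⊗ v̄ ↦ (v ⊗ w)‾`. -/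
def tensConjInv : (tens (W.bar hK) (V.bar hK)).carrier →ₗ[ℂ] ((tens V W).bar hK).carrier :=
  tensLift fun w v => (tens V W).barMk hK (tmk V W ((V.barMk hK).symm v) ((W.barMk hK).symm w))

theorem tensConj_tmk (v : V.carrier) (w : W.carrier) :
    tensConj hK V W ((tens V W).barMk hK (tmk V W v w)) =
      tmk (W.bar hK) (V.bar hK) (W.barMk hK w) (V.barMk hK v) := by
  rw [tensConj, barDescend_barMk, tensLift_tmk (isBal_tensConj hK), LinearEquiv.symm_apply_apply]

theorem tensConjInv_tmk (v : V.carrier) (w : W.carrier) :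
    tensConjInv hK V W (tmk (W.bar hK) (V.bar hK) (W.barMk hK w) (V.barMk hK v)) =
      (tens V W).barMk hK (tmk V W v w) := by
  rw [tensConjInv, tensLift_tmk (isBal_tensConjInv hK), LinearEquiv.symm_apply_apply,
    LinearEquiv.symm_apply_apply]

@[elab_as_elim] theorem bar_tens_induction {motive : ((tens V W).bar hK).carrier → Prop}
    (z : ((tens V W).bar hK).carrier) (tmk : ∀ v w, motive ((tens V W).barMk hK (tmk V W v w)))
    (add : ∀ x y, motive x → motive y → motive (x + y)) : motive z := by
  induction z using bar_induction hK with | _ z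
  induction z using tens_induction with
  | tmk v w => exact tmk v w
  | add x y hx hy => rw [map_add]; exact add _ _ hx hy

@[elab_as_elim] theorem tens_bar_induction
    {motive : (tens (W.bar hK) (V.bar hK)).carrier → Prop}
    (z : (tens (W.bar hK) (V.bar hK)).carrier)
    (tmk : ∀ w v, motive (tmk (W.bar hK) (V.bar hK) (W.barMk hK w) (V.barMk hK v)))
    (add : ∀ x y, motive x → motive y → motive (x + y)) : motive z := by
  induction z using tens_induction with
  | tmk w v =>
    induction v using bar_induction hK with | _ v
    induction w using bar_induction hK with | _ w
    exact tmk w v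
  | add x y hx hy => exact add _ _ hx hy

/-- The action of `X` on a conjugate is that of `S⁻¹(X*)` before conjugation. The involution sends
`Δ` to `Δ_R` in the same order and `S⁻¹` reverses the components, matching the exchange of the
tensor factors. -/
theorem tensConj_act (X : H) (z : ((tens V W).bar hK).carrier) :
    tensConj hK V W (((tens V W).bar hK).mod.act X z) =
      (tens (W.bar hK) (V.bar hK)).mod.act X (tensConj hK V W z) := by
  induction z using bar_tens_induction hK with
  | add x y hx hy => simp only [map_add, hx, hy]
  | tmk v w =>
    obtain ⟨Z, rfl⟩ : ∃ Z, X = star (K.S Z) := ⟨K.S.symm (star X), by simp⟩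
    rw [act_barMk, tensConj_tmk, act_tmk, act_tmk, hK.sw_ΔR_star (isBal_tmk_act _ _), map_sw_barMk,
      star_star, LinearEquiv.symm_apply_apply, map_ofConj_sw, K.sw_ΔR (.mk fun a x y => ?_)]
    · simp only [act_barMk, map_toConj, tensConj_tmk, star_star]
    · exact congrArg (fun z => Conj.map (tensConj hK V W) (toConj _ ((tens V W).barMk hK z)))
        ((isBal_tmk_act v w).bal a x y)

/-- The involution reverses the product `v_(1) w_(1)`, in agreement with the reversed tensor
factors. The nesting chosen for `δ_L`, with `W` outside, makes both sides match without an exchange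
of sums. -/
theorem δR_tensConj (z : ((tens V W).bar hK).carrier) :
    (tens (W.bar hK) (V.bar hK)).comodR.δ (tensConj hK V W z) =
      sw (((tens V W).bar hK).comodR.δ z) fun p q => Bal.tmul _ _ (tensConj hK V W p) q := by
  induction z using bar_tens_induction hK with
  | add x y hx hy => simp only [map_add, sw_add, hx, hy]
  | tmk v w =>
    have h := isBal_of_act _ (tensConj_act hK (V := V) (W := W))
    rw [sw_δR_barMk hK h, sw_δL_tmk (isBal_barMkR hK h)]
    simp only [tensConj_tmk, star_mul]
    have h1 := isBal_tmkR_left (V := W.bar hK) (W := V.bar hK) isBal_tmul 1 (V.barMk hK v)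
    simp only [one_mul] at h1
    rw [δR_tmk, sw_δR_barMk hK h1]
    simp only [sw_δR_barMk hK (isBal_tmkR_right (V := W.bar hK) (W := V.bar hK) isBal_tmul _ _),
      LinearEquiv.apply_symm_apply]

variable (V W) in
/-- The isomorphism `(v ⊗ w)‾ ↦ w̄ ⊗ v̄`. -/
def tensConjIso : (tens V W).bar hK ≅ tens (W.bar hK) (V.bar hK) :=
  isoOfInverse (Hom.ofR (tensConj hK V W) (tensConj_act hK) (δR_tensConj hK)) (tensConjInv hK V W)
    (fun z => by
      rw [lin_ofR]
      induction z using bar_tens_induction hK with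
      | add x y hx hy => simp only [map_add, hx, hy]
      | tmk v w => rw [tensConj_tmk, tensConjInv_tmk])
    (fun z => by
      rw [lin_ofR]
      induction z using tens_bar_induction hK with
      | add x y hx hy => simp only [map_add, hx, hy]
      | tmk v w => rw [tensConjInv_tmk, tensConj_tmk])

theorem tensConjIso_hom_tmk (v : V.carrier) (w : W.carrier) :
    lin (tensConjIso hK V W).hom ((tens V W).barMk hK (tmk V W v w)) =
      tmk (W.bar hK) (V.bar hK) (W.barMk hK w) (V.barMk hK v) := tensConj_tmk hK v w

theorem tensConjIso_inv_tmk (v : V.carrier) (w : W.carrier) :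
    lin (tensConjIso hK V W).inv (tmk (W.bar hK) (V.bar hK) (W.barMk hK w) (V.barMk hK v)) =
      (tens V W).barMk hK (tmk V W v w) := tensConjInv_tmk hK v w

/-! The isomorphisms `a ↦ (a*)‾` and `v ↦ v̄̄`. -/

/-- The map `a ↦ (a*)‾`. -/
def unitConj : K.unitYD.carrier →ₗ[ℂ] (K.unitYD.bar hK).carrier where
  toFun a := K.unitYD.barMk hK (unitEquiv K (star ((unitEquiv K).symm a)))
  map_add' _ _ := by simp only [map_add, star_add]
  map_smul' c a := by
    rw [map_smul, star_smul, map_smul, map_smulₛₗ]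
    simp

theorem unitConj_unitEquiv (a : Bᵐᵒᵖ) :
    unitConj hK (unitEquiv K a) = K.unitYD.barMk hK (unitEquiv K (star a)) := rfl

/-- The map `ā ↦ a*`. -/
def unitConjInv : (K.unitYD.bar hK).carrier →ₗ[ℂ] K.unitYD.carrier where
  toFun z := unitEquiv K (star ((unitEquiv K).symm ((K.unitYD.barMk hK).symm z)))
  map_add' _ _ := by simp only [map_add, star_add]
  map_smul' _ _ := by simp

theorem unitConjInv_barMk (a : Bᵐᵒᵖ) :
    unitConjInv hK (K.unitYD.barMk hK (unitEquiv K a)) = unitEquiv K (star a) := by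
  rw [unitConjInv, LinearMap.coe_mk, AddHom.coe_mk, LinearEquiv.symm_apply_apply,
    LinearEquiv.symm_apply_apply]

theorem unitConj_act (X : H) (z : K.unitYD.carrier) :
    unitConj hK (K.unitYD.mod.act X z) = (K.unitYD.bar hK).mod.act X (unitConj hK z) := by
  induction z using unit_induction with | _ a
  rw [act_unitEquiv, unitConj_unitEquiv, unitConj_unitEquiv, act_barMk, act_unitEquiv]
  congr 2
  rw [← hK.ε_star, star_mul, hK.star_sR, FullHopfAlgebroid.εR, K.S_mul,
    LinearEquiv.apply_symm_apply, K.S_sR]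
  -- The two sides are `ε_L(X* t_L(b))` and `ε_L(X* s_L(b))` with `b = a*`; they agree since
  -- `ε_L(s_L(b)) = b`.
  have := K.ε_mul_t (star X) (K.s (unop (star a)))
  rw [K.ε_s] at this
  exact congrArg op this.symm

theorem δR_unitConj (z : K.unitYD.carrier) :
    (K.unitYD.bar hK).comodR.δ (unitConj hK z) =
      sw (K.unitYD.comodR.δ z) fun p q => Bal.tmul _ _ (unitConj hK p) q := by
  induction z using unit_induction with | _ a
  rw [sw_δR_unitEquiv (isBal_of_act _ (unitConj_act hK)), unitConj_unitEquiv, unitConj_unitEquiv,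
    δR_barMk, δL_unitEquiv, sw_tmul (isBal_barMkR hK isBal_tmul), LinearEquiv.symm_apply_apply,
    star_one]
  congr 1
  exact (hK.star_sR _).trans (by rw [star_star])

variable (K) in
/-- The isomorphism `a ↦ (a*)‾` from the unit object to its conjugate. -/
def unitConjIso : K.unitYD ≅ K.unitYD.bar hK :=
  isoOfInverse (Hom.ofR (unitConj hK) (unitConj_act hK) (δR_unitConj hK))
    (unitConjInv hK)
    (fun z => by
      induction z using unit_induction with | _ a
      rw [lin_ofR, unitConj_unitEquiv, unitConjInv_barMk, star_star])
    (fun z => by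
      induction z using bar_induction hK with | _ z
      induction z using unit_induction with | _ a
      rw [lin_ofR, unitConjInv_barMk, unitConj_unitEquiv, star_star])

theorem unitConjIso_hom (a : Bᵐᵒᵖ) :
    lin (unitConjIso K hK).hom (unitEquiv K a) = K.unitYD.barMk hK (unitEquiv K (star a)) :=
  unitConj_unitEquiv hK a

theorem unitConjIso_inv (a : Bᵐᵒᵖ) :
    lin (unitConjIso K hK).inv (K.unitYD.barMk hK (unitEquiv K a)) = unitEquiv K (star a) :=
  unitConjInv_barMk hK a

variable (V) in
/-- The isomorphism `v ↦ v̄̄`. -/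
def barBarIso : V ≅ (V.bar hK).bar hK :=
  isoOfInverse (Hom.ofR (doubleConj V.carrier).toLinearMap
    (fun X v => by
      show (V.bar hK).barMk hK (V.barMk hK (V.mod.act X v)) =
        ((V.bar hK).bar hK).mod.act X ((V.bar hK).barMk hK (V.barMk hK v))
      -- On the double conjugate `X` acts through `S⁻¹((S⁻¹(X*))*) = S⁻¹(S(X))`.
      rw [act_barMk, act_barMk, hK.star_S_symm_star, LinearEquiv.symm_apply_apply])
    (fun v => by
      show ((V.bar hK).bar hK).comodR.δ ((V.bar hK).barMk hK (V.barMk hK v)) = _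
      rw [δR_barMk, sw_δL_barMk hK (isBal_barMkR hK isBal_tmul)]
      simp only [star_star]
      exact congrArg (fun z => ofConj _ (ofConj _ z)) (map_sw (doubleConj _).toLinearMap (V.comodR.δ v)
        fun p q => Bal.tmul (fun a => ((V.bar hK).bar hK).bim.ract a) K.rt
          ((V.bar hK).barMk hK (V.barMk hK p)) q).symm)) (doubleConj V.carrier).symm.toLinearMap
    (fun _ => rfl) (fun _ => rfl)

theorem barBarIso_hom (v : V.carrier) :
    lin (barBarIso hK V).hom v = (V.bar hK).barMk hK (V.barMk hK v) := rfl

end FullYD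

end YDBarCategory

/-! ### The bar category of Yetter–Drinfeld modules -/

section YDBarCategory

variable {B H : Type u} [Ring B] [Algebra ℂ B] [StarRing B] [StarModule ℂ B]
  [Ring H] [Algebra ℂ H] [StarRing H] [StarModule ℂ H]
  {K : FullHopfAlgebroid B H}

open Bal Conj

namespace FullYD

variable (hK : K.IsStar) {U V W : FullYD K}

theorem bar_tens_hom_ext {f g : (tens V W).bar hK ⟶ U}
    (h : ∀ v w, lin f ((tens V W).barMk hK (tmk V W v w)) =
      lin g ((tens V W).barMk hK (tmk V W v w))) : f = g :=
  hom_ext_lin (LinearMap.ext fun z => by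
    induction z using bar_tens_induction hK with
    | tmk v w => exact h v w
    | add x y hx hy => simp only [map_add, hx, hy])

theorem tensConjIso_naturality {V' W' : FullYD K} (f : V ⟶ V') (g : W ⟶ W') :
    barMap hK (tensMap f g) ≫ (tensConjIso hK V' W').hom =
      (tensConjIso hK V W).hom ≫ tensMap (barMap hK g) (barMap hK f) :=
  bar_tens_hom_ext hK fun v w => by
    simp only [lin_comp_apply, barMap_barMk, tensMap_tmk, tensConjIso_hom_tmk]

theorem tensConjIso_assoc :
    (tensConjIso hK (tens U V) W).hom ≫ tensMap (𝟙 (W.bar hK)) (tensConjIso hK U V).hom =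
      barMap hK (assocIso U V W).hom ≫ (tensConjIso hK U (tens V W)).hom ≫
        tensMap (tensConjIso hK V W).hom (𝟙 (U.bar hK)) ≫
          (assocIso (W.bar hK) (V.bar hK) (U.bar hK)).hom :=
  bar_tens_hom_ext hK fun z w => by
    induction z using tens_induction with
    | add x y hx hy => simp only [map_add, LinearMap.add_apply, hx, hy]
    | tmk u v =>
      simp only [lin_comp_apply, barMap_barMk, tensMap_tmk, tensConjIso_hom_tmk, assocIso_hom_tmk,
        lin_id_apply]

theorem tensConjIso_unit_left :
    (tensConjIso hK K.unitYD V).hom ≫ tensMap (𝟙 (V.bar hK)) (unitConjIso K hK).inv ≫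
      (rightUnitIso (V.bar hK)).hom = barMap hK (leftUnitIso V).hom :=
  bar_tens_hom_ext hK fun a v => by
    induction a using unit_induction with | _ a
    simp only [lin_comp_apply, barMap_barMk, tensMap_tmk, tensConjIso_hom_tmk, lin_id_apply,
      unitConjIso_inv, rightUnitIso_hom_tmk, leftUnitIso_hom_tmk, ract_barMk, star_star]

theorem tensConjIso_unit_right :
    (tensConjIso hK V K.unitYD).hom ≫ tensMap (unitConjIso K hK).inv (𝟙 (V.bar hK)) ≫
      (leftUnitIso (V.bar hK)).hom = barMap hK (rightUnitIso V).hom :=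
  bar_tens_hom_ext hK fun v a => by
    induction a using unit_induction with | _ a
    simp only [lin_comp_apply, barMap_barMk, tensMap_tmk, tensConjIso_hom_tmk, lin_id_apply,
      unitConjIso_inv, rightUnitIso_hom_tmk, leftUnitIso_hom_tmk, lact_barMk, star_star]

theorem unitConjIso_bar :
    (unitConjIso K hK).hom ≫ barMap hK (unitConjIso K hK).hom = (barBarIso hK K.unitYD).hom :=
  hom_ext_lin (LinearMap.ext fun a => by
    induction a using unit_induction with | _ a
    rw [lin_comp_apply, unitConjIso_hom, barMap_barMk, unitConjIso_hom, barBarIso_hom, star_star])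

/-- On `v̄ ⊗ w̄` the braiding uses `δ_R(w̄)`, made from `w_(0)` and `w_(1)*`, and the conjugate
action of `w_(1)*` is that of `S⁻¹(w_(1))`. The result is the conjugate of `v ◁ S⁻¹(w_(1)) ⊗ w_(0)`,
the inverse braiding of `w ⊗ v`. -/
theorem braidIso_antireal :
    (braidIso (V.bar hK) (W.bar hK)).hom ≫ (tensConjIso hK V W).inv =
      (tensConjIso hK W V).inv ≫ barMap hK (braidIso V W).inv :=
  tens_hom_ext fun v w => by
    induction v using bar_induction hK with | _ v
    induction w using bar_induction hK with | _ w
    rw [lin_comp_apply, lin_comp_apply, braidIso_hom_tmk, tensConjIso_inv_tmk, barMap_barMk,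
      braidIso_inv_tmk, sw_δR_barMk hK (isBal_braid _), map_ofConj_sw, map_sw_barMk]
    simp only [act_barMk, star_star, map_toConj, tensConjIso_inv_tmk]

end FullYD

open FullYD

variable (hK : K.IsStar)

/-- The bar category of Yetter–Drinfeld modules of a full `*`-Hopf algebroid. -/
def ydBarCategory : BarCategory (FullYD K) where
  bar := barFunctor hK
  Υ := tensConjIso hK
  Υ_natural f g := tensConjIso_naturality hK f g
  starIso := unitConjIso K hK
  Υ_assoc _ _ _ := tensConjIso_assoc hK
  Υ_unit_left _ := tensConjIso_unit_left hK
  Υ_unit_right _ := tensConjIso_unit_right hK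
  bb := NatIso.ofComponents (barBarIso hK) fun f => hom_ext_lin (LinearMap.ext fun v => by
    exact (lin_comp_apply _ _ _).trans ((barBarIso_hom hK _).trans (Eq.symm
      ((lin_comp_apply _ _ _).trans ((congrArg _ (barBarIso_hom hK v)).trans
        ((barMap_barMk hK _ _).trans (congrArg _ (barMap_barMk hK _ _))))))))
  star_star := unitConjIso_bar hK
  bar_bb _ := bar_hom_ext hK fun v => barMap_barMk hK _ v

/-- The bar category is the one of conjugates. -/
def ydBarOfConjugates : BarOfConjugates (tensorOverBase K) (ydBarCategory hK) where
  c V := V.barMk hK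
  lact_c _ a v := lact_barMk hK a v
  ract_c _ a v := ract_barMk hK a v
  act_c _ X v := act_barMk hK X v
  δR_c V v n p q h := by
    refine (δR_barMk hK v).trans ((congrArg (ofConj _)
      (h.sw_eq (isBal_barMkR hK isBal_tmul))).trans ?_)
    simp
    rfl
  δL_c V v n p q h := by
    refine (δL_barMk hK v).trans ((congrArg (ofConj _)
      (h.sw_eq (isBal_barMkL hK isBal_tmul))).trans ?_)
    simp
    rfl
  map_c f v := barMap_barMk hK f v
  Υ_c _ _ v w := tensConjIso_hom_tmk hK v w
  star_c a := unitConjIso_hom hK a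
  bb_c _ v := barBarIso_hom hK v

theorem ydBarCategory_isAntireal : (ydBarCategory hK).IsAntireal :=
  fun _ _ => braidIso_antireal hK

end YDBarCategory

end

theorem theorem3p15 {B H : Type u} [Ring B] [Algebra ℂ B] [StarRing B] [StarModule ℂ B]
    [Ring H] [Algebra ℂ H] [StarRing H] [StarModule ℂ H]
    (K : FullHopfAlgebroid B H) (hK : K.IsStar) :
    ∃ (_ : MonoidalCategory (FullYD K)) (T : TensorOverBase K)
      (_ : BraidedCategory (FullYD K)) (b : BarCategory (FullYD K)) (_ : BarOfConjugates T b),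
      IsYDBraiding T ∧ b.IsAntireal :=
  ⟨inferInstance, tensorOverBase K, inferInstance, ydBarCategory hK, ydBarOfConjugates hK,
    FullYD.isYDBraiding, ydBarCategory_isAntireal hK⟩
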